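/- Let $p\ge 3$ be a prime. Let $R$ be a perfectoid ring, with a presentation $R\cong W(S)/\xi$, where $S$ is a perfect ring of characteristic $p$ and $\xi=(\xi_0,\xi_1,\dots)\in W(S)$ is distinguished, i.e. $\xi_1\in S$ is a unit and $S$ is $\xi_0$-adically complete. A frame $(A,I,A/I,\sigma,\sigma_1)$ consists of a ring $A$, an ideal $I$ with $pA+I\subseteq \mathrm{Rad}(A)$, a ring endomorphism $\sigma$ of $A$ with $\sigma(a)\equiv a^p$ mod $pA$, and a $\sigma$-linear map $\sigma_1:I\to A$ whose image generates the unit ideal. A window over it is $(M,Q,F,F_1)$ where $M$ is a finite projective $A$-module, $Q\subseteq M$ is a submodule such that $M=L\oplus T$ and $Q=L\oplus IT$ for some submodules $L,T$, and $F:M\to M$, $F_1:Q\to M$ are $\sigma$-linear with $F_1(ax)=\sigma_1(a)F(x)$ for $a\in I$, $x\in M$, and such that $F_1(Q)$ generates $M$. Morphisms of windows are $A$-linear maps that preserve $Q$ and commute with $F$ and $F_1$. A frame homomorphism $\alpha:(A,I,\sigma,\sigma_1)\to(A',I',\sigma',\sigma_1')$ is a ring homomorphism $\alpha:A\to A'$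 with $\alpha(I)\subseteq I'$, $\sigma'\alpha=\alpha\sigma$ and $\sigma_1'\alpha=u\cdot\alpha\sigma_1$ for a unit $u\in A'$. It induces a base change functor $\alpha^*$ on windows: $M'=A'\otimes_A M$, $Q'$ is generated by the images of $Q$ and $I'M'$, $F'(s\otimes x)=\sigma'(s)\otimes F(x)$, and $F_1'(s\otimes x)=\sigma'(s)u\otimes F_1(x)$ for $x\in Q$, $F_1'(ay)=\sigma_1'(a)F'(y)$ for $a\in I'$, $y\in M'$. Let $A_{\inf}(R)=W(S)$ with its Frobenius $\sigma$, with the frame structure given by the ideal $\xi W(S)=\mathrm{Ker}(W(S)\to R)$ and $\sigma_1(\xi a)=\sigma(a)$. Let $A_{\mathrm{cris}}(R)\to R$ be the universal $p$-adic divided power extension of $R$, i.e. $A_{\mathrm{cris}}(R)$ is the $p$-adic completion of the divided power envelope of $\mathrm{Ker}(W(S)\to R/p)$ in $W(S)$ relative to $p\mathbb Z_p$, with the endomorphism $\sigma$ induced by the Frobenius of $W(S)$. Then $A_{\mathrm{cris}}(R)$ is $p$-torsion free, and $A_{\mathrm{cris}}(R)$ with the ideal $\mathrm{Ker}(A_{\mathrm{cris}}(R)\to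 R)$, with $\sigma$, and with $\sigma_1=p^{-1}\sigma$ is a frame. The natural ring homomorphism $A_{\inf}(R)\to A_{\mathrm{cris}}(R)$ is a homomorphism of frames $\lambda$, and the base change functor $\lambda^*$ from windows over $A_{\inf}(R)$ to windows over $A_{\mathrm{cris}}(R)$ is an equivalence of categories. -/

import Mathlib

open scoped TensorProduct
open CategoryTheory

universe u v

/-- A frame `(A, I, A / I, σ, σ₁)` (relative to the prime `p`): `σ` is a Frobenius lift on `A`,
`σ₁ : I → A` is `σ`-linear and its image generates the unit ideal, and `pA + I` is contained in
the Jacobson radical of `A`. -/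
structure WindowFrame (p : ℕ) (A : Type u) [CommRing A] (I : Ideal A) where
  σ : A →+* A
  σ₁ : I →ₛₗ[σ] A
  le_rad : I ≤ Ideal.jacobson ⊥
  p_mem_rad : (p : A) ∈ Ideal.jacobson (⊥ : Ideal A)
  frobenius_lift : ∀ a : A, σ a - a ^ p ∈ Ideal.span {(p : A)}
  span_range : Ideal.span (Set.range σ₁) = ⊤

/-- A window `(M, Q, F, F₁)` over a frame: `M` is a finite projective `A`-module, `Q ⊆ M` is a
submodule which contains `I M` and has a normal decomposition `M = L ⊕ T`, `Q = L ⊕ I T`, and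
`F : M → M`, `F₁ : Q → M` are `σ`-linear maps such that `F₁ (a x) = σ₁ a • F x` for `a ∈ I` and
such that the image of `F₁` generates `M`. -/
structure Window {p : ℕ} {A : Type u} [CommRing A] {I : Ideal A} (𝓕 : WindowFrame p A I) where
  M : Type u
  [addCommGroup : AddCommGroup M]
  [module : Module A M]
  [finite : Module.Finite A M]
  [projective : Module.Projective A M]
  Q : Submodule A M
  smul_mem : I • (⊤ : Submodule A M) ≤ Q
  normal : ∃ L T : Submodule A M, IsCompl L T ∧ Q = L ⊔ I • T
  F : M →ₛₗ[𝓕.σ] M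
  F₁ : Q →ₛₗ[𝓕.σ] M
  F₁_smul : ∀ (a : I) (x : M),
    F₁ ⟨(a : A) • x, smul_mem (Submodule.smul_mem_smul a.2 trivial)⟩ = 𝓕.σ₁ a • F x
  span_range : Submodule.span A (Set.range F₁) = ⊤

namespace Window

attribute [instance] addCommGroup module finite projective

variable {p : ℕ} {A : Type u} [CommRing A] {I : Ideal A} {𝓕 : WindowFrame p A I}

/-- Homomorphisms of windows: linear maps that preserve `Q` and commute with `F` and `F₁`. -/
@[ext]
structure Hom (X Y : Window 𝓕) where
  f : X.M →ₗ[A] Y.M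
  map_mem : ∀ x ∈ X.Q, f x ∈ Y.Q
  comm_F : ∀ x, f (X.F x) = Y.F (f x)
  comm_F₁ : ∀ x : X.Q, f (X.F₁ x) = Y.F₁ ⟨f x, map_mem x x.2⟩

instance : Category (Window 𝓕) where
  Hom := Hom
  id X := ⟨LinearMap.id, fun _ h => h, fun _ => rfl, fun _ => rfl⟩
  comp g h := ⟨h.f ∘ₗ g.f, fun x hx => h.map_mem _ (g.map_mem x hx),
    fun x => by simp [g.comm_F, h.comm_F],
    fun x => by simp [g.comm_F₁, h.comm_F₁]⟩

@[simp] lemma id_f (X : Window 𝓕) : (𝟙 X : X ⟶ X).f = LinearMap.id := rfl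
@[simp] lemma comp_f {X Y Z : Window 𝓕} (g : X ⟶ Y) (h : Y ⟶ Z) : (g ≫ h).f = h.f ∘ₗ g.f := rfl
lemma hom_ext {X Y : Window 𝓕} {g h : X ⟶ Y} (e : g.f = h.f) : g = h := Hom.ext e

end Window

/-- The structure of a frame homomorphism on the ring homomorphism `algebraMap A A'`: it maps `I`
to `I'`, commutes with `σ`, and commutes with `σ₁` up to the unit `u`. -/
structure WindowFrame.Hom {p : ℕ} {A A' : Type u} [CommRing A] [CommRing A'] [Algebra A A']
    {I : Ideal A} {I' : Ideal A'} (𝓕 : WindowFrame p A I) (𝓕' : WindowFrame p A' I') where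
  u : A'ˣ
  map_mem : ∀ a ∈ I, algebraMap A A' a ∈ I'
  comm_σ : ∀ a, 𝓕'.σ (algebraMap A A' a) = algebraMap A A' (𝓕.σ a)
  comm_σ₁ : ∀ a : I, 𝓕'.σ₁ ⟨algebraMap A A' a, map_mem a a.2⟩ = u * algebraMap A A' (𝓕.σ₁ a)

section DualBasis
variable {p : ℕ} {A : Type u} [CommRing A] {I : Ideal A} (𝓕 : WindowFrame p A I)
  {M : Type u} [AddCommGroup M] [Module A M]

/-- For a projective module `M` and a `σ`-linear map `F` there is a `σ`-linear map on `I M`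
with `a x ↦ σ₁ a • F x`. -/
lemma exists_semilinear [Module.Projective A M] (F : M →ₛₗ[𝓕.σ] M) :
    ∃ K : (I • (⊤ : Submodule A M) : Submodule A M) →ₛₗ[𝓕.σ] M,
      ∀ (a : I) (x : M), K ⟨(a : A) • x, Submodule.smul_mem_smul a.2 trivial⟩ = 𝓕.σ₁ a • F x := by
  obtain ⟨s, hs⟩ := Module.projective_def'.1 (inferInstance : Module.Projective A M)
  have hs' : ∀ x, Finsupp.linearCombination A id (s x) = x := fun x => LinearMap.congr_fun hs x
  have hmem : ∀ (z : (I • (⊤ : Submodule A M) : Submodule A M)) (m : M), s z m ∈ I := by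
    rintro ⟨z, hz⟩ m
    change s z m ∈ I
    refine Submodule.smul_induction_on (p := fun z => s z m ∈ I) hz ?_ ?_
    · intro a ha x _
      simpa using I.mul_mem_right _ ha
    · intro x y hx hy
      simpa using I.add_mem hx hy
  let K0 : (I • (⊤ : Submodule A M) : Submodule A M) → M := fun z =>
    ∑ m ∈ (s z).support, 𝓕.σ₁ ⟨s z m, hmem z m⟩ • F m
  have hK0 : ∀ (z : (I • (⊤ : Submodule A M) : Submodule A M)) (t : Finset M), (s z).support ⊆ t →
      K0 z = ∑ m ∈ t, 𝓕.σ₁ ⟨s z m, hmem z m⟩ • F m := by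
    intro z t ht
    refine Finset.sum_subset ht ?_
    intro m _ hm
    have h0 : (⟨s z m, hmem z m⟩ : I) = 0 := Subtype.ext (by simpa using hm)
    rw [h0, map_zero, zero_smul]
  classical
  refine ⟨{ toFun := K0, map_add' := ?_, map_smul' := ?_ }, ?_⟩
  · intro x y
    rw [hK0 (x + y) ((s x).support ∪ (s y).support ∪ (s (x+y : M)).support) (by
        intro m hm; simp only [Finset.mem_union]; right; simpa using hm),
      hK0 x ((s x).support ∪ (s y).support ∪ (s (x+y : M)).support) (by
        intro m hm; simp only [Finset.mem_union]; left; left; simpa using hm),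
      hK0 y ((s x).support ∪ (s y).support ∪ (s (x+y : M)).support) (by
        intro m hm; simp only [Finset.mem_union]; left; right; simpa using hm),
      ← Finset.sum_add_distrib]
    refine Finset.sum_congr rfl fun m _ => ?_
    rw [← add_smul, ← map_add]
    congr 2
    exact Subtype.ext (by simp)
  · intro c x
    rw [hK0 (c • x) ((s x).support ∪ (s (c • x : M)).support) (by
        intro m hm; simp only [Finset.mem_union]; right; simpa using hm),
      hK0 x ((s x).support ∪ (s (c • x : M)).support) (by
        intro m hm; simp only [Finset.mem_union]; left; simpa using hm), Finset.smul_sum]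
    refine Finset.sum_congr rfl fun m _ => ?_
    have : (⟨s (c • x : (I • (⊤ : Submodule A M) : Submodule A M)) m, hmem _ m⟩ : I)
        = c • ⟨s x m, hmem x m⟩ := Subtype.ext (by simp)
    rw [this, map_smulₛₗ, smul_assoc]
  · intro a x
    change K0 _ = _
    rw [hK0 _ (s x).support (by
        intro m hm
        have := Finsupp.support_smul (b := (a : A)) (g := s x)
        apply this
        simpa using! hm)]
    conv_rhs => rw [← hs' x, Finsupp.linearCombination_apply, Finsupp.sum, map_sum, Finset.smul_sum]
    refine Finset.sum_congr rfl fun m _ => ?_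
    have : (⟨s ((a : A) • x) m, hmem ⟨(a : A) • x, Submodule.smul_mem_smul a.2 trivial⟩ m⟩ : I)
        = (s x m) • a := Subtype.ext (by simp [mul_comm])
    change 𝓕.σ₁ ⟨s ((a : A) • x) m, _⟩ • _ = _
    rw [this, map_smulₛₗ, id, map_smulₛₗ, smul_smul, smul_eq_mul, mul_comm]

end DualBasis

namespace WindowFrame.Hom

variable {p : ℕ} {A A' : Type u} [CommRing A] [CommRing A'] [Algebra A A']
    {I : Ideal A} {I' : Ideal A'} {𝓕 : WindowFrame p A I} {𝓕' : WindowFrame p A' I'} (α : WindowFrame.Hom 𝓕 𝓕')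

/-- For `σ`-linear `G`, the `σ'`-linear map `s ⊗ x ↦ σ' s ⊗ G x`. -/
noncomputable def tensorMap {M N : Type u} [AddCommGroup M] [Module A M] [AddCommGroup N] [Module A N]
    (G : M →ₛₗ[𝓕.σ] N) : A' ⊗[A] M →ₛₗ[𝓕'.σ] A' ⊗[A] N :=
  let σA : A' →ₛₗ[𝓕.σ] A' :=
    { toFun := 𝓕'.σ
      map_add' := map_add _
      map_smul' := fun a s => by rw [Algebra.smul_def, map_mul, α.comm_σ]; exact (Algebra.smul_def _ _).symm }
  { toFun := TensorProduct.map σA G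
    map_add' := map_add _
    map_smul' := fun c y => by
      induction y with
      | zero => simp
      | add x y hx hy => rw [smul_add, map_add, hx, hy, map_add, smul_add]
      | tmul s x =>
        rw [TensorProduct.smul_tmul', TensorProduct.map_tmul, TensorProduct.map_tmul,
          TensorProduct.smul_tmul', smul_eq_mul, smul_eq_mul]
        congr 1
        exact map_mul 𝓕'.σ c s }

@[simp] lemma tensorMap_tmul {M N : Type u} [AddCommGroup M] [Module A M] [AddCommGroup N]
    [Module A N] (G : M →ₛₗ[𝓕.σ] N) (s : A') (x : M) :
    α.tensorMap G (s ⊗ₜ[A] x) = 𝓕'.σ s ⊗ₜ[A] G x := rfl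

variable (X : Window 𝓕)

/-- The submodule of `A' ⊗ M` generated by the image of `Q` and `I' (A' ⊗ M)`. -/
noncomputable def baseQ (I' : Ideal A') : Submodule A' (A' ⊗[A] X.M) :=
  X.Q.baseChange A' ⊔ I' • ⊤

lemma tmul_mem_baseQ (s : A') {x : X.M} (hx : x ∈ X.Q) : s ⊗ₜ[A] x ∈ baseQ X I' :=
  Submodule.mem_sup_left (Submodule.tmul_mem_baseChange_of_mem s hx)

lemma smul_mem_baseQ (a : I') (y : A' ⊗[A] X.M) : (a : A') • y ∈ baseQ X I' :=
  Submodule.mem_sup_right (Submodule.smul_mem_smul a.2 trivial)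

lemma map_smul_top_le (α : WindowFrame.Hom 𝓕 𝓕') (X : Window 𝓕) : (I • (⊤ : Submodule A X.M)).baseChange A' ≤ I' • ⊤ := by
  rw [Submodule.baseChange_eq_span, Submodule.span_le]
  rintro _ ⟨x, hx, rfl⟩
  refine Submodule.smul_induction_on hx ?_ ?_
  · intro a ha x _
    simp only [TensorProduct.mk_apply, TensorProduct.tmul_smul]
    rw [← algebraMap_smul A' a]
    exact Submodule.smul_mem_smul (α.map_mem a ha) trivial
  · intro x y hx hy
    simpa [TensorProduct.tmul_add] using Submodule.add_mem _ hx hy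

lemma cross (a : I') (x : X.Q) :
    (α.u * 𝓕'.σ a : A') ⊗ₜ[A] X.F₁ x = 𝓕'.σ₁ a ⊗ₜ[A] X.F (x : X.M) := by
  have key : ∀ c ∈ Ideal.span (Set.range 𝓕.σ₁),
      algebraMap A A' c • ((α.u * 𝓕'.σ a : A') ⊗ₜ[A] X.F₁ x - 𝓕'.σ₁ a ⊗ₜ[A] X.F (x : X.M)) = 0 := by
    intro c hc
    induction hc using Submodule.span_induction with
    | zero => simp
    | add x y _ _ hx hy => rw [map_add, add_smul, hx, hy, add_zero]
    | smul r x _ hx => rw [smul_eq_mul, map_mul, mul_smul, hx, smul_zero]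
    | mem c hc =>
      obtain ⟨b, rfl⟩ := hc
      have e1 : algebraMap A A' (𝓕.σ₁ b) * (α.u * 𝓕'.σ a) = algebraMap A A' (𝓕.σ b) * 𝓕'.σ₁ a := by
        have h1 : 𝓕'.σ a * 𝓕'.σ₁ ⟨algebraMap A A' b, α.map_mem b b.2⟩
            = 𝓕'.σ (algebraMap A A' b) * 𝓕'.σ₁ a := by
          rw [← smul_eq_mul, ← smul_eq_mul, ← map_smulₛₗ, ← map_smulₛₗ]
          congr 1
          exact Subtype.ext (by simpa [Algebra.smul_def] using! mul_comm _ _)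
        rw [α.comm_σ₁, α.comm_σ] at h1
        rw [← h1]; ring
      have e2 : 𝓕.σ₁ b • X.F (x : X.M) = 𝓕.σ b • X.F₁ x := by
        rw [← X.F₁_smul, ← map_smulₛₗ]; rfl
      rw [smul_sub, sub_eq_zero, TensorProduct.smul_tmul', TensorProduct.smul_tmul',
        smul_eq_mul, smul_eq_mul, e1, ← Algebra.smul_def, TensorProduct.smul_tmul, ← e2,
        ← TensorProduct.smul_tmul, ← Algebra.smul_def]
  have := key 1 (by rw [𝓕.span_range]; trivial)
  rwa [map_one, one_smul, sub_eq_zero] at this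

/-- The `σ'`-linear map `F₁'` of the base change exists. -/
lemma exists_baseF₁ : ∃ G : baseQ X I' →ₛₗ[𝓕'.σ] A' ⊗[A] X.M,
    (∀ (s : A') (x : X.Q), G ⟨s ⊗ₜ[A] (x : X.M), tmul_mem_baseQ X s x.2⟩
      = (𝓕'.σ s * α.u) ⊗ₜ[A] X.F₁ x) ∧
    (∀ (a : I') (y : A' ⊗[A] X.M), G ⟨(a : A') • y, smul_mem_baseQ X a y⟩
      = 𝓕'.σ₁ a • α.tensorMap X.F y) := by
  obtain ⟨L, T, hLT, hQ⟩ := X.normal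
  obtain ⟨K, hK⟩ := exists_semilinear 𝓕' (α.tensorMap X.F)
  have hLQ : L ≤ X.Q := hQ ▸ le_sup_left
  let pL : X.M →ₗ[A] L := L.projectionOnto T hLT
  let pT : X.M →ₗ[A] X.M := T.subtype ∘ₗ T.projectionOnto L hLT.symm
  have hsum : ∀ x, (pL x : X.M) + pT x = x := fun x =>
    Submodule.projection_add_projection_eq_self hLT x
  have hpTQ : ∀ x ∈ X.Q, pT x ∈ I • (⊤ : Submodule A X.M) := by
    intro x hx
    rw [hQ] at hx
    obtain ⟨l, hl, t, ht, rfl⟩ := Submodule.mem_sup.1 hx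
    have h1 : pT l = 0 := by
      simp [pT, hl]
    have h2 : pT t ∈ I • (⊤ : Submodule A X.M) := by
      have := Submodule.mem_map_of_mem (f := pT) ht
      rw [Submodule.map_smul''] at this
      exact Submodule.smul_mono le_rfl le_top this
    rw [map_add, h1, zero_add]; exact h2
  let pT' := pT.baseChange A'
  have hpT' : ∀ y : baseQ X I', pT' y ∈ I' • (⊤ : Submodule A' (A' ⊗[A] X.M)) := by
    rintro ⟨y, hy⟩
    obtain ⟨y1, h1, y2, h2, rfl⟩ := Submodule.mem_sup.1 hy
    simp only [map_add]
    refine Submodule.add_mem _ ?_ ?_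
    · rw [Submodule.baseChange_eq_span] at h1
      induction h1 using Submodule.span_induction with
      | zero => simp
      | add a b ha hb h h' =>
        rw [map_add]; exact Submodule.add_mem _ (h (Submodule.mem_sup_left (by
          rw [Submodule.baseChange_eq_span]; exact ha) |> fun q => Submodule.add_mem _ q (Submodule.mem_sup_right h2)))
            (h' (Submodule.mem_sup_left (by
          rw [Submodule.baseChange_eq_span]; exact hb) |> fun q => Submodule.add_mem _ q (Submodule.mem_sup_right h2)))
      | smul r a ha h =>
        rw [map_smul]; exact Submodule.smul_mem _ _ (h (Submodule.mem_sup_left (by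
          rw [Submodule.baseChange_eq_span]; exact ha) |> fun q => Submodule.add_mem _ q (Submodule.mem_sup_right h2)))
      | mem a ha =>
        obtain ⟨x, hx, rfl⟩ := ha
        exact α.map_smul_top_le X (Submodule.tmul_mem_baseChange_of_mem _ (hpTQ x hx))
    · have := Submodule.mem_map_of_mem (f := pT') h2
      rw [Submodule.map_smul''] at this
      exact Submodule.smul_mono le_rfl le_top this
  let F1L : X.M →ₛₗ[𝓕.σ] X.M := (X.F₁.comp (Submodule.inclusion hLQ)).comp pL
  let G1 : A' ⊗[A] X.M →ₛₗ[𝓕'.σ] A' ⊗[A] X.M := (α.u : A') • α.tensorMap F1L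
  let G : baseQ X I' →ₛₗ[𝓕'.σ] A' ⊗[A] X.M :=
    G1.comp (baseQ X I').subtype + K.comp (LinearMap.codRestrict _ (pT' ∘ₗ (baseQ X I').subtype) hpT')
  have hG : ∀ y, G y = G1 y + K ⟨pT' y, hpT' y⟩ := fun y => rfl
  have hA : ∀ (a : I') (y : A' ⊗[A] X.M), G ⟨(a : A') • y, smul_mem_baseQ X a y⟩
      = 𝓕'.σ₁ a • α.tensorMap X.F y := by
    intro a y
    rw [hG]
    have e : K ⟨pT' ((a : A') • y), hpT' ⟨_, smul_mem_baseQ X a y⟩⟩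
        = 𝓕'.σ₁ a • α.tensorMap X.F (pT' y) := by
      rw [← hK a (pT' y)]; congr 1; exact Subtype.ext (by simp)
    have e' : ∀ y, G1 ((a : A') • y) = 𝓕'.σ₁ a • α.tensorMap X.F ((L.subtype ∘ₗ pL).baseChange A' y) := by
      intro y
      induction y with
      | zero => simp
      | add x y hx hy => rw [smul_add, map_add, hx, hy, map_add, map_add, smul_add]
      | tmul s x =>
        have := α.cross X a ⟨pL x, hLQ (pL x).2⟩
        simp only [G1, LinearMap.smul_apply, TensorProduct.smul_tmul', tensorMap_tmul, F1L,
          LinearMap.baseChange_tmul, smul_eq_mul, map_mul]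
        calc _ = 𝓕'.σ s • ((α.u * 𝓕'.σ a : A') ⊗ₜ[A] X.F₁ ⟨pL x, hLQ (pL x).2⟩) := by
              rw [TensorProduct.smul_tmul', smul_eq_mul]; congr 1; ring
          _ = _ := by
              rw [this, TensorProduct.smul_tmul', smul_eq_mul, mul_comm]; rfl
    rw [e]
    change G1 ((a : A') • y) + _ = _
    rw [e' y, ← smul_add, ← map_add]
    congr 2
    have : (L.subtype ∘ₗ pL).baseChange A' + pT' = LinearMap.id := by
      rw [← LinearMap.baseChange_add, ← LinearMap.baseChange_id]
      congr 1
      ext x; exact hsum x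
    exact LinearMap.congr_fun this y
  refine ⟨G, ?_, hA⟩
  intro s x
  have hz : ∀ z (hz : z ∈ I • (⊤ : Submodule A X.M)),
      K ⟨s ⊗ₜ[A] z, α.map_smul_top_le X (Submodule.tmul_mem_baseChange_of_mem _ hz)⟩
        = (𝓕'.σ s * α.u) ⊗ₜ[A] X.F₁ ⟨z, X.smul_mem hz⟩ := by
    intro z hz
    induction hz using Submodule.smul_induction_on' with
    | smul a ha t ht =>
      have h1 := hK ⟨algebraMap A A' a, α.map_mem a ha⟩ (s ⊗ₜ[A] t)
      have h2 := X.F₁_smul ⟨a, ha⟩ t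
      have h3 := α.comm_σ₁ ⟨a, ha⟩
      simp only at h1 h2 h3
      rw [h2, ← TensorProduct.smul_tmul (𝓕.σ₁ ⟨a, ha⟩), Algebra.smul_def]
      have h4 : (𝓕'.σ₁ ⟨algebraMap A A' a, α.map_mem a ha⟩) • α.tensorMap X.F (s ⊗ₜ[A] t)
          = (algebraMap A A' (𝓕.σ₁ ⟨a, ha⟩) * (𝓕'.σ s * α.u)) ⊗ₜ[A] X.F t := by
        rw [h3, tensorMap_tmul, TensorProduct.smul_tmul', smul_eq_mul]
        congr 1; ring
      rw [← h4, ← h1]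
      congr 1
      refine Subtype.ext ?_
      simp [algebraMap_smul, TensorProduct.tmul_smul]
    | add x hx y hy h h' =>
      have : (⟨x + y, X.smul_mem (Submodule.add_mem _ hx hy)⟩ : X.Q)
        = ⟨x, X.smul_mem hx⟩ + ⟨y, X.smul_mem hy⟩ := rfl
      rw [this, map_add, TensorProduct.tmul_add ((𝓕'.σ s) * (α.u : A')), ← h, ← h', ← map_add]
      congr 1
      exact Subtype.ext (by simp [TensorProduct.tmul_add])
  rw [hG]
  have e1 : K ⟨pT' (s ⊗ₜ[A] (x : X.M)), hpT' ⟨_, tmul_mem_baseQ X s x.2⟩⟩ = _ := hz (pT x) (hpTQ x x.2)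
  have e2 : G1 (s ⊗ₜ[A] (x : X.M)) = (𝓕'.σ s * α.u) ⊗ₜ[A] X.F₁ ⟨pL x, hLQ (pL x).2⟩ := by
    simp only [G1, LinearMap.smul_apply, tensorMap_tmul, TensorProduct.smul_tmul', smul_eq_mul]
    rw [mul_comm]; rfl
  rw [e1]
  change G1 (s ⊗ₜ[A] (x : X.M)) + _ = _
  rw [e2, ← TensorProduct.tmul_add, ← map_add]
  congr 2
  exact Subtype.ext (hsum x)



/-- The map `F₁` of the base change of a window. -/
noncomputable def baseF₁ : baseQ X I' →ₛₗ[𝓕'.σ] A' ⊗[A] X.M := (α.exists_baseF₁ X).choose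

lemma baseF₁_tmul (s : A') (x : X.M) (hx : x ∈ X.Q) (h : s ⊗ₜ[A] x ∈ baseQ X I') :
    α.baseF₁ X ⟨s ⊗ₜ[A] x, h⟩ = (𝓕'.σ s * α.u) ⊗ₜ[A] X.F₁ ⟨x, hx⟩ :=
  (α.exists_baseF₁ X).choose_spec.1 s ⟨x, hx⟩

lemma baseF₁_smul (a : A') (ha : a ∈ I') (y : A' ⊗[A] X.M) (h : a • y ∈ baseQ X I') :
    α.baseF₁ X ⟨a • y, h⟩ = 𝓕'.σ₁ ⟨a, ha⟩ • α.tensorMap X.F y :=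
  (α.exists_baseF₁ X).choose_spec.2 ⟨a, ha⟩ y

/-- The elements `s ⊗ x` with `x ∈ Q` and `a • y` with `a ∈ I'` generate `Q'`. -/
lemma baseQ_induction {C : ∀ y, y ∈ baseQ X I' → Prop}
    (tmul : ∀ (s : A') (x : X.M) (hx : x ∈ X.Q), C _ (tmul_mem_baseQ X s hx))
    (smul : ∀ (a : A') (ha : a ∈ I') (y : A' ⊗[A] X.M), C _ (smul_mem_baseQ X ⟨a, ha⟩ y))
    (add : ∀ y hy z hz, C y hy → C z hz → C (y + z) (Submodule.add_mem _ hy hz))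
    (y : A' ⊗[A] X.M) (hy : y ∈ baseQ X I') : C y hy := by
  obtain ⟨y1, h1, y2, h2, rfl⟩ := Submodule.mem_sup.1 hy
  refine add _ (Submodule.mem_sup_left h1) _ (Submodule.mem_sup_right h2) ?_ ?_
  · obtain ⟨z, hz⟩ := Submodule.toBaseChange_surjective A' X.Q ⟨y1, h1⟩
    obtain rfl : (Submodule.toBaseChange A' X.Q z : A' ⊗[A] X.M) = y1 := congrArg Subtype.val hz
    clear hz hy
    induction z with
    | zero => simpa using! smul 0 I'.zero_mem 0
    | tmul s x => exact tmul s x x.2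
    | add a b ha hb =>
      have := add _ _ _ _ (ha (Submodule.coe_mem _)) (hb (Submodule.coe_mem _))
      simpa using! this
  · clear hy
    induction h2 using Submodule.smul_induction_on' with
    | smul a ha y hy => exact smul a ha y
    | add x hx y hy h h' =>
      exact add _ _ _ _ h h'

/-- Base change of a window: `M' = A' ⊗ M`, `Q'` is generated by the images of `Q` and `I' M'`,
`F' (s ⊗ x) = σ' s ⊗ F x`, `F₁' (s ⊗ x) = σ' s * u ⊗ F₁ x` for `x ∈ Q`, and
`F₁' (a • y) = σ₁' a • F' y` for `a ∈ I'`. -/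
noncomputable def baseChangeObj : Window 𝓕' where
  M := A' ⊗[A] X.M
  Q := baseQ X I'
  smul_mem := le_sup_right
  normal := by
    obtain ⟨L, T, hLT, hQ⟩ := X.normal
    refine ⟨L.baseChange A', T.baseChange A', ?_, ?_⟩
    · constructor
      · rw [Submodule.disjoint_def]
        intro y hL hT
        have e1 : (T.projection L hLT.symm).baseChange A' y = 0 := by
          obtain ⟨z, hz⟩ := Submodule.toBaseChange_surjective A' L ⟨y, hL⟩
          obtain rfl : (Submodule.toBaseChange A' L z : A' ⊗[A] X.M) = y := congrArg Subtype.val hz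
          clear hz hL hT
          induction z with
          | zero => simp
          | tmul s x =>
            change (T.projection L hLT.symm).baseChange A' (s ⊗ₜ[A] (x : X.M)) = 0
            rw [LinearMap.baseChange_tmul, Submodule.projection_apply_right, TensorProduct.tmul_zero]
          | add a b ha hb => simp only [map_add, Submodule.coe_add, ha, hb, add_zero]
        have e2 : (T.projection L hLT.symm).baseChange A' y = y := by
          obtain ⟨z, hz⟩ := Submodule.toBaseChange_surjective A' T ⟨y, hT⟩
          obtain rfl : (Submodule.toBaseChange A' T z : A' ⊗[A] X.M) = y := congrArg Subtype.val hz
          clear hz hL hT e1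
          induction z with
          | zero => simp
          | tmul s x =>
            change (T.projection L hLT.symm).baseChange A' (s ⊗ₜ[A] (x : X.M)) = s ⊗ₜ[A] (x : X.M)
            rw [LinearMap.baseChange_tmul, Submodule.projection_apply_left]
          | add a b ha hb => simp only [map_add, Submodule.coe_add, ha, hb]
        rw [← e2, e1]
      · rw [codisjoint_iff, eq_top_iff]
        rintro y -
        induction y with
        | zero => exact Submodule.zero_mem _
        | add a b ha hb => exact Submodule.add_mem _ ha hb
        | tmul s x =>
          rw [← Submodule.projection_add_projection_eq_self hLT x, TensorProduct.tmul_add]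
          exact Submodule.add_mem _
            (Submodule.mem_sup_left (Submodule.tmul_mem_baseChange_of_mem _
              (Submodule.projection_apply_mem hLT x)))
            (Submodule.mem_sup_right (Submodule.tmul_mem_baseChange_of_mem _
              (Submodule.projection_apply_mem hLT.symm x)))
    · have hL : L ≤ X.Q := hQ ▸ le_sup_left
      apply le_antisymm
      · intro y hy
        refine baseQ_induction X (C := fun y _ => y ∈ L.baseChange A' ⊔ I' • T.baseChange A')
          ?_ ?_ ?_ y hy
        · intro s x hx
          rw [hQ] at hx
          obtain ⟨l, hl, t, ht, rfl⟩ := Submodule.mem_sup.1 hx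
          rw [TensorProduct.tmul_add]
          refine Submodule.add_mem _
            (Submodule.mem_sup_left (Submodule.tmul_mem_baseChange_of_mem _ hl))
            (Submodule.mem_sup_right ?_)
          refine Submodule.smul_induction_on (p := fun t => s ⊗ₜ[A] t ∈ I' • T.baseChange A')
            ht ?_ ?_
          · intro a ha t ht
            rw [TensorProduct.tmul_smul, ← algebraMap_smul A' a]
            exact Submodule.smul_mem_smul (α.map_mem a ha)
              (Submodule.tmul_mem_baseChange_of_mem _ ht)
          · intro x y hx hy
            rw [TensorProduct.tmul_add]; exact Submodule.add_mem _ hx hy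
        · intro a ha y
          induction y with
          | zero => simp
          | add x y hx hy => rw [smul_add]; exact Submodule.add_mem _ hx hy
          | tmul s x =>
            rw [← Submodule.projection_add_projection_eq_self hLT x, TensorProduct.tmul_add, smul_add]
            exact Submodule.add_mem _
              (Submodule.smul_mem _ _ (Submodule.mem_sup_left
                (Submodule.tmul_mem_baseChange_of_mem _ (Submodule.projection_apply_mem hLT x))))
              (Submodule.mem_sup_right (Submodule.smul_mem_smul ha
                (Submodule.tmul_mem_baseChange_of_mem _
                  (Submodule.projection_apply_mem hLT.symm x))))
        · intro y _ z _ h h'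
          exact Submodule.add_mem _ h h'
      · exact sup_le_sup (Submodule.baseChange_mono (A := A') hL) (Submodule.smul_mono le_rfl le_top)
  F := α.tensorMap X.F
  F₁ := α.baseF₁ X
  F₁_smul a y := α.baseF₁_smul X a a.2 y _
  span_range := by
    rw [eq_top_iff]
    have h1 : ∀ m ∈ Submodule.span A (Set.range X.F₁),
        (α.u : A') ⊗ₜ[A] m ∈ Submodule.span A' (Set.range (α.baseF₁ X)) := by
      intro m hm
      induction hm using Submodule.span_induction with
      | zero => simp
      | add x y _ _ hx hy => rw [TensorProduct.tmul_add]; exact Submodule.add_mem _ hx hy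
      | smul c x _ hx =>
        rw [TensorProduct.tmul_smul, ← algebraMap_smul A' c]; exact Submodule.smul_mem _ _ hx
      | mem x hx =>
        obtain ⟨q, rfl⟩ := hx
        refine Submodule.subset_span ⟨⟨1 ⊗ₜ[A] (q : X.M), tmul_mem_baseQ X 1 q.2⟩, ?_⟩
        rw [α.baseF₁_tmul X 1 q q.2, map_one, one_mul]
    rintro y -
    induction y with
    | zero => exact Submodule.zero_mem _
    | add a b ha hb => exact Submodule.add_mem _ ha hb
    | tmul s x =>
      have h2 := Submodule.smul_mem _ (s * (↑α.u⁻¹ : A')) (h1 x (by rw [X.span_range]; trivial))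
      rwa [TensorProduct.smul_tmul', smul_eq_mul, mul_assoc, Units.inv_mul, mul_one] at h2

lemma map_mem_baseQ {X Y : Window 𝓕} (g : X ⟶ Y) (y : A' ⊗[A] X.M) (hy : y ∈ baseQ X I') :
    g.f.baseChange A' y ∈ baseQ Y I' := by
  refine baseQ_induction X (C := fun y _ => g.f.baseChange A' y ∈ baseQ Y I') ?_ ?_ ?_ y hy
  · intro s x hx
    exact tmul_mem_baseQ Y s (g.map_mem x hx)
  · intro a ha y
    rw [map_smul]
    exact smul_mem_baseQ Y ⟨a, ha⟩ _
  · intro y _ z _ h h'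
    rw [map_add]; exact Submodule.add_mem _ h h'

lemma baseChange_comm_F {X Y : Window 𝓕} (g : X ⟶ Y) (y : A' ⊗[A] X.M) :
    g.f.baseChange A' (α.tensorMap X.F y) = α.tensorMap Y.F (g.f.baseChange A' y) := by
  induction y with
  | zero => simp
  | add x y hx hy => simp only [map_add, hx, hy]
  | tmul s x => simp [g.comm_F]

/-- The base change functor along a homomorphism of frames. -/
noncomputable def baseChange : Window 𝓕 ⥤ Window 𝓕' where
  obj := α.baseChangeObj
  map {X Y} g :=
    { f := g.f.baseChange A'
      map_mem := map_mem_baseQ g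
      comm_F := α.baseChange_comm_F g
      comm_F₁ := by
        rintro ⟨y, hy⟩
        refine baseQ_induction X (C := fun y hy => g.f.baseChange A' (α.baseF₁ X ⟨y, hy⟩) =
          α.baseF₁ Y ⟨g.f.baseChange A' y, map_mem_baseQ g y hy⟩) ?_ ?_ ?_ y hy
        · intro s x hx
          rw [α.baseF₁_tmul X s x hx, LinearMap.baseChange_tmul, g.comm_F₁]
          exact (α.baseF₁_tmul Y s (g.f x) (g.map_mem x hx) _).symm
        · intro a ha y
          rw [α.baseF₁_smul X a ha, map_smul, α.baseChange_comm_F, ← α.baseF₁_smul Y a ha _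
            (smul_mem_baseQ Y ⟨a, ha⟩ _)]
          congr 1
          exact Subtype.ext (by simp)
        · intro y hy z hz h h'
          have e1 : (⟨y + z, Submodule.add_mem _ hy hz⟩ : baseQ X I') = ⟨y, hy⟩ + ⟨z, hz⟩ := rfl
          rw [e1, map_add, map_add, h, h', ← map_add]
          congr 1
          exact Subtype.ext (by simp) }
  map_id X := Window.hom_ext (by exact LinearMap.baseChange_id)
  map_comp g h := Window.hom_ext (by exact LinearMap.baseChange_comp _ _)

end WindowFrame.Hom

/-- A Witt vector `ξ = (ξ₀, ξ₁, …)` is distinguished if `ξ₁` is a unit and `S` is `ξ₀`-adically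
complete. -/
structure IsDistinguished (p : ℕ) [Fact p.Prime] {S : Type u} [CommRing S] (ξ : WittVector p S) :
    Prop where
  isUnit_coeff_one : IsUnit (ξ.coeff 1)
  complete : IsAdicComplete (Ideal.span {ξ.coeff 0}) S

/-- A presentation `R ≅ W(S) / ξ` of a perfectoid ring `R`, where `S` is a perfect ring of
characteristic `p` and `ξ` is distinguished: a surjective ring homomorphism `π : W(S) → R` with
kernel generated by `ξ`. A ring is perfectoid if and only if it has such a presentation. -/
structure PerfectoidPresentation (p : ℕ) [Fact p.Prime] (S : Type u) (R : Type v)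
    [CommRing S] [Algebra (ZMod p) S] [PerfectRing S p] [CommRing R] where
  ξ : WittVector p S
  distinguished : IsDistinguished p ξ
  π : WittVector p S →+* R
  surjective : Function.Surjective π
  ker_eq : RingHom.ker π = Ideal.span {ξ}

namespace WittVector

variable {p : ℕ} [Fact p.Prime] {S : Type u} [CommRing S] [Algebra (ZMod p) S]

lemma subsingleton_or_charP (p : ℕ) [Fact p.Prime] (S : Type u) [CommRing S] [Algebra (ZMod p) S] :
    Subsingleton S ∨ CharP S p := by
  rcases subsingleton_or_nontrivial S with h | h
  · exact Or.inl h
  · exact Or.inr (charP_of_injective_algebraMap (algebraMap (ZMod p) S).injective p)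

lemma subsingleton_of {p : ℕ} {S : Type u} [Subsingleton S] : Subsingleton (WittVector p S) :=
  ⟨fun _ _ => WittVector.ext fun _ => Subsingleton.elim _ _⟩

/-- The homomorphism `ℤ_p = W(𝔽_p) → W(S)`. -/
noncomputable def ofPadicInt (p : ℕ) [Fact p.Prime] (S : Type u) [CommRing S] [Algebra (ZMod p) S] :
    ℤ_[p] →+* WittVector p S :=
  (WittVector.map (algebraMap (ZMod p) S)).comp (WittVector.fromPadicInt p)

lemma frobenius_ofPadicInt (x : ℤ_[p]) :
    frobenius (ofPadicInt p S x) = ofPadicInt p S x := by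
  rcases subsingleton_or_charP p S with h | h
  · have := subsingleton_of (p := p) (S := S)
    exact Subsingleton.elim _ _
  · ext n
    simp only [ofPadicInt, RingHom.comp_apply, coeff_frobenius_charP, map_coeff, ← map_pow,
      ZMod.pow_card]

variable [PerfectRing S p]

lemma frobenius_sub_pow_mem (x : WittVector p S) :
    frobenius x - x ^ p ∈ Ideal.span {(p : WittVector p S)} := by
  rcases subsingleton_or_charP p S with h | h
  · have := subsingleton_of (p := p) (S := S)
    rw [Subsingleton.elim (frobenius x - x ^ p) 0]; exact Ideal.zero_mem _
  · rw [← ker_constantCoeff, RingHom.mem_ker, map_sub, map_pow]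
    change (frobenius x).coeff 0 - x.coeff 0 ^ p = 0
    rw [coeff_frobenius_charP, sub_self]

lemma isAdicComplete_p : IsAdicComplete (Ideal.span {(p : WittVector p S)}) (WittVector p S) := by
  rcases subsingleton_or_charP p S with h | h
  · have := subsingleton_of (p := p) (S := S)
    infer_instance
  · infer_instance

lemma p_mem_jacobson : (p : WittVector p S) ∈ Ideal.jacobson (⊥ : Ideal (WittVector p S)) := by
  have := isAdicComplete_p (p := p) (S := S)
  exact IsAdicComplete.le_jacobson_bot _ (Ideal.mem_span_singleton_self _)

lemma p_mul_cancel {x y : WittVector p S} (h : (p : WittVector p S) * x = p * y) : x = y := by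
  rcases subsingleton_or_charP p S with h' | h'
  · have := subsingleton_of (p := p) (S := S)
    exact Subsingleton.elim _ _
  · rw [← sub_eq_zero] at h ⊢
    exact eq_zero_of_p_mul_eq_zero _ (by rw [← h]; ring)

lemma isUnit_of_coeff_zero {x : WittVector p S} (hx : IsUnit (x.coeff 0)) : IsUnit x := by
  rcases subsingleton_or_charP p S with h | h
  · have := subsingleton_of (p := p) (S := S)
    exact isUnit_of_subsingleton x
  · obtain ⟨b, hb⟩ := hx.exists_right_inv
    obtain ⟨y, rfl⟩ := constantCoeff_surjective (R := S) p b
    have h1 : x * y - 1 ∈ Ideal.span {(p : WittVector p S)} := by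
      rw [← ker_constantCoeff, RingHom.mem_ker, map_sub, map_mul, map_one, sub_eq_zero]
      exact hb
    have h2 : x * y - 1 ∈ Ideal.jacobson (⊥ : Ideal (WittVector p S)) :=
      (Ideal.span_singleton_le_iff_mem _).2 p_mem_jacobson h1
    have h3 := Ideal.mem_jacobson_bot.1 h2 1
    rw [mul_one, sub_add_cancel] at h3
    exact isUnit_of_mul_isUnit_left h3

lemma mul_coeff_one_of_zero [CharP S p] {x y : WittVector p S} (h : x.coeff 0 * y.coeff 0 = 0) :
    (x * y).coeff 1 = x.coeff 0 ^ p * y.coeff 1 + x.coeff 1 * y.coeff 0 ^ p := by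
  have dec : ∀ z : WittVector p S, z = teichmuller p (z.coeff 0) + verschiebung (z.shift 1) := by
    intro z
    ext n
    rw [coeff_add_of_disjoint]
    · cases n with
      | zero => simp
      | succ n => simp [teichmuller_coeff_pos, shift_coeff, add_comm]
    · intro n
      cases n with
      | zero => right; simp
      | succ n => left; exact teichmuller_coeff_pos _ _ _ (Nat.succ_pos n)
  have e : x * y = verschiebung (frobenius (teichmuller p (x.coeff 0)) * y.shift 1
      + x.shift 1 * frobenius y) := by
    rw [map_add, verschiebung_mul_frobenius, mul_comm (frobenius _), verschiebung_mul_frobenius]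
    conv_lhs => rw [dec x, add_mul]
    congr 1
    conv_lhs => rw [dec y, mul_add, ← map_mul, h, teichmuller_zero, zero_add, mul_comm]
  rw [e, verschiebung_coeff_succ _ 0]
  have hc : ∀ z : WittVector p S, z.coeff 0 = constantCoeff z := fun _ => rfl
  rw [hc, map_add, map_mul, map_mul]
  change (frobenius _).coeff 0 * (y.shift 1).coeff 0 + (x.shift 1).coeff 0 * (frobenius y).coeff 0 = _
  rw [coeff_frobenius_charP, coeff_frobenius_charP, teichmuller_coeff_zero, shift_coeff, shift_coeff]

lemma pow_dvd_of_pow_dvd_mul {ξ : WittVector p S} (hξ : IsUnit (ξ.coeff 1)) (n : ℕ) :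
    ∀ x : WittVector p S, (p : WittVector p S) ^ (n + 1) ∣ ξ * x → (p : WittVector p S) ^ n ∣ x := by
  rcases subsingleton_or_charP p S with h | h
  · have := subsingleton_of (p := p) (S := S)
    intro x _; rw [Subsingleton.elim x 0]; exact dvd_zero _
  induction n with
  | zero => intro x _; simp
  | succ n ih =>
    intro x hx
    have h1 : ∀ m < 2, (ξ * x).coeff m = 0 := by
      rw [← mem_span_p_pow_iff_le_coeff_eq_zero, Ideal.mem_span_singleton]
      exact (pow_dvd_pow _ (by omega)).trans hx
    have h0 : ξ.coeff 0 * x.coeff 0 = 0 := by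
      have := h1 0 (by norm_num)
      rwa [show (ξ * x).coeff 0 = ξ.coeff 0 * x.coeff 0 from map_mul constantCoeff ξ x] at this
    have h2 := h1 1 (by norm_num)
    rw [mul_coeff_one_of_zero h0] at h2
    have h3 : ξ.coeff 1 * (x.coeff 0) ^ (p + p) = 0 := by
      have e : ξ.coeff 1 * (x.coeff 0) ^ (p + p) =
        (ξ.coeff 0 ^ p * x.coeff 1 + ξ.coeff 1 * x.coeff 0 ^ p) * x.coeff 0 ^ p
          - (ξ.coeff 0 * x.coeff 0) ^ p * x.coeff 1 := by ring
      rw [e, h2, h0, zero_pow (Fact.out : p.Prime).ne_zero]; ring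
    have h4 : x.coeff 0 ^ (p + p) = 0 := by
      simpa [hξ.mul_right_eq_zero] using h3
    have inj : ∀ s : S, s ^ p = 0 → s = 0 := fun s hs =>
      (PerfectRing.bijective_frobenius (R := S) (p := p)).1
        (by simpa [zero_pow (Fact.out : p.Prime).ne_zero] using hs)
    have h5 : x.coeff 0 = 0 := by
      apply inj; apply inj
      rw [← pow_mul]
      have : p + p ≤ p * p := by nlinarith [(Fact.out : p.Prime).two_le]
      exact pow_eq_zero_of_le this h4
    obtain ⟨y, rfl⟩ : (p : WittVector p S) ∣ x := by
      rw [← Ideal.mem_span_singleton, mem_span_p_iff_coeff_zero_eq_zero]; exact h5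
    rw [pow_succ']
    refine mul_dvd_mul_left _ (ih y ?_)
    obtain ⟨z, hz⟩ := hx
    refine ⟨z, p_mul_cancel (p := p) ?_⟩
    rw [← mul_assoc _ _ z, ← pow_succ', ← hz]; ring

lemma eq_zero_of_pow_dvd {x : WittVector p S} (h : ∀ n, (p : WittVector p S) ^ n ∣ x) : x = 0 := by
  have hc := isAdicComplete_p (p := p) (S := S)
  refine hc.haus _ fun n => ?_
  rw [SModEq.sub_mem, sub_zero, smul_eq_mul, Ideal.mul_top, Ideal.span_singleton_pow,
    Ideal.mem_span_singleton]
  exact h n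

end WittVector

namespace PerfectoidPresentation

variable {p : ℕ} [Fact p.Prime] {S : Type u} {R : Type v} [CommRing S] [Algebra (ZMod p) S]
  [PerfectRing S p] [CommRing R] (P : PerfectoidPresentation p S R)

lemma mul_left_injective : Function.Injective (fun x : WittVector p S => P.ξ * x) := by
  intro x y h
  rw [← sub_eq_zero]
  refine WittVector.eq_zero_of_pow_dvd fun n =>
    WittVector.pow_dvd_of_pow_dvd_mul P.distinguished.isUnit_coeff_one n _ ?_
  have : P.ξ * (x - y) = 0 := by rw [mul_sub, sub_eq_zero]; exact h
  rw [this]; exact dvd_zero _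

lemma xi_mem_jacobson : P.ξ ∈ Ideal.jacobson (⊥ : Ideal (WittVector p S)) := by
  rw [Ideal.mem_jacobson_bot]
  intro y
  apply WittVector.isUnit_of_coeff_zero
  have hc := P.distinguished.complete
  have h := Ideal.mem_jacobson_bot.1 (IsAdicComplete.le_jacobson_bot (Ideal.span {P.ξ.coeff 0})
    (Ideal.mem_span_singleton_self _)) (y.coeff 0)
  have e : (P.ξ * y + 1).coeff 0 = P.ξ.coeff 0 * y.coeff 0 + 1 := by
    have hc : ∀ z : WittVector p S, z.coeff 0 = WittVector.constantCoeff z := fun _ => rfl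
    rw [hc, map_add, map_mul, map_one]; rfl
  rwa [e]

lemma isAdicComplete (P : PerfectoidPresentation p S R) : IsAdicComplete (Ideal.span {(p : R)}) R := by
  have hc := WittVector.isAdicComplete_p (p := p) (S := S)
  have key : ∀ (I : ℕ) (x y : R), x ≡ y [SMOD (Ideal.span {(p : R)} ^ I • ⊤ : Ideal R)] ↔
      (p : R) ^ I ∣ x - y := by
    intro n x y
    rw [SModEq.sub_mem, smul_eq_mul, Ideal.mul_top, Ideal.span_singleton_pow,
      Ideal.mem_span_singleton]
  have keyW : ∀ (I : ℕ) (x y : WittVector p S),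
      x ≡ y [SMOD (Ideal.span {(p : WittVector p S)} ^ I • ⊤ : Ideal (WittVector p S))] ↔
      (p : WittVector p S) ^ I ∣ x - y := by
    intro n x y
    rw [SModEq.sub_mem, smul_eq_mul, Ideal.mul_top, Ideal.span_singleton_pow,
      Ideal.mem_span_singleton]
  have limW : ∀ z : ℕ → WittVector p S, ∃ L, ∀ n, (p : WittVector p S) ^ n ∣
      (∑ k ∈ Finset.range n, (p : WittVector p S) ^ k * z k) - L := by
    intro z
    obtain ⟨L, hL⟩ := hc.prec (f := fun n => ∑ k ∈ Finset.range n, (p : WittVector p S) ^ k * z k) (by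
      intro m n hmn
      rw [keyW, dvd_sub_comm]
      rw [← Finset.sum_Ico_eq_sub _ hmn]
      exact Finset.dvd_sum fun k hk => Dvd.dvd.mul_right (pow_dvd_pow _ (Finset.mem_Ico.1 hk).1) _)
    exact ⟨L, fun n => (keyW _ _ _).1 (hL n)⟩
  refine { haus' := ?_, prec' := ?_ }
  · intro r hr
    simp only [key, sub_zero] at hr
    obtain ⟨w, rfl⟩ := P.surjective r
    have h1 : ∀ n, ∃ x, (p : WittVector p S) ^ (n + 1) ∣ w - P.ξ * x := by
      intro n
      obtain ⟨c, hc⟩ := hr (n + 1)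
      obtain ⟨c, rfl⟩ := P.surjective c
      have : w - p ^ (n + 1) * c ∈ RingHom.ker P.π := by
        rw [RingHom.mem_ker, map_sub, hc, map_mul, map_pow, map_natCast, sub_self]
      rw [P.ker_eq, Ideal.mem_span_singleton] at this
      obtain ⟨x, hx⟩ := this
      exact ⟨x, c, by rw [← hx]; ring⟩
    choose x hx using h1
    have h2 : ∀ n, (p : WittVector p S) ^ n ∣ x (n + 1) - x n := by
      intro n
      refine WittVector.pow_dvd_of_pow_dvd_mul P.distinguished.isUnit_coeff_one n _ ?_
      have e : P.ξ * (x (n + 1) - x n) = (w - P.ξ * x n) - (w - P.ξ * x (n + 1)) := by ring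
      rw [e]
      exact dvd_sub (hx n) ((pow_dvd_pow _ (by omega)).trans (hx (n + 1)))
    choose z hz using h2
    have hsum : ∀ n, x n = x 0 + ∑ k ∈ Finset.range n, (p : WittVector p S) ^ k * z k := by
      intro n
      rw [← Finset.sum_congr rfl fun k _ => hz k, Finset.sum_range_sub]; ring
    obtain ⟨L, hL⟩ := limW z
    have h3 : w = P.ξ * (x 0 + L) := by
      rw [← sub_eq_zero]
      refine WittVector.eq_zero_of_pow_dvd fun n => ?_
      have e : w - P.ξ * (x 0 + L) = (w - P.ξ * x n)
        + P.ξ * ((∑ k ∈ Finset.range n, (p : WittVector p S) ^ k * z k) - L) := by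
        rw [hsum n]; ring
      rw [e]
      exact dvd_add ((pow_dvd_pow _ (by omega)).trans (hx n)) ((hL n).mul_left _)
    have : w ∈ RingHom.ker P.π := by
      rw [P.ker_eq, Ideal.mem_span_singleton]; exact ⟨_, h3⟩
    exact this
  · intro f hf
    have h1 : ∀ n, ∃ z, f (n + 1) - f n = (p : R) ^ n * P.π z := by
      intro n
      have := (key _ _ _).1 (hf (Nat.le_succ n))
      rw [dvd_sub_comm] at this
      obtain ⟨c, hc⟩ := this
      obtain ⟨z, rfl⟩ := P.surjective c
      exact ⟨z, hc⟩
    choose z hz using h1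
    obtain ⟨L, hL⟩ := limW z
    refine ⟨f 0 + P.π L, fun n => (key _ _ _).2 ?_⟩
    have e : f n - (f 0 + P.π L) =
        P.π ((∑ k ∈ Finset.range n, (p : WittVector p S) ^ k * z k) - L) := by
      have : f n = f 0 + ∑ k ∈ Finset.range n, (p : R) ^ k * P.π (z k) := by
        rw [← Finset.sum_congr rfl fun k _ => hz k, Finset.sum_range_sub]; ring
      rw [this]
      simp only [map_sub, map_sum, map_mul, map_pow, map_natCast]; ring
    rw [e]
    have := map_dvd P.π (hL n)
    rwa [map_pow, map_natCast] at this

/-- Division by the generator `ξ` of the kernel of `W(S) → R`. -/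
noncomputable def divXi (a : RingHom.ker P.π) : WittVector p S :=
  (Ideal.mem_span_singleton.1 (show (a : WittVector p S) ∈ Ideal.span {P.ξ} from P.ker_eq ▸ a.2)).choose

lemma mul_divXi (a : RingHom.ker P.π) : P.ξ * P.divXi a = a :=
  (Ideal.mem_span_singleton.1
    (show (a : WittVector p S) ∈ Ideal.span {P.ξ} from P.ker_eq ▸ a.2)).choose_spec.symm

lemma divXi_eq (a : RingHom.ker P.π) (b : WittVector p S) (h : (a : WittVector p S) = P.ξ * b) :
    P.divXi a = b :=
  P.mul_left_injective (by simp only [P.mul_divXi, h])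

/-- The Frobenius-linear map `ker (W(S) → R) → W(S)`, `ξ a ↦ σ a`. -/
noncomputable def ainfσ₁ :
    RingHom.ker P.π →ₛₗ[(WittVector.frobenius : WittVector p S →+* WittVector p S)]
      WittVector p S where
  toFun a := WittVector.frobenius (P.divXi a)
  map_add' a b := by
    rw [← map_add, P.divXi_eq (a + b) (P.divXi a + P.divXi b)]
    rw [mul_add, P.mul_divXi, P.mul_divXi]; rfl
  map_smul' c a := by
    rw [smul_eq_mul, ← map_mul, P.divXi_eq (c • a) (c * P.divXi a)]
    rw [mul_left_comm, P.mul_divXi]; rfl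

lemma ainfσ₁_mul (a : WittVector p S) (h : P.ξ * a ∈ RingHom.ker P.π) :
    P.ainfσ₁ ⟨P.ξ * a, h⟩ = WittVector.frobenius a :=
  congrArg WittVector.frobenius (P.divXi_eq ⟨P.ξ * a, h⟩ a rfl)

lemma span_range_ainfσ₁ : Ideal.span (Set.range P.ainfσ₁) = ⊤ := by
  rw [Ideal.eq_top_iff_one]
  have hξ : P.ξ * 1 ∈ RingHom.ker P.π := by
    rw [P.ker_eq, mul_one]; exact Ideal.mem_span_singleton_self _
  refine Ideal.subset_span ⟨⟨P.ξ * 1, hξ⟩, ?_⟩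
  rw [P.ainfσ₁_mul, map_one]

/-- The frame `(A_inf, ker (A_inf → R), R, σ, σ₁)` with `A_inf = W(S)` and `σ₁ (ξ a) = σ a`. -/
noncomputable def ainfFrame : WindowFrame p (WittVector p S) (RingHom.ker P.π) where
  σ := WittVector.frobenius
  σ₁ := P.ainfσ₁
  le_rad := P.ker_eq ▸ (Ideal.span_singleton_le_iff_mem _).2 P.xi_mem_jacobson
  p_mem_rad := WittVector.p_mem_jacobson
  frobenius_lift a := WittVector.frobenius_sub_pow_mem a
  span_range := P.span_range_ainfσ₁

end PerfectoidPresentation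

namespace PadicInt

variable (p : ℕ) [Fact p.Prime]

/-- The divided power `p ^ n / n!` of `p` in `ℤ_p`. -/
noncomputable def dpowP (n : ℕ) : ℤ_[p] := (PadicInt.dividedPowers p).dpow n p

lemma dpowP_zero : dpowP p 0 = 1 :=
  (PadicInt.dividedPowers p).dpow_zero (Ideal.mem_span_singleton_self _)

lemma dpowP_one : dpowP p 1 = p :=
  (PadicInt.dividedPowers p).dpow_one (Ideal.mem_span_singleton_self _)

lemma dpowP_mul (m n : ℕ) : dpowP p m * dpowP p n = (m + n).choose m * dpowP p (m + n) :=
  (PadicInt.dividedPowers p).mul_dpow (Ideal.mem_span_singleton_self _)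

lemma p_dvd_dpowP {n : ℕ} (hn : n ≠ 0) : (p : ℤ_[p]) ∣ dpowP p n :=
  Ideal.mem_span_singleton.1
    ((PadicInt.dividedPowers p).dpow_mem hn (Ideal.mem_span_singleton_self _))

end PadicInt

section PadicCompletion

variable (p : ℕ) {A : Type u} {B : Type v} [CommRing A] [CommRing B] (f : A →+* B)

lemma span_pow_le_comap (n : ℕ) :
    Ideal.span {(p : A)} ^ n ≤ (Ideal.span {(p : B)} ^ n).comap f := by
  rw [Ideal.span_singleton_pow, Ideal.span_singleton_pow, Ideal.span_singleton_le_iff_mem,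
    Ideal.mem_comap, map_pow, map_natCast]
  exact Ideal.mem_span_singleton_self _

lemma factorPow_comp_quotientMap {m n : ℕ} (h : m ≤ n) :
    (Ideal.Quotient.factorPow (Ideal.span {(p : B)}) h).comp
      ((Ideal.quotientMap _ f (span_pow_le_comap p f n)).comp
        (AdicCompletion.evalₐ (Ideal.span {(p : A)}) n).toRingHom) =
      (Ideal.quotientMap _ f (span_pow_le_comap p f m)).comp
        (AdicCompletion.evalₐ (Ideal.span {(p : A)}) m).toRingHom := by
  refine RingHom.ext fun x => ?_
  induction x using AdicCompletion.induction_on with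
  | _ x =>
    have h1 := AdicCompletion.Ideal.mk_eq_mk (I := Ideal.span {(p : A)}) h x
    have h2 := congrArg (Ideal.quotientMap _ f (span_pow_le_comap p f m)) h1
    simpa [AdicCompletion.evalₐ_mk] using! h2

/-- The homomorphism of `p`-adic completions induced by a ring homomorphism. -/
noncomputable def padicCompletionMap :
    AdicCompletion (Ideal.span {(p : A)}) A →+* AdicCompletion (Ideal.span {(p : B)}) B :=
  AdicCompletion.liftRingHom _
    (fun n => (Ideal.quotientMap _ f (span_pow_le_comap p f n)).comp
      (AdicCompletion.evalₐ (Ideal.span {(p : A)}) n).toRingHom)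
    (factorPow_comp_quotientMap p f)

lemma padicCompletionMap_of (a : A) :
    padicCompletionMap p f (algebraMap A _ a) = algebraMap B _ (f a) := by
  refine AdicCompletion.ext_evalₐ fun n => ?_
  rw [padicCompletionMap,
    AdicCompletion.evalₐ_liftRingHom (hf := factorPow_comp_quotientMap p f)]
  simp

end PadicCompletion

namespace PerfectoidPresentation

variable {p : ℕ} [Fact p.Prime] {S : Type u} {R : Type v} [CommRing S] [Algebra (ZMod p) S]
  [PerfectRing S p] [CommRing R] (P : PerfectoidPresentation p S R)

/-- The kernel of `W(S) → R / p`. -/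
noncomputable def J : Ideal (WittVector p S) := (Ideal.span {(p : R)}).comap P.π

lemma p_mem_J : (p : WittVector p S) ∈ P.J := by
  rw [J, Ideal.mem_comap, map_natCast]; exact Ideal.mem_span_singleton_self _

lemma frobenius_mem_J {a : WittVector p S} (ha : a ∈ P.J) : WittVector.frobenius a ∈ P.J := by
  have h1 := WittVector.frobenius_sub_pow_mem a
  have h2 : Ideal.span {(p : WittVector p S)} ≤ P.J :=
    (Ideal.span_singleton_le_iff_mem _).2 P.p_mem_J
  have h3 := P.J.add_mem (h2 h1) (P.J.pow_mem_of_mem ha p (Fact.out : p.Prime).pos)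
  rwa [sub_add_cancel] at h3

/-- The relations which turn the divided power algebra of the `W(S)`-module `J` into the divided
power envelope of `J` relative to `p ℤ_p`: the first divided power of `a ∈ J` is `a`, and the
divided powers of `p` are those of `ℤ_p`. -/
noncomputable def pdRelations : Ideal (DividedPowerAlgebra (WittVector p S) P.J) :=
  Ideal.span
    ({x | ∃ a : P.J, x = DividedPowerAlgebra.dp (WittVector p S) 1 a -
        algebraMap (WittVector p S) _ (a : WittVector p S)} ∪
     {x | ∃ n : ℕ, x = DividedPowerAlgebra.dp (WittVector p S) n ⟨(p : WittVector p S), P.p_mem_J⟩ -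
        algebraMap (WittVector p S) _ (WittVector.ofPadicInt p S (PadicInt.dpowP p n))})

/-- The divided power envelope of `J ⊆ W(S)` relative to `p ℤ_p`. -/
noncomputable def PDEnvelope : Type u := DividedPowerAlgebra (WittVector p S) P.J ⧸ P.pdRelations

noncomputable instance : CommRing P.PDEnvelope :=
  inferInstanceAs (CommRing (DividedPowerAlgebra (WittVector p S) P.J ⧸ P.pdRelations))

noncomputable instance : Algebra (WittVector p S) P.PDEnvelope :=
  inferInstanceAs (Algebra (WittVector p S)
    (DividedPowerAlgebra (WittVector p S) P.J ⧸ P.pdRelations))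

/-- The projection from the divided power algebra of the module `J`. -/
noncomputable def PDEnvelope.mk : DividedPowerAlgebra (WittVector p S) P.J →ₐ[WittVector p S] P.PDEnvelope :=
  Ideal.Quotient.mkₐ _ _

/-- The divided powers of the elements of `J` in the divided power envelope. -/
noncomputable def γ (n : ℕ) (a : P.J) : P.PDEnvelope := PDEnvelope.mk P (DividedPowerAlgebra.dp _ n a)

lemma γ_one (a : P.J) : P.γ 1 a = algebraMap (WittVector p S) _ (a : WittVector p S) := by
  rw [← sub_eq_zero, γ, ← (PDEnvelope.mk P).commutes, ← map_sub]
  exact Ideal.Quotient.eq_zero_iff_mem.2 (Ideal.subset_span (Or.inl ⟨a, rfl⟩))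

lemma γ_p (n : ℕ) : P.γ n ⟨p, P.p_mem_J⟩ =
    algebraMap (WittVector p S) _ (WittVector.ofPadicInt p S (PadicInt.dpowP p n)) := by
  rw [← sub_eq_zero, γ, ← (PDEnvelope.mk P).commutes, ← map_sub]
  exact Ideal.Quotient.eq_zero_iff_mem.2 (Ideal.subset_span (Or.inr ⟨n, rfl⟩))

/-- Homomorphisms out of the divided power envelope. -/
lemma exists_lift {B : Type*} [CommRing B] (f : WittVector p S →+* B) (δ : ℕ → P.J → B)
    (zero : ∀ a, δ 0 a = 1)
    (smul : ∀ n (r : WittVector p S) a, δ n (r • a) = f r ^ n * δ n a)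
    (mul : ∀ m n a, δ m a * δ n a = (m + n).choose m • δ (m + n) a)
    (add : ∀ n a b, δ n (a + b) = ∑ k ∈ Finset.HasAntidiagonal.antidiagonal n, δ k.1 a * δ k.2 b)
    (one : ∀ a, δ 1 a = f a)
    (pp : ∀ n, δ n ⟨p, P.p_mem_J⟩ = f (WittVector.ofPadicInt p S (PadicInt.dpowP p n))) :
    ∃ g : P.PDEnvelope →+* B, (∀ w, g (algebraMap _ _ w) = f w) ∧ ∀ n a, g (P.γ n a) = δ n a := by
  let _ : Algebra (WittVector p S) B := f.toAlgebra
  have hf : ∀ w, algebraMap (WittVector p S) B w = f w := fun _ => rfl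
  let g0 : DividedPowerAlgebra (WittVector p S) P.J →ₐ[WittVector p S] B :=
    DividedPowerAlgebra.lift' (f := fun x => δ x.1 x.2) zero
      (fun n r a => by rw [smul, Algebra.smul_def, map_pow, hf]) mul add
  have hg0 : ∀ n a, g0 (DividedPowerAlgebra.dp _ n a) = δ n a := fun n a => by simp [g0]
  have hk : ∀ x ∈ P.pdRelations, (g0 : _ →+* B) x = 0 := by
    intro x hx
    have : P.pdRelations ≤ RingHom.ker (g0 : _ →+* B) := by
      rw [pdRelations, Ideal.span_le]
      rintro _ (⟨a, rfl⟩ | ⟨n, rfl⟩)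
      · change g0 _ = 0
        rw [map_sub, hg0, g0.commutes, one, hf, sub_self]
      · change g0 _ = 0
        rw [map_sub, hg0, g0.commutes, pp, hf, sub_self]
    exact this hx
  refine ⟨Ideal.Quotient.lift P.pdRelations (g0 : _ →+* B) hk, ?_, ?_⟩
  · intro w; exact g0.commutes w
  · intro n a; exact hg0 n a

lemma exists_toR : ∃ g : P.PDEnvelope →+* R, (∀ w, g (algebraMap _ _ w) = P.π w) ∧
    ∀ n (a : P.J) (x : R), P.π a = p * x →
      g (P.γ n a) = P.π (WittVector.ofPadicInt p S (PadicInt.dpowP p n)) * x ^ n := by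
  have hx : ∀ a : P.J, ∃ x, P.π a = p * x := fun a => Ideal.mem_span_singleton.1 a.2
  choose x hx using hx
  let c : ℤ_[p] →+* R := P.π.comp (WittVector.ofPadicInt p S)
  have key : ∀ (n : ℕ) (x y : R), (p : R) * x = p * y →
      c (PadicInt.dpowP p n) * x ^ n = c (PadicInt.dpowP p n) * y ^ n := by
    intro n x y h
    cases n with
    | zero => simp
    | succ n =>
      obtain ⟨d, hd⟩ := PadicInt.p_dvd_dpowP p (Nat.succ_ne_zero n)
      have h2 : ∀ m, (p : R) * x ^ m = p * y ^ m := by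
        intro m
        induction m with
        | zero => simp
        | succ m ih => rw [pow_succ, ← mul_assoc, ih, mul_right_comm, h]; ring
      rw [hd, map_mul, map_natCast, mul_right_comm, h2]; ring
  obtain ⟨g, h1, h2⟩ := P.exists_lift P.π (fun n a => c (PadicInt.dpowP p n) * x a ^ n)
    (fun a => by simp [PadicInt.dpowP_zero])
    (fun n r a => by
      rw [key n (x (r • a)) (P.π r * x a)]
      · ring
      · rw [← hx]
        change P.π (r * a) = _
        rw [map_mul, hx]; ring)
    (fun m n a => by
      have h := congrArg c (PadicInt.dpowP_mul p m n)
      rw [map_mul, map_mul, map_natCast] at h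
      rw [nsmul_eq_mul]
      linear_combination (x a ^ m * x a ^ n) * h)
    (fun n a b => by
      rw [key n (x (a + b)) (x a + x b)]
      · rw [add_pow, Finset.mul_sum, Finset.Nat.sum_antidiagonal_eq_sum_range_succ_mk]
        refine Finset.sum_congr rfl fun k hk => ?_
        have hk' : k + (n - k) = n := by have := Finset.mem_range.1 hk; omega
        have := congrArg c (PadicInt.dpowP_mul p k (n - k))
        rw [hk', map_mul, map_mul, map_natCast] at this
        simp only
        calc _ = (n.choose k * c (PadicInt.dpowP p n)) * (x a ^ k * x b ^ (n - k)) := by ring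
          _ = _ := by rw [← this]; ring
      · rw [← hx, mul_add, ← hx, ← hx, ← map_add]; rfl)
    (fun a => by
      rw [PadicInt.dpowP_one, map_natCast, pow_one, ← hx])
    (fun n => by
      rw [key n _ 1]
      · simp [c]
      · rw [← hx]; simp)
  exact ⟨g, h1, fun n a y hy => by rw [h2]; exact key n _ _ (by rw [← hx, hy])⟩

/-- The homomorphism from the divided power envelope to `R`; it maps `γ n a` to `(p ^ n / n!) x ^ n`
when `a ∈ J` maps to `p x`. -/
noncomputable def envToR : P.PDEnvelope →+* R := P.exists_toR.choose

lemma envToR_algebraMap (w : WittVector p S) : P.envToR (algebraMap _ _ w) = P.π w :=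
  P.exists_toR.choose_spec.1 w

lemma envToR_γ (n : ℕ) (a : P.J) (x : R) (h : P.π a = p * x) :
    P.envToR (P.γ n a) = P.π (WittVector.ofPadicInt p S (PadicInt.dpowP p n)) * x ^ n :=
  P.exists_toR.choose_spec.2 n a x h

lemma exists_frob : ∃ g : P.PDEnvelope →+* P.PDEnvelope,
    (∀ w : WittVector p S, g (algebraMap _ _ w) = algebraMap _ _ (WittVector.frobenius w)) ∧
    ∀ n (a : P.J), g (P.γ n a) = P.γ n ⟨WittVector.frobenius (a : WittVector p S),
      P.frobenius_mem_J a.2⟩ :=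
  P.exists_lift ((algebraMap _ _).comp WittVector.frobenius)
    (fun n a => P.γ n ⟨WittVector.frobenius (a : WittVector p S), P.frobenius_mem_J a.2⟩)
    (fun a => by rw [γ, DividedPowerAlgebra.dp_zero, map_one])
    (fun n r a => by
      have : (⟨WittVector.frobenius ((r • a : P.J) : WittVector p S), P.frobenius_mem_J (r • a).2⟩ : P.J)
          = WittVector.frobenius r • ⟨WittVector.frobenius (a : WittVector p S),
            P.frobenius_mem_J a.2⟩ := Subtype.ext (map_mul WittVector.frobenius r (a : WittVector p S))
      rw [this, γ, DividedPowerAlgebra.dp_smul, map_smul, Algebra.smul_def, map_pow]; rfl)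
    (fun m n a => by
      simp only [γ]; rw [← map_mul, DividedPowerAlgebra.dp_mul, map_nsmul])
    (fun n a b => by
      have : (⟨WittVector.frobenius ((a + b : P.J) : WittVector p S), P.frobenius_mem_J (a + b).2⟩ : P.J)
          = ⟨WittVector.frobenius (a : WittVector p S), P.frobenius_mem_J a.2⟩
            + ⟨WittVector.frobenius (b : WittVector p S), P.frobenius_mem_J b.2⟩ :=
        Subtype.ext (map_add WittVector.frobenius (a : WittVector p S) b)
      rw [this, γ, DividedPowerAlgebra.dp_add, map_sum]
      simp only [map_mul]; rfl)
    (fun a => P.γ_one _)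
    (fun n => by
      have : (⟨WittVector.frobenius (p : WittVector p S), P.frobenius_mem_J P.p_mem_J⟩ : P.J)
          = ⟨p, P.p_mem_J⟩ := Subtype.ext (map_natCast WittVector.frobenius p)
      simp only
      rw [this, P.γ_p, RingHom.comp_apply, WittVector.frobenius_ofPadicInt])

/-- The endomorphism of the divided power envelope induced by the Frobenius of `W(S)`;
it maps `γ n a` to `γ n (σ a)`. -/
noncomputable def envFrob : P.PDEnvelope →+* P.PDEnvelope := P.exists_frob.choose

lemma envFrob_algebraMap (w : WittVector p S) :
    P.envFrob (algebraMap _ _ w) = algebraMap _ _ (WittVector.frobenius w) :=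
  P.exists_frob.choose_spec.1 w

lemma envFrob_γ (n : ℕ) (a : P.J) : P.envFrob (P.γ n a) =
    P.γ n ⟨WittVector.frobenius (a : WittVector p S), P.frobenius_mem_J a.2⟩ :=
  P.exists_frob.choose_spec.2 n a

/-- `A_cris(R)`, the universal `p`-adic divided power extension of `R`: the `p`-adic completion of
the divided power envelope of `J = ker (W(S) → R / p)` relative to `p ℤ_p`. (For the ideal
`ker (W(S) → R)` in place of `J` the envelope relative to `p ℤ_p` is the same ring.) -/
noncomputable def Acris : Type u := AdicCompletion (Ideal.span {(p : P.PDEnvelope)}) P.PDEnvelope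

noncomputable instance : CommRing P.Acris :=
  inferInstanceAs (CommRing (AdicCompletion (Ideal.span {(p : P.PDEnvelope)}) P.PDEnvelope))

noncomputable instance : Algebra (WittVector p S) P.Acris :=
  inferInstanceAs (Algebra (WittVector p S)
    (AdicCompletion (Ideal.span {(p : P.PDEnvelope)}) P.PDEnvelope))

/-- `A_cris(R) → R`, using that `R` is `p`-adically complete. -/
noncomputable def acrisToR : P.Acris →+* R :=
  haveI := P.isAdicComplete
  ((AdicCompletion.ofAlgEquiv (Ideal.span {(p : R)})).symm : _ →+* R).comp
    (padicCompletionMap p P.envToR)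

/-- The Frobenius endomorphism `σ` of `A_cris(R)`, induced by the Frobenius of `W(S)`. -/
noncomputable def acrisFrob : P.Acris →+* P.Acris := padicCompletionMap p P.envFrob

lemma acrisFrob_algebraMap (w : WittVector p S) :
    P.acrisFrob (algebraMap _ _ w) = algebraMap _ _ (WittVector.frobenius w) := by
  change padicCompletionMap p P.envFrob (algebraMap P.PDEnvelope _ (algebraMap _ _ w)) = _
  rw [padicCompletionMap_of, P.envFrob_algebraMap]; rfl

lemma acrisToR_algebraMap (w : WittVector p S) : P.acrisToR (algebraMap _ _ w) = P.π w := by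
  have := P.isAdicComplete
  change (AdicCompletion.ofAlgEquiv (Ideal.span {(p : R)})).symm
    (padicCompletionMap p P.envToR (algebraMap P.PDEnvelope _ (algebraMap _ _ w))) = _
  rw [padicCompletionMap_of, P.envToR_algebraMap, AlgEquiv.symm_apply_eq]; rfl

end PerfectoidPresentation

/-! Write A = W(S) and A' = A_cris, and let N be the ideal of all x in Ker(A' → R) with σ(x) ∈ p²A'.
Up to completion, A' is generated as an A-module by the divided powers γₙ(ξ), and σ(γₙ(ξ)) =
(pⁿ/n!)uⁿ with u = σ(ξ)/p, a unit. For p ≥ 3 the number pⁿ/n! is divisible by p² as soon as n ≥ 2,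
while γ₀(ξ) = 1 and γ₁(ξ) = ξ come from A. Hence A' = A + N and σ₁(N) ⊆ pA': on the part of A' that
does not come from A, the operator F₁ is p-adically contracting (`IsContracting`, `IsDescent`).

Fullness (`IsContracting.exists_eq_tmul`): a homomorphism g over A' sends 1 ⊗ x into the image of
the A-module modulo N. Since F₁ generates and commutes with g, and since it makes N divisible by p,
this improves to a statement modulo pᵏN for all k. As A is p-adically closed in A', the values of g
are defined over A.

Essential surjectivity (`IsDescent.essSurj`): A is complete for J = (p, ξ), so idempotent matrices
lift and a window over A' has a normal decomposition with a model j : M → M' over A. It remains to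
change j by a map k into NM' so that the Frobenius structure carries the image of M to itself, i.e.
is given by a σ-linear Ψ on M. This is solved modulo pⁿ successively (`IsDescent.exists_next`): the
error is split along A' = A + N, its A-part is absorbed in Ψ and its N-part in k. The second step
inverts Ψ, which is possible because σ is bijective on A and Ψ is surjective by Nakayama. The change
of k affects the Frobenius side only one power of p later.

The ring-theoretic input is that A' is p-torsion free (`natCast_mul_eq_zero`) and that A is
p-adically closed in A' (`exists_algebraMap_eq_of_forall`). Both use expansions in γₙ([ξ₀]). As ξ₀
may be a zero divisor, one needs that in a perfect ring every element annihilated by ξ₀ has p-power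
roots annihilated by ξ₀, so that its Teichmüller lift kills γₙ([ξ₀]) for n > 0. The result is A ∩
pᵏA' ⊆ Jᵏ, while J^(r+pr) maps into pʳA'; so A carries the J-adic topology, for which it is
complete. -/

/-! ### Nakayama's lemma and dual bases -/

section Nakayama

variable {A : Type*} [CommRing A] {M : Type*} [AddCommGroup M] [Module A M]

/-- An endomorphism of a finite module that is congruent to the identity modulo an ideal in the
radical is bijective. -/
lemma LinearMap.bijective_of_sub_mem_smul_top [Module.Finite A M] {J : Ideal A}
    (hJ : J ≤ Ideal.jacobson ⊥) (f : M →ₗ[A] M)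
    (hf : ∀ x, f x - x ∈ J • (⊤ : Submodule A M)) : Function.Bijective f := by
  have hs : Function.Surjective f := by
    rw [← LinearMap.range_eq_top, eq_top_iff]
    refine Submodule.le_of_le_smul_of_le_jacobson_bot Module.Finite.fg_top hJ fun x _ => ?_
    have e : x = f x - (f x - x) := by abel
    rw [e]
    exact Submodule.sub_mem _ (Submodule.mem_sup_left ⟨x, rfl⟩) (Submodule.mem_sup_right (hf x))
  exact ⟨OrzechProperty.injective_of_surjective_endomorphism f hs, hs⟩

variable (A M) in
/-- A finite projective module has a finite dual basis. -/
lemma Module.Projective.exists_finite_dualBasis [Module.Finite A M] [Module.Projective A M] :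
    ∃ (n : ℕ) (e : Fin n → M) (f : Fin n → M →ₗ[A] A), ∀ x, ∑ i, f i x • e i = x := by
  obtain ⟨n, f, g, -, -, h⟩ := Module.Finite.exists_comp_eq_id_of_projective A M
  refine ⟨n, fun i => f (Pi.single i 1), fun i => LinearMap.proj i ∘ₗ g, fun x => ?_⟩
  conv_rhs => rw [← LinearMap.id_apply (R := A) x, ← h, LinearMap.comp_apply,
    LinearMap.pi_apply_eq_sum_univ f (g x)]
  refine Finset.sum_congr rfl fun i _ => ?_
  simp only [LinearMap.comp_apply, LinearMap.proj_apply]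
  congr 2
  ext j
  simp [Pi.single_apply, eq_comm]

lemma Submodule.sum_dualBasis_mem_smul_top {n : ℕ} {e : Fin n → M} {f : Fin n → M →ₗ[A] A}
    (h : ∀ x, ∑ i, f i x • e i = x) (J : Ideal A) (x : M) :
    x ∈ J • (⊤ : Submodule A M) ↔ ∀ i, f i x ∈ J := by
  constructor
  · intro hx i
    refine Submodule.smul_induction_on (p := fun x => f i x ∈ J) hx ?_ ?_
    · intro a ha y _
      simpa using J.mul_mem_right _ ha
    · intro x y hx hy
      simpa using J.add_mem hx hy
  · intro hx
    rw [← h x]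
    exact Submodule.sum_mem _ fun i _ => Submodule.smul_mem_smul (hx i) trivial

end Nakayama

/-! ### Surjective semilinear endomorphisms are injective -/

section Semilinear

variable {A : Type*} [CommRing A] {M : Type*} [AddCommGroup M] [Module A M]

/-- A surjective `σ`-linear endomorphism of a finite projective module is injective when `σ` is an
automorphism which preserves all maximal ideals. -/
lemma LinearMap.injective_of_surjective_semilinear [Module.Finite A M] [Module.Projective A M]
    {σ : A →+* A} (hσ : Function.Bijective σ)
    (hmax : ∀ m : Ideal A, m.IsMaximal → ∀ a, σ a ∈ m ↔ a ∈ m)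
    (Ψ : M →ₛₗ[σ] M) (hΨ : Function.Surjective Ψ) : Function.Injective Ψ := by
  -- Dimension count over A/m: the images under Ψ of a basis of M/mM still span, hence are
  -- independent. So the coefficients σ(cᵢ) of Ψ z = 0 lie in m, and then so do the cᵢ.
  have step : ∀ m : Ideal A, m.IsMaximal → ∀ z, Ψ z = 0 → z ∈ m • (⊤ : Submodule A M) := by
    intro m hm z hz
    let _ : Field (A ⧸ m) := Ideal.Quotient.field m
    let V := M ⧸ m • (⊤ : Submodule A M)
    let q : M →ₗ[A] V := Submodule.mkQ _
    have hq : ∀ x, q x = 0 ↔ x ∈ m • (⊤ : Submodule A M) := fun x =>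
      Submodule.Quotient.mk_eq_zero _
    have hqs : ∀ (a : A) (x : M), q (a • x) = (Ideal.Quotient.mk m a) • q x := fun a x => rfl
    have : Module.Finite (A ⧸ m) V := Module.Finite.of_restrictScalars_finite A _ _
    let b := Module.finBasis (A ⧸ m) V
    choose x hx using fun i => Submodule.mkQ_surjective (m • (⊤ : Submodule A M)) (b i)
    have dec : ∀ y : M, ∃ c : Fin (Module.finrank (A ⧸ m) V) → A,
        y - ∑ i, c i • x i ∈ m • (⊤ : Submodule A M) := by
      intro y
      choose c hc using fun i => Ideal.Quotient.mk_surjective (I := m) (b.repr (q y) i)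
      refine ⟨c, ?_⟩
      rw [← hq, map_sub, map_sum, sub_eq_zero]
      conv_lhs => rw [← b.sum_repr (q y)]
      refine Finset.sum_congr rfl fun i _ => ?_
      rw [hqs, hc]; congr 1; exact (hx i).symm
    have hm' : ∀ y ∈ m • (⊤ : Submodule A M), Ψ y ∈ m • (⊤ : Submodule A M) := by
      intro y hy
      refine Submodule.smul_induction_on (p := fun y => Ψ y ∈ m • (⊤ : Submodule A M)) hy ?_ ?_
      · intro a ha y _
        rw [map_smulₛₗ]
        exact Submodule.smul_mem_smul ((hmax m hm a).2 ha) trivial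
      · intro a b ha hb
        rw [map_add]; exact Submodule.add_mem _ ha hb
    have hli : LinearIndependent (A ⧸ m) (fun i => q (Ψ (x i))) := by
      apply linearIndependent_of_top_le_span_of_card_eq_finrank
      · rintro v -
        obtain ⟨y, rfl⟩ := Submodule.mkQ_surjective _ v
        obtain ⟨y, rfl⟩ := hΨ y
        obtain ⟨c, hc⟩ := dec y
        have h1 := (hq _).2 (hm' _ hc)
        rw [map_sub, map_sub, sub_eq_zero, map_sum, map_sum] at h1
        change q (Ψ y) ∈ _
        rw [h1]
        refine Submodule.sum_mem _ fun i _ => ?_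
        rw [map_smulₛₗ, hqs]
        exact Submodule.smul_mem _ _ (Submodule.subset_span ⟨i, rfl⟩)
      · simp [V]
    obtain ⟨c, hc⟩ := dec z
    have h1 := (hq _).2 (hm' _ hc)
    rw [map_sub, hz, zero_sub, map_neg, neg_eq_zero, map_sum, map_sum] at h1
    simp only [map_smulₛₗ Ψ, hqs] at h1
    have h2 := Fintype.linearIndependent_iff.1 hli _ h1
    have e : z = (z - ∑ i, c i • x i) + ∑ i, c i • x i := by abel
    rw [e]
    refine Submodule.add_mem _ hc (Submodule.sum_mem _ fun i _ => ?_)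
    exact Submodule.smul_mem_smul ((hmax m hm _).1 (Ideal.Quotient.eq_zero_iff_mem.1 (h2 i))) trivial
  obtain ⟨n, e, f, hef⟩ := Module.Projective.exists_finite_dualBasis A M
  choose z hz using fun i => hΨ (e i)
  let τ := (RingEquiv.ofBijective σ hσ).symm
  have hτ : ∀ a, σ (τ a) = a := fun a => (RingEquiv.ofBijective σ hσ).apply_symm_apply a
  have hτ' : ∀ a, τ (σ a) = a := fun a => (RingEquiv.ofBijective σ hσ).symm_apply_apply a
  -- A σ⁻¹-linear section of Ψ is obtained by lifting a dual basis; subtracting it after Ψ gives an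
  -- A-linear projector onto the kernel, which is therefore a finitely generated direct summand.
  let pr : M →ₗ[A] M :=
    { toFun := fun x => x - ∑ i, τ (f i (Ψ x)) • z i
      map_add' := fun x y => by
        simp only [map_add, add_smul, Finset.sum_add_distrib]; abel
      map_smul' := fun a x => by
        simp only [map_smulₛₗ, smul_eq_mul, map_mul, RingHom.id_apply, hτ', mul_smul, smul_sub,
          Finset.smul_sum] }
  have hpr : ∀ x, Ψ (pr x) = 0 := by
    intro x
    change Ψ (x - ∑ i, τ (f i (Ψ x)) • z i) = 0
    rw [map_sub, map_sum, sub_eq_zero]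
    conv_lhs => rw [← hef (Ψ x)]
    refine Finset.sum_congr rfl fun i _ => ?_
    rw [map_smulₛₗ, hτ, hz]
  have hpr' : ∀ x, Ψ x = 0 → pr x = x := by
    intro x hx
    change x - ∑ i, τ (f i (Ψ x)) • z i = x
    simp [hx]
  have hK : LinearMap.range pr = ⊥ := by
    by_contra hne
    have hfg : (LinearMap.range pr).FG := Module.Finite.range pr |> fun _ => Module.Finite.iff_fg.1 inferInstance
    -- Applying the projector to `step` gives K = mK for the kernel K and every maximal m, so no
    -- maximal ideal contains the annihilator of K.
    have htop : Submodule.annihilator (LinearMap.range pr) = ⊤ := by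
      by_contra h
      obtain ⟨m, hm, hle⟩ := Ideal.exists_le_maximal _ h
      have hKm : LinearMap.range pr ≤ m • LinearMap.range pr := by
        rintro _ ⟨x, rfl⟩
        have h1 := Submodule.mem_map_of_mem (f := pr) (step m hm _ (hpr x))
        rw [Submodule.map_smul'', hpr' _ (hpr x), Submodule.map_top] at h1
        exact h1
      obtain ⟨r, hr1, hr2⟩ :=
        Submodule.exists_sub_one_mem_and_smul_eq_zero_of_fg_of_le_smul m _ hfg hKm
      have : r ∈ m := hle (Submodule.mem_annihilator.2 hr2)
      exact hm.ne_top ((Ideal.eq_top_iff_one _).2 (by simpa using m.sub_mem this hr1))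
    exact hne (Submodule.annihilator_eq_top_iff.1 htop)
  rw [injective_iff_map_eq_zero]
  intro x hx
  have : pr x ∈ LinearMap.range pr := ⟨x, rfl⟩
  rwa [hK, Submodule.mem_bot, hpr' x hx] at this

end Semilinear

/-! ### p-adically complete groups -/

/-- An abelian group is `p`-adically complete: it is separated, and `p`-adic series converge. -/
structure PadicComplete (p : ℕ) (V : Type*) [AddCommGroup V] : Prop where
  haus : ∀ x : V, (∀ k : ℕ, ∃ y, x = p ^ k • y) → x = 0
  sum : ∀ a : ℕ → V, ∃ s, ∀ k, ∃ z, s = ∑ i ∈ Finset.range k, p ^ i • a i + p ^ k • z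

namespace PadicComplete

variable {p : ℕ}

lemma of_isAdicComplete {A : Type*} [CommRing A] [IsAdicComplete (Ideal.span {(p : A)}) A] :
    PadicComplete p A := by
  have key : ∀ (n : ℕ) (x y : A), x ≡ y [SMOD (Ideal.span {(p : A)} ^ n • ⊤ : Ideal A)] ↔
      (p : A) ^ n ∣ x - y := by
    intro n x y
    rw [SModEq.sub_mem, smul_eq_mul, Ideal.mul_top, Ideal.span_singleton_pow,
      Ideal.mem_span_singleton]
  constructor
  · intro x hx
    refine IsHausdorff.haus' (I := Ideal.span {(p : A)}) x fun n => ?_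
    rw [key, sub_zero]
    obtain ⟨y, hy⟩ := hx n
    exact ⟨y, by rw [hy]; simp⟩
  · intro a
    obtain ⟨L, hL⟩ := IsPrecomplete.prec' (I := Ideal.span {(p : A)})
      (fun n => ∑ k ∈ Finset.range n, p ^ k • a k) (by
        intro m n hmn
        rw [key, dvd_sub_comm]
        rw [← Finset.sum_Ico_eq_sub _ hmn]
        refine Finset.dvd_sum fun k hk => ?_
        rw [nsmul_eq_mul, Nat.cast_pow]
        exact Dvd.dvd.mul_right (pow_dvd_pow _ (Finset.mem_Ico.1 hk).1) _)
    refine ⟨L, fun k => ?_⟩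
    obtain ⟨z, hz⟩ := (key _ _ _).1 (hL k)
    refine ⟨-z, ?_⟩
    rw [nsmul_eq_mul, Nat.cast_pow, mul_neg, ← hz]; ring

/-- `p`-adically convergent series of semilinear maps. -/
lemma exists_sum_semilinear {A B : Type*} [CommRing A] [CommRing B] {τ : A →+* B} {M V : Type*}
    [AddCommGroup M] [Module A M] [AddCommGroup V] [Module B V] (h : PadicComplete p V)
    (H : ℕ → M →ₛₗ[τ] V) :
    ∃ G : M →ₛₗ[τ] V, ∀ x k, ∃ z, G x = ∑ i ∈ Finset.range k, p ^ i • H i x + p ^ k • z := by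
  choose G hG using fun x => h.sum (fun i => H i x)
  have uniq : ∀ x y : V, (∀ k, ∃ z, x - y = p ^ k • z) → x = y := fun x y hxy =>
    sub_eq_zero.1 (h.haus _ hxy)
  refine ⟨{ toFun := G, map_add' := ?_, map_smul' := ?_ }, hG⟩
  · intro x y
    refine uniq _ _ fun k => ?_
    obtain ⟨a, ha⟩ := hG x k
    obtain ⟨b, hb⟩ := hG y k
    obtain ⟨c, hc⟩ := hG (x + y) k
    refine ⟨c - a - b, ?_⟩
    rw [ha, hb, hc]
    simp only [map_add, smul_add, Finset.sum_add_distrib, smul_sub]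
    abel
  · intro r x
    refine uniq _ _ fun k => ?_
    obtain ⟨a, ha⟩ := hG x k
    obtain ⟨c, hc⟩ := hG (r • x) k
    refine ⟨c - τ r • a, ?_⟩
    rw [ha, hc]
    simp only [map_smulₛₗ, smul_add, Finset.smul_sum, smul_sub, smul_comm (τ r) (p ^ _)]
    abel

/-- For a finite projective module `V` the group `J V` is `p`-adically complete if `J` is. -/
lemma smul_top {A : Type*} [CommRing A] {V : Type*} [AddCommGroup V] [Module A V]
    [Module.Finite A V] [Module.Projective A V] {J : Ideal A} (h : PadicComplete p J) :
    PadicComplete p (J • ⊤ : Submodule A V) := by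
  obtain ⟨n, e, f, hef⟩ := Module.Projective.exists_finite_dualBasis A V
  have mem := Submodule.sum_dualBasis_mem_smul_top hef J
  constructor
  · rintro ⟨x, hx⟩ hx'
    refine Subtype.ext ?_
    change x = 0
    rw [← hef x]
    refine Finset.sum_eq_zero fun i _ => ?_
    have : (⟨f i x, (mem x).1 hx i⟩ : J) = 0 := by
      refine h.haus _ fun k => ?_
      obtain ⟨y, hy⟩ := hx' k
      refine ⟨⟨f i y, (mem _).1 y.2 i⟩, Subtype.ext ?_⟩
      have := congrArg (f i) (congrArg Subtype.val hy)
      simpa using! this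
    have := congrArg Subtype.val this
    simp only at this
    rw [this]; simp
  · intro a
    choose s hs using fun i => h.sum (fun k => ⟨f i (a k), (mem _).1 (a k).2 i⟩)
    choose z hz using hs
    have hm : ∀ s : Fin n → J, ∑ i, (s i : A) • e i ∈ (J • ⊤ : Submodule A V) := fun s =>
      Submodule.sum_mem _ fun i _ => Submodule.smul_mem_smul (s i).2 trivial
    refine ⟨⟨_, hm s⟩, fun k => ⟨⟨_, hm fun i => z i k⟩, Subtype.ext ?_⟩⟩
    have h1 : ∀ i, (s i : A) = ∑ j ∈ Finset.range k, p ^ j • f i (a j) + p ^ k • (z i k : A) := by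
      intro i
      have := congrArg Subtype.val (hz i k)
      simpa using! this
    have h2 : ∀ j, (a j : V) = ∑ i, f i (a j) • e i := fun j => (hef _).symm
    simp only [Submodule.coe_add, AddSubmonoidClass.coe_finsetSum, AddSubmonoidClass.coe_nsmul]
    rw [Finset.sum_congr rfl fun j _ => congrArg (p ^ j • ·) (h2 j)]
    simp only [h1, add_smul, Finset.sum_smul, Finset.sum_add_distrib, Finset.smul_sum, smul_assoc]
    rw [Finset.sum_comm]

lemma of_equiv {V W : Type*} [AddCommGroup V] [AddCommGroup W] (e : V ≃+ W)
    (h : PadicComplete p V) : PadicComplete p W := by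
  constructor
  · intro x hx
    have : e.symm x = 0 := h.haus _ fun k => by
      obtain ⟨y, rfl⟩ := hx k
      exact ⟨e.symm y, by rw [map_nsmul]⟩
    simpa using this
  · intro a
    obtain ⟨s, hs⟩ := h.sum (fun i => e.symm (a i))
    refine ⟨e s, fun k => ?_⟩
    obtain ⟨z, rfl⟩ := hs k
    exact ⟨e z, by simp [map_sum, map_nsmul]⟩

lemma module {A : Type*} [CommRing A] {V : Type*} [AddCommGroup V] [Module A V]
    [Module.Finite A V] [Module.Projective A V] (h : PadicComplete p A) : PadicComplete p V := by
  have h1 : PadicComplete p (⊤ : Ideal A) :=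
    of_equiv (Submodule.topEquiv (R := A) (M := A)).symm.toAddEquiv h
  have h2 : PadicComplete p ((⊤ : Ideal A) • ⊤ : Submodule A V) := smul_top h1
  rw [Submodule.top_smul] at h2
  exact of_equiv (Submodule.topEquiv (R := A) (M := V)).toAddEquiv h2

end PadicComplete

/-! ### Lifting of idempotent matrices -/

section Idempotent

variable {A : Type*} [CommRing A] {n : Type*} [Fintype n] [DecidableEq n]

/-- Idempotent matrices lift along complete ideals. -/
lemma Matrix.exists_isIdempotentElem_sub_mem (K : Ideal A) [IsAdicComplete K A]
    (e₀ : Matrix n n A) (h : ∀ i j, (e₀ * e₀ - e₀) i j ∈ K) :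
    ∃ e : Matrix n n A, e * e = e ∧ ∀ i j, (e - e₀) i j ∈ K := by
  have mul_mem : ∀ (k l : ℕ) (x y : Matrix n n A), (∀ i j, x i j ∈ K ^ k) → (∀ i j, y i j ∈ K ^ l) →
      ∀ i j, (x * y) i j ∈ K ^ (k + l) := by
    intro k l x y hx hy i j
    rw [Matrix.mul_apply, pow_add]
    exact Ideal.sum_mem _ fun a _ => Ideal.mul_mem_mul (hx _ _) (hy _ _)
  have mul_mem' : ∀ (k : ℕ) (x y : Matrix n n A), (∀ i j, x i j ∈ K ^ k) →
      ∀ i j, (x * y) i j ∈ K ^ k := fun k x y hx => by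
    simpa using mul_mem k 0 x y hx (by simp)
  -- The Newton step e ↦ 3e² − 2e³. It squares the defect e² − e up to a factor; only an increase of
  -- the exponent by one is kept in `hf`.
  let N : Matrix n n A → Matrix n n A := fun e => e - (e * e - e) * (2 * e - 1)
  let s : ℕ → Matrix n n A := fun k => N^[k] e₀
  have hs : ∀ k, s (k + 1) = N (s k) := fun k => Function.iterate_succ_apply' N k e₀
  have hN : ∀ e : Matrix n n A, N e * N e - N e =
      (e * e - e) * ((e * e - e) * (4 * (e * e) - 4 * e - 3)) := by
    intro e; simp only [N]; noncomm_ring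
  have hf : ∀ k i j, (s k * s k - s k) i j ∈ K ^ (k + 1) := by
    intro k
    induction k with
    | zero => simpa [s] using h
    | succ k ih =>
      intro i j
      rw [hs, hN]
      exact Ideal.pow_le_pow_right (by omega) (mul_mem _ _ _ _ ih (mul_mem' _ _ _ ih) i j)
  have hd : ∀ k i j, (s (k + 1) - s k) i j ∈ K ^ (k + 1) := by
    intro k i j
    rw [hs]
    have e : N (s k) - s k = (s k * s k - s k) * (-(2 * s k - 1)) := by
      simp only [N]; noncomm_ring
    rw [e]
    exact mul_mem' _ _ _ (hf k) i j
  have key : ∀ (k : ℕ) (x y : A), x ≡ y [SMOD (K ^ k • ⊤ : Ideal A)] ↔ x - y ∈ K ^ k := by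
    intro k x y
    rw [SModEq.sub_mem, smul_eq_mul, Ideal.mul_top]
  have hc : ∀ {k l : ℕ}, k ≤ l → ∀ i j, s l i j - s k i j ∈ K ^ k := by
    intro k l hkl i j
    induction l, hkl using Nat.le_induction with
    | base => simp
    | succ l hl ih =>
      have e : s (l + 1) i j - s k i j = (s (l + 1) - s l) i j + (s l i j - s k i j) := by
        simp
      rw [e]
      exact Ideal.add_mem _ (Ideal.pow_le_pow_right (by omega) (hd l i j)) ih
  have lim : ∀ i j, ∃ L, ∀ k, s k i j - L ∈ K ^ k := by
    intro i j
    obtain ⟨L, hL⟩ := IsPrecomplete.prec' (I := K) (fun k => s k i j) (by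
      intro k l hkl
      rw [key, ← neg_mem_iff, neg_sub]
      exact hc hkl i j)
    exact ⟨L, fun k => (key _ _ _).1 (hL k)⟩
  choose e he using lim
  refine ⟨Matrix.of e, ?_, ?_⟩
  · ext i j
    rw [← sub_eq_zero]
    refine IsHausdorff.haus' (I := K) _ fun k => ?_
    rw [key, sub_zero]
    let d : Matrix n n A := s k - Matrix.of e
    have hd' : ∀ i j, d i j ∈ K ^ k := fun i j => he i j k
    have e1 : Matrix.of e * Matrix.of e - Matrix.of e =
        (s k * s k - s k) - s k * d - d * s k + d * d + d := by
      have : Matrix.of e = s k - d := by simp [d]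
      rw [this]; noncomm_ring
    have e2 : (Matrix.of e * Matrix.of e) i j - Matrix.of e i j =
        (s k * s k - s k) i j - (s k * d) i j - (d * s k) i j + (d * d) i j + d i j := by
      rw [← Matrix.sub_apply, e1]; simp only [Matrix.add_apply, Matrix.sub_apply]
    rw [e2]
    have h1 : ∀ i j, (s k * d) i j ∈ K ^ k := fun i j => by
      simpa using mul_mem 0 k (s k) d (by simp) hd' i j
    exact Ideal.add_mem _ (Ideal.add_mem _ (Ideal.sub_mem _ (Ideal.sub_mem _
      (Ideal.pow_le_pow_right (Nat.le_succ k) (hf k i j)) (h1 i j)) (mul_mem' _ _ _ hd' i j))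
      (mul_mem' _ _ _ hd' i j)) (hd' i j)
  · intro i j
    have h1 := he i j 1
    have h2 := hd 0 i j
    rw [zero_add, pow_one] at h2
    rw [pow_one] at h1
    have e1 : (Matrix.of e - e₀) i j = (s (0 + 1) - s 0) i j - (s 1 i j - e i j) := by
      simp [s]
    rw [e1]
    exact K.sub_mem h2 h1

end Idempotent

/-! ### Descent of finite projective modules -/

section Model

variable {A A' : Type u} [CommRing A] [CommRing A'] [Algebra A A']

/-- Finite projective modules over `A'` descend to `A` when `A` is complete for an ideal `K` which
maps to the radical of `A'`, and `A'` is the sum of `A` and an ideal `N` in the radical that lies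
over `K`. -/
lemma Module.Projective.exists_model (K : Ideal A) [IsAdicComplete K A] (N : Ideal A')
    (hK : ∀ a ∈ K, algebraMap A A' a ∈ Ideal.jacobson (⊥ : Ideal A'))
    (hN : N ≤ Ideal.jacobson ⊥) (hNK : ∀ a, algebraMap A A' a ∈ N → a ∈ K)
    (hAN : ∀ x : A', ∃ a : A, x - algebraMap A A' a ∈ N)
    (P' : Type*) [AddCommGroup P'] [Module A' P'] [Module A P'] [IsScalarTower A A' P']
    [Module.Finite A' P'] [Module.Projective A' P'] :
    ∃ (P : Type u) (_ : AddCommGroup P) (_ : Module A P) (_ : Module.Finite A P)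
      (_ : Module.Projective A P) (j : P →ₗ[A] P'), IsBaseChange A' j := by
  obtain ⟨n, e', f', h'⟩ := Module.Projective.exists_finite_dualBasis A' P'
  choose E₀ hE₀ using fun i j => hAN (f' i (e' j))
  let E' : Matrix (Fin n) (Fin n) A' := Matrix.of fun i j => f' i (e' j)
  let M₀ : Matrix (Fin n) (Fin n) A := Matrix.of E₀
  have hE'j : ∀ j, ∑ i, E' i j • e' i = e' j := fun j => h' (e' j)
  have hE' : E' * E' = E' := by
    ext i k
    rw [Matrix.mul_apply]
    change ∑ j, f' i (e' j) * f' j (e' k) = f' i (e' k)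
    conv_rhs => rw [← h' (e' k), map_sum]
    exact Finset.sum_congr rfl fun j _ => by rw [map_smul, smul_eq_mul, mul_comm]
  -- M₀ agrees modulo N with the idempotent matrix E' that presents P', and elements of A that fall
  -- into N lie in K.
  have hM₀ : ∀ i j, (M₀ * M₀ - M₀) i j ∈ K := by
    intro i j
    apply hNK
    have e1 : algebraMap A A' ((M₀ * M₀ - M₀) i j) =
        (M₀.map (algebraMap A A') * M₀.map (algebraMap A A') - M₀.map (algebraMap A A')) i j := by
      simp [Matrix.mul_apply]
    have hd : ∀ i j, (E' - M₀.map (algebraMap A A')) i j ∈ N := fun i j => hE₀ i j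
    set D := E' - M₀.map (algebraMap A A') with hD
    have e2 : M₀.map (algebraMap A A') = E' - D := by rw [hD]; abel
    have e3 : (E' - D) * (E' - D) - (E' - D) = D - D * E' - (E' - D) * D := by
      have : (E' - D) * (E' - D) - (E' - D) = (E' * E' - E') + D - D * E' - (E' - D) * D := by
        noncomm_ring
      rw [this, hE', sub_self, zero_add]
    rw [e1, e2, e3]
    refine N.sub_mem (N.sub_mem (hd i j) ?_) ?_
    · rw [Matrix.mul_apply]; exact N.sum_mem fun k _ => N.mul_mem_right _ (hd _ _)
    · rw [Matrix.mul_apply]; exact N.sum_mem fun k _ => N.mul_mem_left _ (hd _ _)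
  obtain ⟨E, hE, hEM⟩ := Matrix.exists_isIdempotentElem_sub_mem K M₀ hM₀
  have hEE' : ∀ i j, algebraMap A A' (E i j) - E' i j ∈ Ideal.jacobson (⊥ : Ideal A') := by
    intro i j
    have e1 : algebraMap A A' (E i j) - E' i j =
        algebraMap A A' ((E - M₀) i j) - (E' i j - algebraMap A A' (M₀ i j)) := by
      simp
    rw [e1]
    exact Ideal.sub_mem _ (hK _ (hEM i j)) (hN (hE₀ i j))
  let g : (Fin n → A) →ₗ[A] (Fin n → A) := Matrix.mulVecLin E
  have hg : ∀ x, g (g x) = g x := fun x => by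
    simp only [g, Matrix.mulVecLin_apply, Matrix.mulVec_mulVec, hE]
  let P := LinearMap.range g
  let ρ : (Fin n → A) →ₗ[A] P := g.rangeRestrict
  have hρ : ∀ x : P, ρ x = x := by
    rintro ⟨_, y, rfl⟩
    exact Subtype.ext (hg y)
  have hproj : Module.Projective A P :=
    Module.Projective.of_split P.subtype ρ (LinearMap.ext hρ)
  let j : P →ₗ[A] P' := ∑ i, ((LinearMap.proj i ∘ₗ P.subtype).smulRight (e' i))
  have hj : ∀ x : P, j x = ∑ i, (x : Fin n → A) i • e' i := fun x => by
    simp [j, LinearMap.sum_apply]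
  let β : A' ⊗[A] P →ₗ[A'] P' := TensorProduct.AlgebraTensorModule.lift
    ((LinearMap.toSpanSingleton A' (P →ₗ[A] P') j))
  have hβ : ∀ s x, β (s ⊗ₜ x) = s • j x := fun s x => rfl
  let b : Fin n → P := fun i => ρ (Pi.single i 1)
  have hb : ∀ i k, (b i : Fin n → A) k = E k i := fun i k => by
    change Matrix.mulVec E (Pi.single i 1) k = _
    simp
  have hxb : ∀ x : P, x = ∑ i, (x : Fin n → A) i • b i := by
    intro x
    conv_lhs => rw [← hρ x, LinearMap.pi_apply_eq_sum_univ ρ]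
    refine Finset.sum_congr rfl fun i _ => ?_
    congr 2; ext k; simp [Pi.single_apply, eq_comm]
  -- α and β need not be inverse to each other. Their composites are the identity modulo the
  -- radical, because E and E' agree there, and Nakayama makes both composites bijective.
  let α : P' →ₗ[A'] A' ⊗[A] P := ∑ i, (f' i).smulRight ((1 : A') ⊗ₜ[A] b i)
  have hα : ∀ y, α y = ∑ i, f' i y • ((1 : A') ⊗ₜ[A] b i) := fun y => by
    simp [α, LinearMap.sum_apply]
  have h1 : Function.Bijective (β ∘ₗ α) := by
    refine LinearMap.bijective_of_sub_mem_smul_top le_rfl _ fun y => ?_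
    have e1 : (β ∘ₗ α) y = ∑ i, f' i y • ∑ k, E k i • e' k := by
      rw [LinearMap.comp_apply, hα, map_sum]
      refine Finset.sum_congr rfl fun i _ => ?_
      rw [map_smul, hβ, one_smul, hj]
      simp only [hb]
    have e2 : (β ∘ₗ α) y - y =
        ∑ i, f' i y • ∑ k, (algebraMap A A' (E k i) - E' k i) • e' k := by
      rw [e1]
      conv_lhs => enter [2]; rw [← h' y]
      rw [← Finset.sum_sub_distrib]
      refine Finset.sum_congr rfl fun i _ => ?_
      rw [← smul_sub]
      congr 1
      conv_lhs => enter [2]; rw [← hE'j i]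
      rw [← Finset.sum_sub_distrib]
      refine Finset.sum_congr rfl fun k _ => ?_
      rw [sub_smul, algebraMap_smul]
    rw [e2]
    exact Submodule.sum_mem _ fun i _ => Submodule.smul_mem _ _ (Submodule.sum_mem _ fun k _ =>
      Submodule.smul_mem_smul (hEE' k i) trivial)
  have h2 : Function.Bijective (α ∘ₗ β) := by
    refine LinearMap.bijective_of_sub_mem_smul_top le_rfl _ fun y => ?_
    induction y with
    | zero => simp
    | add x y hx hy =>
      have : (α ∘ₗ β) (x + y) - (x + y) = ((α ∘ₗ β) x - x) + ((α ∘ₗ β) y - y) := by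
        rw [map_add]; abel
      rw [this]; exact Submodule.add_mem _ hx hy
    | tmul s x =>
      have e0 : s ⊗ₜ[A] x = s • ((1 : A') ⊗ₜ[A] x) := by
        rw [TensorProduct.smul_tmul', smul_eq_mul, mul_one]
      have e3 : ∀ z : A' ⊗[A] P, (α ∘ₗ β) (s • z) - s • z = s • ((α ∘ₗ β) z - z) := fun z => by
        rw [map_smul, smul_sub]
      rw [e0, e3]
      refine Submodule.smul_mem _ _ ?_
      have hx : ∀ i, (x : Fin n → A) i = ∑ k, E i k * (x : Fin n → A) k := by
        intro i
        have := congrArg Subtype.val (hρ x)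
        exact (congrFun this i).symm
      have e1 : (α ∘ₗ β) ((1 : A') ⊗ₜ[A] x) =
          ∑ i, (∑ k, algebraMap A A' ((x : Fin n → A) k) * E' i k) • ((1 : A') ⊗ₜ[A] b i) := by
        rw [LinearMap.comp_apply, hβ, one_smul, hj, hα]
        refine Finset.sum_congr rfl fun i _ => ?_
        congr 1
        rw [map_sum]
        refine Finset.sum_congr rfl fun k _ => ?_
        rw [← algebraMap_smul A', map_smul]; rfl
      have e2 : (1 : A') ⊗ₜ[A] x =
          ∑ i, (∑ k, algebraMap A A' ((x : Fin n → A) k) * algebraMap A A' (E i k)) •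
            ((1 : A') ⊗ₜ[A] b i) := by
        conv_lhs => rw [hxb x, TensorProduct.tmul_sum]
        refine Finset.sum_congr rfl fun i _ => ?_
        rw [TensorProduct.tmul_smul, ← algebraMap_smul A' ((x : Fin n → A) i)]
        congr 1
        rw [hx i, map_sum]
        exact Finset.sum_congr rfl fun k _ => by rw [map_mul, mul_comm]
      rw [e1, e2, ← Finset.sum_sub_distrib]
      refine Submodule.sum_mem _ fun i _ => ?_
      have e4 : ∀ (a c : A') (z : A' ⊗[A] P), a • z - c • z = (a - c) • z := fun a c z =>
        (sub_smul a c z).symm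
      rw [e4, ← Finset.sum_sub_distrib]
      refine Submodule.smul_mem_smul (Ideal.sum_mem _ fun k _ => ?_) trivial
      rw [← mul_sub, ← neg_sub, mul_neg, neg_mem_iff]
      exact Ideal.mul_mem_left _ _ (hEE' i k)
  refine ⟨P, inferInstance, inferInstance, inferInstance, hproj, j, ?_⟩
  have hβb : Function.Bijective β :=
    ⟨Function.Injective.of_comp (f := α) h2.1, Function.Surjective.of_comp (g := α) h1.2⟩
  change Function.Bijective _
  convert hβb using 1
  funext x
  induction x with
  | zero => rw [map_zero, map_zero]
  | add x y hx hy => rw [map_add, map_add, hx, hy]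
  | tmul s x => rfl

end Model

/-! ### Testing elements of a base change on coordinates -/

section BaseChange

variable {A A' : Type u} [CommRing A] [CommRing A'] [Algebra A A']
  {M M' : Type*} [AddCommGroup M] [Module A M] [AddCommGroup M'] [Module A M'] [Module A' M']
  [IsScalarTower A A' M'] {j : M →ₗ[A] M'}

lemma IsBaseChange.induction_add_smul (hj : IsBaseChange A' j) {C : M' → Prop}
    (smul : ∀ (s : A') (x : M), C (s • j x)) (add : ∀ x y, C x → C y → C (x + y)) (y : M') : C y := by
  refine hj.inductionOn y _ ?_ (fun x => ?_) (fun s y hy => ?_) add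
  · simpa using smul 0 0
  · simpa using smul 1 x
  · have : ∀ y : M', ∀ s : A', C (s • y) := by
      intro y
      refine hj.inductionOn y _ (fun s => ?_) (fun x s => smul s x) (fun r y h s => ?_)
        (fun x y hx hy s => ?_)
      · simpa using smul 0 0
      · rw [smul_smul]; exact h _
      · rw [smul_add]; exact add _ _ (hx s) (hy s)
    exact this y s

/-- A finite dual basis extends along a base change. -/
lemma IsBaseChange.exists_dualBasis (hj : IsBaseChange A' j) {n : ℕ} {e : Fin n → M}
    {f : Fin n → M →ₗ[A] A} (h : ∀ x, ∑ i, f i x • e i = x) :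
    ∃ F : Fin n → M' →ₗ[A'] A', (∀ i x, F i (j x) = algebraMap A A' (f i x)) ∧
      ∀ y, ∑ i, F i y • j (e i) = y := by
  let F : Fin n → M' →ₗ[A'] A' := fun i => hj.lift (Algebra.linearMap A A' ∘ₗ f i)
  have hF : ∀ i x, F i (j x) = algebraMap A A' (f i x) := fun i x => by
    simp only [F, hj.lift_eq]; rfl
  refine ⟨F, hF, fun y => ?_⟩
  refine hj.induction_add_smul (C := fun y => ∑ i, F i y • j (e i) = y) (fun s x => ?_)
    (fun x y hx hy => ?_) y
  · conv_rhs => rw [← h x, map_sum, Finset.smul_sum]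
    refine Finset.sum_congr rfl fun i _ => ?_
    rw [map_smul, hF, smul_eq_mul, mul_smul, algebraMap_smul, map_smul]
  · conv_rhs => rw [← hx, ← hy, ← Finset.sum_add_distrib]
    exact Finset.sum_congr rfl fun i _ => by rw [map_add, add_smul]

variable [Module.Finite A M] [Module.Projective A M]

/-- A dual basis of M extends to M', with coordinates transported by `algebraMap`. This reduces the
properties below that assume M projective to the same properties of A → A'. -/
lemma IsBaseChange.injective_of_projective (hj : IsBaseChange A' j)
    (h : Function.Injective (algebraMap A A')) : Function.Injective j := by
  obtain ⟨n, e, f, hef⟩ := Module.Projective.exists_finite_dualBasis A M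
  obtain ⟨F, hF, -⟩ := hj.exists_dualBasis hef
  intro x y hxy
  rw [← hef x, ← hef y]
  refine Finset.sum_congr rfl fun i _ => ?_
  rw [h (by rw [← hF, ← hF, hxy] : algebraMap A A' (f i x) = algebraMap A A' (f i y))]

lemma IsBaseChange.mem_smul_top (hj : IsBaseChange A' j) {J : Ideal A} {J' : Ideal A'}
    (h : ∀ a, algebraMap A A' a ∈ J' → a ∈ J) {x : M} (hx : j x ∈ J' • (⊤ : Submodule A' M')) :
    x ∈ J • (⊤ : Submodule A M) := by
  obtain ⟨n, e, f, hef⟩ := Module.Projective.exists_finite_dualBasis A M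
  obtain ⟨F, hF, hF'⟩ := hj.exists_dualBasis hef
  have h1 := (Submodule.sum_dualBasis_mem_smul_top (e := fun i => j (e i)) hF' J' _).1 hx
  rw [Submodule.sum_dualBasis_mem_smul_top hef]
  exact fun i => h _ (by rw [← hF]; exact h1 i)

omit [Module.Finite A M] [Module.Projective A M] in
lemma IsBaseChange.exists_add_mem (hj : IsBaseChange A' j) {N : Ideal A'}
    (h : ∀ x : A', ∃ a : A, x - algebraMap A A' a ∈ N) (y : M') :
    ∃ x : M, ∃ z ∈ N • (⊤ : Submodule A' M'), y = j x + z := by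
  refine hj.induction_add_smul (C := fun y => ∃ x : M, ∃ z ∈ N • (⊤ : Submodule A' M'), y = j x + z)
    (fun s x => ?_) ?_ y
  · obtain ⟨a, ha⟩ := h s
    refine ⟨a • x, _, Submodule.smul_mem_smul ha (trivial : j x ∈ _), ?_⟩
    rw [sub_smul, algebraMap_smul, map_smul]; abel
  · rintro _ _ ⟨x, z, hz, rfl⟩ ⟨x', z', hz', rfl⟩
    refine ⟨x + x', z + z', Submodule.add_mem _ hz hz', ?_⟩
    rw [map_add]; abel

lemma IsBaseChange.exists_eq_of_closed (hj : IsBaseChange A' j) {p : ℕ}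
    (h : ∀ x : A', (∀ k, ∃ a y, x = algebraMap A A' a + p ^ k • y) → ∃ a, algebraMap A A' a = x)
    {y : M'} (hy : ∀ k, ∃ x z, y = j x + p ^ k • z) : ∃ x, j x = y := by
  obtain ⟨n, e, f, hef⟩ := Module.Projective.exists_finite_dualBasis A M
  obtain ⟨F, hF, hF'⟩ := hj.exists_dualBasis hef
  choose a ha using fun i => h (F i y) (fun k => by
    obtain ⟨x, z, rfl⟩ := hy k
    exact ⟨f i x, F i z, by rw [map_add, map_nsmul, hF]⟩)
  refine ⟨∑ i, a i • e i, ?_⟩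
  rw [map_sum, ← hF' y]
  refine Finset.sum_congr rfl fun i _ => ?_
  rw [map_smul, ← algebraMap_smul A' (a i), ha]

end BaseChange

/-! ### Contracting frame homomorphisms and full faithfulness -/

namespace WindowFrame.Hom

variable {p : ℕ} {A A' : Type u} [CommRing A] [CommRing A'] [Algebra A A']
    {I : Ideal A} {I' : Ideal A'} {𝓕 : WindowFrame p A I} {𝓕' : WindowFrame p A' I'}

/-- A homomorphism of frames `A → A'` is `N`-contracting, for an ideal `N ⊆ I'`, if `A' = A + N`,
`σ₁ N ⊆ p A'`, and `A` is a `p`-adically closed subring of the `p`-torsion free ring `A'` with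
`A ∩ I' = I`. -/
structure IsContracting (_α : WindowFrame.Hom 𝓕 𝓕') (N : Ideal A') : Prop where
  le : N ≤ I'
  exists_sub_mem : ∀ x : A', ∃ a : A, x - algebraMap A A' a ∈ N
  σ₁_mem : ∀ x (h : x ∈ N), ∃ y, 𝓕'.σ₁ ⟨x, le h⟩ = p * y
  torsionFree : ∀ x : A', p * x = 0 → x = 0
  closed : ∀ x : A', (∀ k, ∃ a y, x = algebraMap A A' a + p ^ k • y) → ∃ a, algebraMap A A' a = x
  injective : Function.Injective (algebraMap A A')
  comap : ∀ a, algebraMap A A' a ∈ I' → a ∈ I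

variable {α : WindowFrame.Hom 𝓕 𝓕'} {N : Ideal A'}

/-- The contraction itself: F₁(ax) = σ₁(a)F(x), and σ₁ is divisible by p on N. -/
lemma IsContracting.exists_F₁_eq (h : α.IsContracting N) (X : Window 𝓕') (x : X.M)
    (hx : x ∈ N • (⊤ : Submodule A' X.M)) (hx' : x ∈ X.Q) : ∃ y, X.F₁ ⟨x, hx'⟩ = p • y := by
  induction hx using Submodule.smul_induction_on' with
  | smul a ha m hm =>
    obtain ⟨y, hy⟩ := h.σ₁_mem a ha
    refine ⟨y • X.F m, ?_⟩
    rw [X.F₁_smul ⟨a, h.le ha⟩ m, hy, mul_smul, Nat.cast_smul_eq_nsmul]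
  | add x hx y hy ihx ihy =>
    have hQ : ∀ x ∈ N • (⊤ : Submodule A' X.M), x ∈ X.Q := fun x hx =>
      X.smul_mem (Submodule.smul_mono_left h.le hx)
    obtain ⟨a, ha⟩ := ihx (hQ x hx)
    obtain ⟨b, hb⟩ := ihy (hQ y hy)
    refine ⟨a + b, ?_⟩
    rw [smul_add, ← ha, ← hb, ← map_add]; rfl

/-- An element lies in Q = L ⊕ IT exactly when its projection to T lies in IM. That can be tested on
coordinates after base change, because A ∩ I' = I. -/
lemma IsContracting.mem_Q (h : α.IsContracting N) (X : Window 𝓕) {x : X.M}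
    (hx : (1 : A') ⊗ₜ[A] x ∈ baseQ X I') : x ∈ X.Q := by
  obtain ⟨L, T, hLT, hQ⟩ := X.normal
  let pT : X.M →ₗ[A] X.M := T.projection L hLT.symm
  have hpT : ∀ x ∈ X.Q, pT x ∈ I • (⊤ : Submodule A X.M) := by
    intro x hx
    rw [hQ] at hx
    obtain ⟨l, hl, t, ht, rfl⟩ := Submodule.mem_sup.1 hx
    have h1 : pT l = 0 := Submodule.projection_apply_right hLT.symm ⟨l, hl⟩
    have h2 := Submodule.mem_map_of_mem (f := pT) ht
    rw [Submodule.map_smul''] at h2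
    rw [map_add, h1, zero_add]
    exact Submodule.smul_mono le_rfl le_top h2
  have key : pT.baseChange A' ((1 : A') ⊗ₜ[A] x) ∈ I' • (⊤ : Submodule A' (A' ⊗[A] X.M)) := by
    refine baseQ_induction X (C := fun y _ => pT.baseChange A' y ∈
      I' • (⊤ : Submodule A' (A' ⊗[A] X.M))) (fun s x hx => ?_) (fun a ha y => ?_)
      (fun y _ z _ hy hz => ?_) _ hx
    · rw [LinearMap.baseChange_tmul]
      exact α.map_smul_top_le X (Submodule.tmul_mem_baseChange_of_mem _ (hpT x hx))
    · rw [map_smul]; exact Submodule.smul_mem_smul ha trivial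
    · rw [map_add]; exact Submodule.add_mem _ hy hz
  rw [LinearMap.baseChange_tmul] at key
  have h1 : pT x ∈ I • (⊤ : Submodule A X.M) :=
    (TensorProduct.isBaseChange A X.M A').mem_smul_top h.comap key
  rw [← Submodule.projection_add_projection_eq_self hLT x]
  exact X.Q.add_mem (hQ ▸ Submodule.mem_sup_left (Submodule.projection_apply_mem hLT x))
    (X.smul_mem h1)

/-- Induction on k shows that g(1 ⊗ x) comes from Y.M up to pᵏNM'. Since x is a combination of
values F₁(q), the error pᵏz for q turns into pᵏF₁(z), which is divisible by pᵏ⁺¹. Closedness of A in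
A' then removes the error. -/
lemma IsContracting.exists_eq_tmul (h : α.IsContracting N) (X Y : Window 𝓕)
    (g : α.baseChange.obj X ⟶ α.baseChange.obj Y) (x : X.M) :
    ∃ y : Y.M, (1 : A') ⊗ₜ[A] y = g.f ((1 : A') ⊗ₜ[A] x) := by
  let g' : A' ⊗[A] X.M →ₗ[A'] A' ⊗[A] Y.M := g.f
  have hbY := TensorProduct.isBaseChange A Y.M A'
  have dec : ∀ y : A' ⊗[A] Y.M, ∃ x : Y.M, ∃ z ∈ N • (⊤ : Submodule A' (A' ⊗[A] Y.M)),
      y = (1 : A') ⊗ₜ[A] x + z := hbY.exists_add_mem h.exists_sub_mem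
  have key : ∀ k : ℕ, ∀ x : X.M, ∃ y : Y.M, ∃ z ∈ N • (⊤ : Submodule A' (A' ⊗[A] Y.M)),
      g' ((1 : A') ⊗ₜ[A] x) = (1 : A') ⊗ₜ[A] y + p ^ k • z := by
    intro k
    induction k with
    | zero => intro x; simpa using dec (g' ((1 : A') ⊗ₜ[A] x))
    | succ k ih =>
      intro x
      have hx : x ∈ Submodule.span A (Set.range X.F₁) := by rw [X.span_range]; trivial
      induction hx using Submodule.span_induction with
      | zero => exact ⟨0, 0, Submodule.zero_mem _, by simp⟩
      | add x x' _ _ hx hx' =>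
        obtain ⟨y, z, hz, e⟩ := hx
        obtain ⟨y', z', hz', e'⟩ := hx'
        refine ⟨y + y', z + z', Submodule.add_mem _ hz hz', ?_⟩
        rw [TensorProduct.tmul_add, map_add, e, e', TensorProduct.tmul_add, smul_add]; abel
      | smul a x _ hx =>
        obtain ⟨y, z, hz, e⟩ := hx
        refine ⟨a • y, algebraMap A A' a • z, Submodule.smul_mem _ _ hz, ?_⟩
        rw [TensorProduct.tmul_smul, ← algebraMap_smul A' a, map_smul, e, smul_add,
          TensorProduct.tmul_smul, ← algebraMap_smul A' a ((1 : A') ⊗ₜ[A] y), smul_comm (p ^ (k + 1))]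
      | mem x hx =>
        obtain ⟨q, rfl⟩ := hx
        obtain ⟨y, z, hz, e⟩ := ih (q : X.M)
        have hzQ : p ^ k • z ∈ baseQ Y I' := Submodule.smul_of_tower_mem _ _
          (Submodule.mem_sup_right (Submodule.smul_mono_left h.le hz))
        have hgq : g' ((1 : A') ⊗ₜ[A] (q : X.M)) ∈ baseQ Y I' :=
          g.map_mem _ (tmul_mem_baseQ X 1 q.2)
        have hy : y ∈ Y.Q := by
          -- The error term lies in Q' because N ⊆ I', so the approximation y may be inserted into
          -- F₁.
          refine h.mem_Q Y ?_
          have : (1 : A') ⊗ₜ[A] y = g' ((1 : A') ⊗ₜ[A] (q : X.M)) - p ^ k • z := by rw [e]; abel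
          rw [this]; exact Submodule.sub_mem _ hgq hzQ
        have hzQ' : z ∈ baseQ Y I' :=
          Submodule.mem_sup_right (Submodule.smul_mono_left h.le hz)
        obtain ⟨w, hw'⟩ : ∃ w : A' ⊗[A] Y.M, α.baseF₁ Y ⟨z, hzQ'⟩ = p • w :=
          h.exists_F₁_eq (α.baseChangeObj Y) z hz hzQ'
        have e1 : g' (α.baseF₁ X ⟨(1 : A') ⊗ₜ[A] (q : X.M), tmul_mem_baseQ X 1 q.2⟩) =
            α.baseF₁ Y ⟨g' ((1 : A') ⊗ₜ[A] (q : X.M)), hgq⟩ :=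
          g.comm_F₁ ⟨(1 : A') ⊗ₜ[A] (q : X.M), tmul_mem_baseQ X 1 q.2⟩
        have e2 : (⟨g' ((1 : A') ⊗ₜ[A] (q : X.M)), hgq⟩ : baseQ Y I') =
            ⟨(1 : A') ⊗ₜ[A] y, tmul_mem_baseQ Y 1 hy⟩ + p ^ k • ⟨z, hzQ'⟩ := Subtype.ext e
        rw [e2, map_add, map_nsmul, hw', α.baseF₁_tmul X 1 q q.2, α.baseF₁_tmul Y 1 y hy,
          map_one, one_mul] at e1
        have hu : ∀ (V : Type u) [AddCommGroup V] [Module A V] (v : V),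
            (α.u : A') ⊗ₜ[A] v = (α.u : A') • ((1 : A') ⊗ₜ[A] v) := fun V _ _ v => by
          rw [TensorProduct.smul_tmul', smul_eq_mul, mul_one]
        rw [hu, hu, map_smul] at e1
        have e3 := congrArg (fun v => (↑α.u⁻¹ : A') • v) e1
        simp only [smul_add, smul_smul, Units.inv_mul, one_smul] at e3
        -- The new error, known only to be in pᵏ⁺¹M', is split along A' = A + N; its A-part joins
        -- the approximation so that the remaining error is again N-valued.
        obtain ⟨y2, z2, hz2, e4⟩ := dec ((↑α.u⁻¹ : A') • w)
        refine ⟨Y.F₁ ⟨y, hy⟩ + p ^ (k + 1) • y2, z2, hz2, ?_⟩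
        rw [e3, TensorProduct.tmul_add, TensorProduct.tmul_smul, add_assoc, ← smul_add, ← e4,
          ← pow_succ, smul_comm _ (p ^ (k + 1))]
  exact hbY.exists_eq_of_closed h.closed fun k => by
    obtain ⟨y, z, -, e⟩ := key k x
    exact ⟨y, z, e⟩

/-- Base change along a contracting homomorphism of frames is faithful. -/
lemma IsContracting.faithful (h : α.IsContracting N) : α.baseChange.Faithful where
  map_injective {X Y} g g' e := by
    refine Window.hom_ext (LinearMap.ext fun x => ?_)
    have h1 : (α.baseChange.map g).f ((1 : A') ⊗ₜ[A] x) =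
      (α.baseChange.map g').f ((1 : A') ⊗ₜ[A] x) := by rw [e]
    exact (TensorProduct.isBaseChange A Y.M A').injective_of_projective h.injective h1

/-- Base change along a contracting homomorphism of frames is full. -/
lemma IsContracting.full (h : α.IsContracting N) : α.baseChange.Full where
  map_surjective {X Y} g := by
    have hinj : Function.Injective (fun y : Y.M => (1 : A') ⊗ₜ[A] y) :=
      (TensorProduct.isBaseChange A Y.M A').injective_of_projective h.injective
    let g' : A' ⊗[A] X.M →ₗ[A'] A' ⊗[A] Y.M := g.f
    choose f hf using h.exists_eq_tmul X Y g
    have hf' : ∀ x, (1 : A') ⊗ₜ[A] f x = g' ((1 : A') ⊗ₜ[A] x) := hf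
    let f' : X.M →ₗ[A] Y.M :=
      { toFun := f
        map_add' := fun x y => hinj (by
          simp only [TensorProduct.tmul_add, hf', map_add])
        map_smul' := fun a x => hinj (by
          simp only [RingHom.id_apply, TensorProduct.tmul_smul, hf']
          rw [← algebraMap_smul A' a, map_smul, algebraMap_smul]) }
    have hQ : ∀ x ∈ X.Q, f x ∈ Y.Q := fun x hx => h.mem_Q Y (by
      rw [hf']; exact g.map_mem _ (tmul_mem_baseQ X 1 hx))
    have hu : ∀ (V : Type u) [AddCommGroup V] [Module A V] (v : V),
        (α.u : A') ⊗ₜ[A] v = (α.u : A') • ((1 : A') ⊗ₜ[A] v) := fun V _ _ v => by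
      rw [TensorProduct.smul_tmul', smul_eq_mul, mul_one]
    refine ⟨⟨f', hQ, fun x => hinj ?_, fun x => hinj ?_⟩, ?_⟩
    · change (1 : A') ⊗ₜ[A] f (X.F x) = (1 : A') ⊗ₜ[A] Y.F (f x)
      have e1 : g' (α.tensorMap X.F ((1 : A') ⊗ₜ[A] x)) =
        α.tensorMap Y.F (g' ((1 : A') ⊗ₜ[A] x)) := g.comm_F _
      rwa [α.tensorMap_tmul, map_one, ← hf', ← hf', α.tensorMap_tmul, map_one] at e1
    · change (1 : A') ⊗ₜ[A] f (X.F₁ x) = (1 : A') ⊗ₜ[A] Y.F₁ ⟨f x, _⟩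
      have hgq : g' ((1 : A') ⊗ₜ[A] (x : X.M)) ∈ baseQ Y I' := g.map_mem _ (tmul_mem_baseQ X 1 x.2)
      have e1 : g' (α.baseF₁ X ⟨(1 : A') ⊗ₜ[A] (x : X.M), tmul_mem_baseQ X 1 x.2⟩) =
            α.baseF₁ Y ⟨g' ((1 : A') ⊗ₜ[A] (x : X.M)), hgq⟩ :=
          g.comm_F₁ ⟨(1 : A') ⊗ₜ[A] (x : X.M), tmul_mem_baseQ X 1 x.2⟩
      have e2 : (⟨g' ((1 : A') ⊗ₜ[A] (x : X.M)), hgq⟩ : baseQ Y I') =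
          ⟨(1 : A') ⊗ₜ[A] f x, tmul_mem_baseQ Y 1 (hQ x x.2)⟩ := Subtype.ext (hf' x).symm
      rw [e2, α.baseF₁_tmul X 1 x x.2, α.baseF₁_tmul Y 1 _ (hQ x x.2), map_one, one_mul,
        hu, hu, map_smul, ← hf'] at e1
      have e3 := congrArg (fun v => (↑α.u⁻¹ : A') • v) e1
      simpa only [smul_smul, Units.inv_mul, one_smul] using e3
    · refine Window.hom_ext ?_
      change f'.baseChange A' = g'
      refine LinearMap.ext fun y => ?_
      induction y with
      | zero => simp
      | add x y hx hy => rw [map_add, map_add, hx, hy]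
      | tmul s x =>
        have e0 : s ⊗ₜ[A] x = s • ((1 : A') ⊗ₜ[A] x) := by
          rw [TensorProduct.smul_tmul', smul_eq_mul, mul_one]
        rw [e0, map_smul, map_smul, LinearMap.baseChange_tmul]
        congr 1
        exact hf' x

end WindowFrame.Hom

/-! ### Windows given by a projection and a semilinear map -/

namespace Window

variable {p : ℕ} {A : Type u} [CommRing A] {I : Ideal A} {𝓕 : WindowFrame p A I}

/-- A bijective homomorphism of windows that reflects `Q` is an isomorphism. -/
lemma isIso_of_bijective {X Y : Window 𝓕} (g : X ⟶ Y) (hg : Function.Bijective g.f)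
    (hQ : ∀ x, g.f x ∈ Y.Q → x ∈ X.Q) : IsIso g := by
  let e : X.M ≃ₗ[A] Y.M := LinearEquiv.ofBijective g.f hg
  have he : ∀ y, g.f (e.symm y) = y := e.apply_symm_apply
  have hm : ∀ y ∈ Y.Q, e.symm y ∈ X.Q := fun y hy => hQ _ (by rwa [he])
  let k : Y ⟶ X :=
    { f := e.symm.toLinearMap
      map_mem := hm
      comm_F := fun y => hg.1 (by
        change g.f (e.symm _) = g.f (X.F (e.symm y))
        rw [he, g.comm_F, he])
      comm_F₁ := fun y => hg.1 (by
        change g.f (e.symm _) = g.f (X.F₁ ⟨e.symm (y : Y.M), hm y y.2⟩)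
        rw [he, g.comm_F₁]
        congr 1
        exact Subtype.ext (he _).symm) }
  exact ⟨k, hom_ext (LinearMap.ext fun x => e.symm_apply_apply x), hom_ext (LinearMap.ext he)⟩

/-- The window given by a surjective `σ`-linear map `Ψ` on a module `M` with a projection `π` onto
the direct summand `L` of the normal decomposition, over a frame with an element `ξ ∈ I` such that
`σ₁ ξ = 1`: one has `F₁ = Ψ` on `L` and `F = Ψ` on `T = ker π`. -/
noncomputable def ofProjection (ξ : I) (hξ : 𝓕.σ₁ ξ = 1) {M : Type u} [AddCommGroup M] [Module A M]
    [Module.Finite A M] [Module.Projective A M] (π : M →ₗ[A] M) (hπ : ∀ x, π (π x) = π x)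
    (Ψ : M →ₛₗ[𝓕.σ] M) (hΨ : Function.Surjective Ψ) : Window 𝓕 :=
  have hsm : ∀ x ∈ I • (⊤ : Submodule A M), x - π x ∈ I • (⊤ : Submodule A M) := fun x hx =>
    Submodule.sub_mem _ hx (by
      have := Submodule.mem_map_of_mem (f := π) hx
      rw [Submodule.map_smul''] at this
      exact Submodule.smul_mono le_rfl le_top this)
  -- Compute σ₁(aξ) by linearity in either factor and use σ₁(ξ) = 1.
  have hσ : ∀ a : I, 𝓕.σ₁ a * 𝓕.σ ξ = 𝓕.σ a := fun a => by
    have h1 : (a : A) • ξ = (ξ : A) • a := Subtype.ext (mul_comm _ _)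
    have h2 := congrArg 𝓕.σ₁ h1
    rw [map_smulₛₗ, map_smulₛₗ, hξ, smul_eq_mul, smul_eq_mul, mul_one] at h2
    rw [h2, mul_comm]
  let K := (exists_semilinear 𝓕 Ψ).choose
  have hK : ∀ (a : I) (x : M),
      K ⟨(a : A) • x, Submodule.smul_mem_smul a.2 trivial⟩ = 𝓕.σ₁ a • Ψ x :=
    (exists_semilinear 𝓕 Ψ).choose_spec
  let δ : M →ₗ[A] M := LinearMap.id - π
  have hδ : ∀ x, δ x = x - π x := fun x => by simp [δ]
  let Q : Submodule A M :=
    { carrier := {x | x - π x ∈ I • (⊤ : Submodule A M)}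
      zero_mem' := by simp
      add_mem' := fun {x y} hx hy => by
        have : x + y - π (x + y) = (x - π x) + (y - π y) := by rw [map_add]; abel
        change _ ∈ I • (⊤ : Submodule A M)
        rw [this]; exact Submodule.add_mem _ hx hy
      smul_mem' := fun a x hx => by
        change _ ∈ I • (⊤ : Submodule A M)
        rw [map_smul, ← smul_sub]; exact Submodule.smul_mem _ a hx }
  let F₁ : Q →ₛₗ[𝓕.σ] M :=
    { toFun := fun x => Ψ (π x) + K ⟨x - π x, x.2⟩
      map_add' := fun x y => by
        have : (⟨((x + y : Q) : M) - π (x + y : Q), (x + y).2⟩ : (I • ⊤ : Submodule A M)) =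
          ⟨x - π x, x.2⟩ + ⟨y - π y, y.2⟩ := Subtype.ext (by
            simp only [Submodule.coe_add, map_add]; abel)
        rw [this]
        simp only [Submodule.coe_add, map_add]; abel
      map_smul' := fun a x => by
        have : (⟨((a • x : Q) : M) - π (a • x : Q), (a • x).2⟩ : (I • ⊤ : Submodule A M)) =
          a • ⟨x - π x, x.2⟩ := Subtype.ext (by simp [smul_sub])
        rw [this]
        simp only [Submodule.coe_smul, map_smul, map_smulₛₗ, smul_add] }
  have hF₁ : ∀ x : Q, F₁ x = Ψ (π x) + K ⟨x - π x, x.2⟩ := fun x => rfl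
  { M := M
    Q := Q
    smul_mem := fun x hx => hsm x hx
    normal := by
      refine ⟨LinearMap.range π, LinearMap.ker π, ?_, ?_⟩
      · constructor
        · rw [Submodule.disjoint_def]
          rintro _ ⟨x, rfl⟩ hx
          rw [LinearMap.mem_ker, hπ] at hx
          exact hx
        · rw [codisjoint_iff, eq_top_iff]
          rintro x -
          rw [← add_sub_cancel (π x) x]
          exact Submodule.add_mem _ (Submodule.mem_sup_left ⟨x, rfl⟩) (Submodule.mem_sup_right (by
            rw [LinearMap.mem_ker, map_sub, hπ, sub_self]))
      · apply le_antisymm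
        · intro x hx
          have hx' : x - π x ∈ I • (⊤ : Submodule A M) := hx
          -- The projector δ = 1 − π maps IM into I·ker π, and it fixes x − π x.
          have h1 := Submodule.mem_map_of_mem (f := δ) hx'
          have h2 : δ (x - π x) = x - π x := by
            simp [hδ, hπ]
          rw [Submodule.map_smul'', h2] at h1
          rw [← add_sub_cancel (π x) x]
          refine Submodule.add_mem _ (Submodule.mem_sup_left ⟨x, rfl⟩) (Submodule.mem_sup_right
            (Submodule.smul_mono le_rfl ?_ h1))
          rintro _ ⟨y, -, rfl⟩
          rw [LinearMap.mem_ker]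
          simp [hδ, hπ]
        · rw [sup_le_iff]
          constructor
          · rintro _ ⟨x, rfl⟩
            change π x - π (π x) ∈ I • (⊤ : Submodule A M)
            rw [hπ, sub_self]; exact Submodule.zero_mem _
          · exact fun x hx => hsm x (Submodule.smul_mono le_rfl le_top hx)
    F :=
      -- The factor σ(ξ) is forced: for x ∈ Q one has F(x) = σ₁(ξ)F(x) = F₁(ξx) = σ(ξ)F₁(x).
      { toFun := fun x => 𝓕.σ ξ • Ψ (π x) + Ψ (x - π x)
        map_add' := fun x y => by simp only [map_add, map_sub, smul_add]; abel
        map_smul' := fun a x => by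
          simp only [map_smul, map_sub, map_smulₛₗ, smul_add, smul_sub, smul_comm (𝓕.σ a) (𝓕.σ ξ)] }
    F₁ := F₁
    F₁_smul := by
      intro a x
      have e1 : Ψ (π ((a : A) • x)) = 𝓕.σ₁ a • 𝓕.σ ξ • Ψ (π x) := by
        rw [map_smul, map_smulₛₗ, smul_smul, hσ]
      have e2 : K ⟨(a : A) • x - π ((a : A) • x), hsm _ (Submodule.smul_mem_smul a.2 trivial)⟩ =
          𝓕.σ₁ a • Ψ (x - π x) := by
        rw [← hK]
        congr 1
        have e3 : (a : A) • x - π ((a : A) • x) = (a : A) • (x - π x) := by rw [map_smul, smul_sub]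
        exact Subtype.ext e3
      change Ψ (π ((a : A) • x)) + K ⟨(a : A) • x - π ((a : A) • x), _⟩ =
        𝓕.σ₁ a • (𝓕.σ ξ • Ψ (π x) + Ψ (x - π x))
      rw [smul_add, e1, e2]
    span_range := by
      rw [eq_top_iff]
      rintro y -
      obtain ⟨x, rfl⟩ := hΨ y
      have h0 : (π x + (ξ : A) • (x - π x)) - π (π x + (ξ : A) • (x - π x)) =
          (ξ : A) • (x - π x) := by simp [hπ]
      -- On this element F₁ takes the value Ψ(π x) + σ₁(ξ)Ψ(x − π x) = Ψ(x), so F₁ is even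
      -- surjective.
      refine Submodule.subset_span ⟨⟨π x + (ξ : A) • (x - π x), ?_⟩, ?_⟩
      · change (π x + (ξ : A) • (x - π x)) - π (π x + (ξ : A) • (x - π x)) ∈
          I • (⊤ : Submodule A M)
        rw [h0]; exact Submodule.smul_mem_smul ξ.2 trivial
      · rw [hF₁]
        simp only [h0]
        rw [hK, hξ, one_smul]
        have h1 : π (π x + (ξ : A) • (x - π x)) = π x := by simp [hπ]
        rw [h1, ← map_add]; congr 1; abel }

section ofProjection

variable (ξ : I) (hξ : 𝓕.σ₁ ξ = 1) {M : Type u} [AddCommGroup M] [Module A M]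
    [Module.Finite A M] [Module.Projective A M] (π : M →ₗ[A] M) (hπ : ∀ x, π (π x) = π x)
    (Ψ : M →ₛₗ[𝓕.σ] M) (hΨ : Function.Surjective Ψ)

lemma mem_ofProjection_Q (x : M) : x ∈ (ofProjection ξ hξ π hπ Ψ hΨ).Q ↔
    x - π x ∈ I • (⊤ : Submodule A M) := Iff.rfl

lemma ofProjection_F (x : M) : (ofProjection ξ hξ π hπ Ψ hΨ).F x =
    𝓕.σ ξ • Ψ (π x) + Ψ (x - π x) := rfl

/-- `F₁` of the window given by `Ψ` is determined by its values on `π x` and on `a • (x - π x)`. -/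
lemma exists_ofProjection_F₁ : ∃ K : (I • (⊤ : Submodule A M) : Submodule A M) →ₛₗ[𝓕.σ] M,
    (∀ (a : I) (x : M), K ⟨(a : A) • x, Submodule.smul_mem_smul a.2 trivial⟩ = 𝓕.σ₁ a • Ψ x) ∧
    ∀ (x : M) (hx : x ∈ (ofProjection ξ hξ π hπ Ψ hΨ).Q), (ofProjection ξ hξ π hπ Ψ hΨ).F₁ ⟨x, hx⟩ =
      Ψ (π x) + K ⟨x - π x, (mem_ofProjection_Q ξ hξ π hπ Ψ hΨ _).1 hx⟩ :=
  ⟨(exists_semilinear 𝓕 Ψ).choose, (exists_semilinear 𝓕 Ψ).choose_spec, fun _ _ => rfl⟩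

end ofProjection

end Window

/-! ### Models over A of windows over A' -/

namespace WindowFrame.Hom

variable {p : ℕ} {A A' : Type u} [CommRing A] [CommRing A'] [Algebra A A']
    {I : Ideal A} {I' : Ideal A'} {𝓕 : WindowFrame p A I} {𝓕' : WindowFrame p A' I'}
    (α : WindowFrame.Hom 𝓕 𝓕')

lemma map_smul_restrict (α : WindowFrame.Hom 𝓕 𝓕') {V W : Type*} [AddCommGroup V] [Module A V] [Module A' V]
    [IsScalarTower A A' V] [AddCommGroup W] [Module A W] [Module A' W] [IsScalarTower A A' W]
    (f : V →ₛₗ[𝓕'.σ] W) (a : A) (x : V) : f (a • x) = 𝓕.σ a • f x := by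
  rw [← algebraMap_smul A' a, map_smulₛₗ, α.comm_σ, algebraMap_smul]

section Model

/-- If finite projective modules descend, then a window over `A'` has a normal decomposition that
is defined over `A`. -/
lemma exists_model_of_window {N : Ideal A'} (K : Ideal A) [IsAdicComplete K A]
    (hK : ∀ a ∈ K, algebraMap A A' a ∈ Ideal.jacobson (⊥ : Ideal A'))
    (hN : N ≤ Ideal.jacobson ⊥) (hNK : ∀ a, algebraMap A A' a ∈ N → a ∈ K)
    (hAN : ∀ x : A', ∃ a : A, x - algebraMap A A' a ∈ N)
    (X : Window 𝓕') [Module A X.M] [IsScalarTower A A' X.M] :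
    ∃ (M : Type u) (_ : AddCommGroup M) (_ : Module A M) (_ : Module.Finite A M)
      (_ : Module.Projective A M) (π : M →ₗ[A] M) (j : M →ₗ[A] X.M), IsBaseChange A' j ∧
      (∀ x, π (π x) = π x) ∧ (∀ x, j (π x) ∈ X.Q) ∧
      X.Q ≤ Submodule.span A' (Set.range (j ∘ₗ π)) ⊔ I' • ⊤ := by
  obtain ⟨L, T, hLT, hQ⟩ := X.normal
  have fin : ∀ {L T : Submodule A' X.M}, IsCompl L T → Module.Finite A' L := fun h =>
    Module.Finite.of_surjective _ (Submodule.projectionOnto_surjective h)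
  have proj : ∀ {L T : Submodule A' X.M}, IsCompl L T → Module.Projective A' L := fun h =>
    Module.Projective.of_split (Submodule.subtype _) (Submodule.projectionOnto _ _ h)
      (Submodule.projectionOnto_comp_subtype h)
  have := fin hLT
  have := fin hLT.symm
  have := proj hLT
  have := proj hLT.symm
  -- L and T are descended separately, so that the projection of M₁ × M₂ onto M₁ is a model of the
  -- projection onto L.
  obtain ⟨M₁, _, _, _, _, j₁, h₁⟩ := Module.Projective.exists_model K N hK hN hNK hAN L
  obtain ⟨M₂, _, _, _, _, j₂, h₂⟩ := Module.Projective.exists_model K N hK hN hNK hAN T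
  let e : (L × T) ≃ₗ[A'] X.M := Submodule.prodEquivOfIsCompl L T hLT
  let j : (M₁ × M₂) →ₗ[A] X.M := (e.toLinearMap.restrictScalars A) ∘ₗ j₁.prodMap j₂
  have hj : IsBaseChange A' j :=
    (IsBaseChange.prodMap _ _ h₁ h₂).comp (IsBaseChange.ofEquiv e)
  have hj' : ∀ x, j x = (j₁ x.1 : X.M) + j₂ x.2 := fun x => rfl
  let π : (M₁ × M₂) →ₗ[A] (M₁ × M₂) := LinearMap.inl A M₁ M₂ ∘ₗ LinearMap.fst A M₁ M₂
  have hπ : ∀ x, π x = (x.1, 0) := fun x => rfl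
  have hL : ∀ x, j (π x) = j₁ x.1 := fun x => by rw [hj', hπ]; simp
  refine ⟨M₁ × M₂, inferInstance, inferInstance, inferInstance, inferInstance, π, j, hj,
    fun x => rfl, fun x => ?_, ?_⟩
  · rw [hL, hQ]; exact Submodule.mem_sup_left (j₁ x.1).2
  · rw [hQ]
    refine sup_le_sup ?_ (Submodule.smul_mono le_rfl le_top)
    intro l hl
    have : ∀ y : L, (y : X.M) ∈ Submodule.span A' (Set.range (j ∘ₗ π)) := fun y =>
      h₁.induction_add_smul (C := fun y => (y : X.M) ∈ Submodule.span A' (Set.range (j ∘ₗ π)))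
        (fun s x => Submodule.smul_mem _ s (Submodule.subset_span ⟨(x, 0), hL _⟩))
        (fun x y hx hy => Submodule.add_mem _ hx hy) y
    exact this ⟨l, hl⟩

end Model

section FrobAlong

variable (X : Window 𝓕') [Module A X.M] [IsScalarTower A A' X.M] {M : Type u} [AddCommGroup M]
  [Module A M] (π : M →ₗ[A] M)

/-- The linear maps `M → X.M` that map the image of `π` to `X.Q`. -/
def adaptedMaps : AddSubgroup (M →ₗ[A] X.M) where
  carrier := {g | ∀ x, g (π x) ∈ X.Q}
  zero_mem' := fun _ => X.Q.zero_mem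
  add_mem' := fun hg hh x => X.Q.add_mem (hg x) (hh x)
  neg_mem' := fun hg x => X.Q.neg_mem (hg x)

/-- The `σ`-linear map `x ↦ u⁻¹ F₁ (g (π x)) + F (g (x - π x))` for `g : M → X.M`. -/
noncomputable def frobAlong : adaptedMaps X π →+ (M →ₛₗ[𝓕.σ] X.M) where
  toFun g :=
    -- The inverse of u compensates for F₁'(1 ⊗ x) = u ⊗ F₁(x) in a base change: g is compatible
    -- with the window that π and Ψ define when this map equals g ∘ Ψ.
    { toFun := fun x => (↑α.u⁻¹ : A') • X.F₁ ⟨g.1 (π x), g.2 x⟩ + X.F (g.1 (x - π x))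
      map_add' := fun x y => by
        have e1 : (⟨g.1 (π (x + y)), g.2 (x + y)⟩ : X.Q) = ⟨g.1 (π x), g.2 x⟩ + ⟨g.1 (π y), g.2 y⟩ :=
          Subtype.ext (by simp)
        have e2 : x + y - π (x + y) = (x - π x) + (y - π y) := by rw [map_add]; abel
        rw [e1, e2]
        simp only [map_add, smul_add]
        abel
      map_smul' := fun a x => by
        have e1 : (⟨g.1 (π (a • x)), g.2 (a • x)⟩ : X.Q) = a • ⟨g.1 (π x), g.2 x⟩ :=
          Subtype.ext (by simp)
        have e2 : a • x - π (a • x) = a • (x - π x) := by rw [map_smul, smul_sub]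
        rw [e1, e2, LinearMap.map_smul g.1, α.map_smul_restrict, α.map_smul_restrict, smul_add,
          smul_comm (↑α.u⁻¹ : A')] }
  map_zero' := LinearMap.ext fun x => by
    change (↑α.u⁻¹ : A') • X.F₁ 0 + X.F 0 = 0
    simp
  map_add' g h := LinearMap.ext fun x => by
    change (↑α.u⁻¹ : A') • X.F₁ (⟨g.1 (π x), g.2 x⟩ + ⟨h.1 (π x), h.2 x⟩) +
      X.F (g.1 (x - π x) + h.1 (x - π x)) = (_ + _) + (_ + _)
    simp only [map_add, smul_add]
    abel

lemma frobAlong_apply (g : adaptedMaps X π) (x : M) : α.frobAlong X π g x =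
    (↑α.u⁻¹ : A') • X.F₁ ⟨g.1 (π x), g.2 x⟩ + X.F (g.1 (x - π x)) := rfl

end FrobAlong

end WindowFrame.Hom

/-! ### Division by p and decomposition of semilinear maps -/

lemma LinearMap.exists_eq_nsmul {A B : Type*} [CommRing A] [CommRing B] {τ : A →+* B}
    {M V : Type*} [AddCommGroup M] [Module A M] [AddCommGroup V] [Module B V] (p : ℕ)
    (hV : ∀ v : V, p • v = 0 → v = 0) (f : M →ₛₗ[τ] V) (hf : ∀ x, ∃ y, f x = p • y) :
    ∃ g : M →ₛₗ[τ] V, ∀ x, f x = p • g x := by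
  choose g hg using hf
  have inj : ∀ v w : V, p • v = p • w → v = w := fun v w e =>
    sub_eq_zero.1 (hV _ (by rw [smul_sub, e, sub_self]))
  exact ⟨{ toFun := g
           map_add' := fun x y => inj _ _ (by rw [← hg, map_add, smul_add, hg, hg])
           map_smul' := fun a x => inj _ _ (by rw [← hg, map_smulₛₗ, hg, smul_comm]) }, hg⟩

lemma Module.Projective.nsmul_torsionFree {A : Type*} [CommRing A] {V : Type*} [AddCommGroup V]
    [Module A V] [Module.Finite A V] [Module.Projective A V] {p : ℕ}
    (h : ∀ x : A, p * x = 0 → x = 0) (v : V) (hv : p • v = 0) : v = 0 := by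
  obtain ⟨n, e, f, hef⟩ := Module.Projective.exists_finite_dualBasis A V
  rw [← hef v]
  refine Finset.sum_eq_zero fun i _ => ?_
  rw [h (f i v) (by rw [← nsmul_eq_mul, ← map_nsmul, hv, map_zero]), zero_smul]

/-- Semilinear maps into a base change decompose along a decomposition of the ring. -/
lemma IsBaseChange.exists_semilinear_add {A A' : Type u} [CommRing A] [CommRing A'] [Algebra A A']
    {M M' : Type*} [AddCommGroup M] [Module A M] [AddCommGroup M'] [Module A M'] [Module A' M']
    [IsScalarTower A A' M'] {j : M →ₗ[A] M'} (hj : IsBaseChange A' j) {N : Ideal A'}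
    (h : ∀ x : A', ∃ a : A, x - algebraMap A A' a ∈ N) {σ : A →+* A}
    [Module.Finite A M] [Module.Projective A M]
    (k : M →ₗ[A] (N • ⊤ : Submodule A' M')) (E : M →ₛₗ[σ] M') :
    ∃ (E₀ : M →ₛₗ[σ] M) (E₁ : M →ₛₗ[σ] (N • ⊤ : Submodule A' M')),
      ∀ x, E x = j (E₀ x) + k (E₀ x) + E₁ x := by
  obtain ⟨n, e, f, hef⟩ := Module.Projective.exists_finite_dualBasis A M
  choose m z hz hm using fun i => hj.exists_add_mem h (E (e i))
  let E₀ : M →ₛₗ[σ] M :=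
    { toFun := fun x => ∑ i, σ (f i x) • m i
      map_add' := fun x y => by simp only [map_add, add_smul, Finset.sum_add_distrib]
      map_smul' := fun a x => by
        simp only [map_smul, smul_eq_mul, map_mul, mul_smul, Finset.smul_sum] }
  -- The correction −k(mᵢ) makes this a decomposition along j + k instead of j; it stays in NM'
  -- because k takes values there.
  let E₁ : M →ₛₗ[σ] (N • ⊤ : Submodule A' M') :=
    { toFun := fun x => ∑ i, σ (f i x) • (⟨z i, hz i⟩ - k (m i))
      map_add' := fun x y => by simp only [map_add, add_smul, Finset.sum_add_distrib]
      map_smul' := fun a x => by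
        simp only [map_smul, smul_eq_mul, map_mul, mul_smul, Finset.smul_sum] }
  refine ⟨E₀, E₁, fun x => ?_⟩
  have h0 : E₀ x = ∑ i, σ (f i x) • m i := rfl
  have h1 : E₁ x = ∑ i, σ (f i x) • (⟨z i, hz i⟩ - k (m i)) := rfl
  have e1 : k (E₀ x) + E₁ x = ∑ i, σ (f i x) • (⟨z i, hz i⟩ : (N • ⊤ : Submodule A' M')) := by
    rw [h0, h1, map_sum, ← Finset.sum_add_distrib]
    refine Finset.sum_congr rfl fun i _ => ?_
    rw [map_smul, ← smul_add]; congr 1; abel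
  rw [add_assoc, ← Submodule.coe_add, e1, h0]
  conv_lhs => rw [← hef x]
  rw [map_sum, map_sum, AddSubmonoidClass.coe_finsetSum, ← Finset.sum_add_distrib]
  refine Finset.sum_congr rfl fun i _ => ?_
  rw [map_smulₛₗ, hm, smul_add, map_smul]; rfl

/-! ### Descent homomorphisms of frames -/

namespace WindowFrame.Hom

variable {p : ℕ} {A A' : Type u} [CommRing A] [CommRing A'] [Algebra A A']
    {I : Ideal A} {I' : Ideal A'} {𝓕 : WindowFrame p A I} {𝓕' : WindowFrame p A' I'}

/-- The conditions on a contracting homomorphism of frames under which windows over `A'` descend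
to `A`. -/
structure IsDescent (α : WindowFrame.Hom 𝓕 𝓕') (N : Ideal A') (ξ : I) : Prop
    extends α.IsContracting N where
  bijective : Function.Bijective 𝓕.σ
  σ₁_gen : 𝓕.σ₁ ξ = 1
  complete : IsAdicComplete (I ⊔ Ideal.span {(p : A)}) A
  padic : PadicComplete p A
  padic' : PadicComplete p A'
  padic_ideal : PadicComplete p N

variable {α : WindowFrame.Hom 𝓕 𝓕'} {N : Ideal A'} {ξ : I}

namespace IsDescent

/-- Evaluate F₁(ξx) in two ways, as σ₁'(ξ)F(x) with σ₁'(ξ) = u, and as σ'(ξ)F₁(x). -/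
lemma F_eq (h : α.IsDescent N ξ) (X : Window 𝓕') (x : X.M) (hx : x ∈ X.Q) :
    X.F x = (↑α.u⁻¹ * 𝓕'.σ (algebraMap A A' ξ) : A') • X.F₁ ⟨x, hx⟩ := by
  have h1 := X.F₁_smul ⟨algebraMap A A' ξ, α.map_mem ξ ξ.2⟩ x
  have h2 := α.comm_σ₁ ξ
  rw [h.σ₁_gen, map_one, mul_one] at h2
  rw [h2] at h1
  have h3 : X.F₁ ⟨algebraMap A A' ξ • x,
      X.smul_mem (Submodule.smul_mem_smul (α.map_mem ξ ξ.2) trivial)⟩ =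
      𝓕'.σ (algebraMap A A' ξ) • X.F₁ ⟨x, hx⟩ := by
    rw [← map_smulₛₗ]; rfl
  have h4 : (α.u : A') • X.F x = 𝓕'.σ (algebraMap A A' ξ) • X.F₁ ⟨x, hx⟩ := h1.symm.trans h3
  rw [mul_smul, ← h4, smul_smul, Units.inv_mul, one_smul]

lemma exists_F_eq (h : α.IsDescent N ξ) (X : Window 𝓕') (x : X.M)
    (hx : x ∈ N • (⊤ : Submodule A' X.M)) : ∃ y, X.F x = p • y := by
  have hx' : x ∈ X.Q := X.smul_mem (Submodule.smul_mono_left h.le hx)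
  obtain ⟨y, hy⟩ := h.exists_F₁_eq X x hx hx'
  exact ⟨_, by rw [h.F_eq X x hx', hy, smul_comm]⟩

/-- If a = i + pb in A', replace b by some c ∈ A with b − c ∈ N ⊆ I'; then a − pc lies in A ∩ I' =
I. -/
lemma comap_sup (h : α.IsDescent N ξ) (a : A)
    (ha : algebraMap A A' a ∈ I' ⊔ Ideal.span {(p : A')}) : a ∈ I ⊔ Ideal.span {(p : A)} := by
  obtain ⟨i, hi, y, hy, e⟩ := Submodule.mem_sup.1 ha
  obtain ⟨b, rfl⟩ := Ideal.mem_span_singleton.1 hy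
  obtain ⟨c, hc⟩ := h.exists_sub_mem b
  have h1 : a - p * c ∈ I := h.comap _ (by
    have : algebraMap A A' (a - p * c) = i + p * (b - algebraMap A A' c) := by
      rw [map_sub, map_mul, map_natCast, ← e]; ring
    rw [this]; exact I'.add_mem hi (I'.mul_mem_left _ (h.le hc)))
  have : a = (a - p * c) + p * c := by ring
  rw [this]
  exact Submodule.add_mem _ (Submodule.mem_sup_left h1)
    (Submodule.mem_sup_right (Ideal.mul_mem_right _ _ (Ideal.mem_span_singleton_self _)))

lemma sup_le_jacobson (𝓕 : WindowFrame p A I) :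
    I ⊔ Ideal.span {(p : A)} ≤ Ideal.jacobson ⊥ :=
  sup_le 𝓕.le_rad ((Ideal.span_singleton_le_iff_mem _).2 𝓕.p_mem_rad)

variable (X : Window 𝓕') [Module A X.M] [IsScalarTower A A' X.M] {M : Type u} [AddCommGroup M]
  [Module A M] {π : M →ₗ[A] M}

/-- A linear map into `N X.M` maps the image of `π` to `X.Q`. -/
def toAdapted (h : α.IsDescent N ξ) (π : M →ₗ[A] M) :
    (M →ₗ[A] (N • ⊤ : Submodule A' X.M)) →+ adaptedMaps X π where
  toFun k := ⟨((N • ⊤ : Submodule A' X.M).subtype.restrictScalars A) ∘ₗ k, fun x =>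
    X.smul_mem (Submodule.smul_mono_left h.le (k (π x)).2)⟩
  map_zero' := Subtype.ext (LinearMap.ext fun _ => rfl)
  map_add' _ _ := Subtype.ext (LinearMap.ext fun _ => rfl)

/-- F₁ and F are both divisible by p on N X.M, and X.M is p-torsion free, so the quotient is again
semilinear. A modification of the embedding by an N-valued map is thus felt only one power of p
later. -/
lemma exists_frobAlong_eq (h : α.IsDescent N ξ) (k : M →ₗ[A] (N • ⊤ : Submodule A' X.M)) :
    ∃ E : M →ₛₗ[𝓕.σ] X.M, ∀ x, α.frobAlong X π (h.toAdapted X π k) x = p • E x := by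
  refine LinearMap.exists_eq_nsmul p (Module.Projective.nsmul_torsionFree h.torsionFree) _
    fun x => ?_
  rw [frobAlong_apply]
  obtain ⟨y, hy⟩ := h.exists_F₁_eq X _ (k (π x)).2 ((h.toAdapted X π k).2 x)
  obtain ⟨z, hz⟩ := h.exists_F_eq X _ (k (x - π x)).2
  refine ⟨(↑α.u⁻¹ : A') • y + z, ?_⟩
  rw [smul_add, smul_comm p, ← hy, ← hz]; rfl

variable [Module.Finite A M] [Module.Projective A M] {j : M →ₗ[A] X.M}

/-- Modulo I' + p the contribution of k vanishes, so jΨ is congruent to the Frobenius structure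
along j, whose values generate X.M since F₁(Q) does. By A' = A + N and `comap_sup` this says that Ψ
is surjective modulo I + p, and Nakayama applies. -/
lemma surjective_of_frobAlong (h : α.IsDescent N ξ) (hj : IsBaseChange A' j)
    (hπ : ∀ x, π (π x) = π x) (hjQ : ∀ x, j (π x) ∈ X.Q)
    (hQ : X.Q ≤ Submodule.span A' (Set.range (j ∘ₗ π)) ⊔ I' • ⊤)
    (k : M →ₗ[A] (N • ⊤ : Submodule A' X.M)) (Ψ : M →ₛₗ[𝓕.σ] M)
    (hΨ : ∀ x, α.frobAlong X π (⟨j, hjQ⟩ + h.toAdapted X π k) x - j (Ψ x) ∈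
      (I' ⊔ Ideal.span {(p : A')}) • (⊤ : Submodule A' X.M)) : Function.Surjective Ψ := by
  set K' : Ideal A' := I' ⊔ Ideal.span {(p : A')}
  have hpK : ∀ y : X.M, p • y ∈ K' • (⊤ : Submodule A' X.M) := fun y => by
    rw [← Nat.cast_smul_eq_nsmul A']
    exact Submodule.smul_mem_smul (Submodule.mem_sup_right (Ideal.mem_span_singleton_self _)) trivial
  have hNK : N • (⊤ : Submodule A' X.M) ≤ K' • ⊤ :=
    Submodule.smul_mono_left (h.le.trans le_sup_left)
  -- Surjectivity of σ makes the range of Ψ an A-submodule.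
  have : RingHomSurjective 𝓕.σ := ⟨h.bijective.2⟩
  let R := LinearMap.range Ψ
  let V : Submodule A' X.M := Submodule.span A' (j '' R) ⊔ K' • ⊤
  have h1 : ∀ x, α.frobAlong X π ⟨j, hjQ⟩ x ∈ V := by
    intro x
    have h2 := hΨ x
    rw [map_add, LinearMap.add_apply] at h2
    obtain ⟨E, hE⟩ := h.exists_frobAlong_eq X (π := π) k
    rw [hE] at h2
    have e : α.frobAlong X π ⟨j, hjQ⟩ x =
      j (Ψ x) + ((α.frobAlong X π ⟨j, hjQ⟩ x + p • E x - j (Ψ x)) - p • E x) := by abel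
    rw [e]
    exact V.add_mem (Submodule.mem_sup_left (Submodule.subset_span ⟨_, ⟨x, rfl⟩, rfl⟩))
      (Submodule.mem_sup_right (Submodule.sub_mem _ h2 (hpK _)))
  have h2 : ∀ x, X.F₁ ⟨j (π x), hjQ x⟩ ∈ V := by
    intro x
    have h3 := h1 (π x)
    rw [frobAlong_apply] at h3
    simp only [hπ, sub_self, map_zero, add_zero] at h3
    have h4 := V.smul_mem (α.u : A') h3
    rwa [smul_smul, Units.mul_inv, one_smul] at h4
  have h3 : ∀ x, X.F (j (x - π x)) ∈ V := by
    intro x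
    have h4 := h1 (x - π x)
    rw [frobAlong_apply] at h4
    have h5 : (⟨j (π (x - π x)), hjQ _⟩ : X.Q) = 0 := Subtype.ext (by simp [hπ])
    have h6 : x - π x - π (x - π x) = x - π x := by simp [hπ]
    simp only at h4
    rwa [h5, map_zero, smul_zero, zero_add, h6] at h4
  -- The values of F on j(π x) are not part of the Frobenius structure along j, but `F_eq` expresses
  -- them through F₁.
  have h4 : ∀ y, X.F y ∈ V := by
    intro y
    refine hj.induction_add_smul (C := fun y => X.F y ∈ V) (fun s x => ?_) (fun x y hx hy => ?_) y
    · rw [map_smulₛₗ]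
      refine V.smul_mem _ ?_
      have e : j x = j (π x) + j (x - π x) := by rw [← map_add]; congr 1; abel
      rw [e, map_add, h.F_eq X _ (hjQ x)]
      exact V.add_mem (V.smul_mem _ (h2 x)) (h3 x)
    · rw [map_add]; exact V.add_mem hx hy
  have h5 : ∀ q (hq : q ∈ X.Q), X.F₁ ⟨q, hq⟩ ∈ V := by
    have h6 : ∀ q ∈ Submodule.span A' (Set.range (j ∘ₗ π)), ∃ hq : q ∈ X.Q, X.F₁ ⟨q, hq⟩ ∈ V := by
      intro q hq
      induction hq using Submodule.span_induction with
      | zero =>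
        refine ⟨X.Q.zero_mem, ?_⟩
        have : (⟨0, X.Q.zero_mem⟩ : X.Q) = 0 := rfl
        rw [this, map_zero]; exact V.zero_mem
      | add x y _ _ hx hy =>
        obtain ⟨hx, hx'⟩ := hx
        obtain ⟨hy, hy'⟩ := hy
        refine ⟨X.Q.add_mem hx hy, ?_⟩
        have : (⟨x + y, X.Q.add_mem hx hy⟩ : X.Q) = ⟨x, hx⟩ + ⟨y, hy⟩ := rfl
        rw [this, map_add]; exact V.add_mem hx' hy'
      | smul s x _ hx =>
        obtain ⟨hx, hx'⟩ := hx
        refine ⟨X.Q.smul_mem s hx, ?_⟩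
        have : (⟨s • x, X.Q.smul_mem s hx⟩ : X.Q) = s • ⟨x, hx⟩ := rfl
        rw [this, map_smulₛₗ]; exact V.smul_mem _ hx'
      | mem x hx =>
        obtain ⟨x, rfl⟩ := hx
        exact ⟨hjQ x, h2 x⟩
    have h7 : ∀ q (hq : q ∈ I' • (⊤ : Submodule A' X.M)), X.F₁ ⟨q, X.smul_mem hq⟩ ∈ V := by
      intro q hq
      induction hq using Submodule.smul_induction_on' with
      | smul a ha y hy => rw [X.F₁_smul ⟨a, ha⟩ y]; exact V.smul_mem _ (h4 y)
      | add x hx y hy ihx ihy =>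
        have : (⟨x + y, X.smul_mem (Submodule.add_mem _ hx hy)⟩ : X.Q) =
          ⟨x, X.smul_mem hx⟩ + ⟨y, X.smul_mem hy⟩ := rfl
        rw [this, map_add]; exact V.add_mem ihx ihy
    intro q hq
    obtain ⟨a, ha, b, hb, rfl⟩ := Submodule.mem_sup.1 (hQ hq)
    obtain ⟨ha', ha''⟩ := h6 a ha
    have : (⟨a + b, hq⟩ : X.Q) = ⟨a, ha'⟩ + ⟨b, X.smul_mem hb⟩ := rfl
    rw [this, map_add]; exact V.add_mem ha'' (h7 b hb)
  have hV : ∀ y, y ∈ V := by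
    intro y
    have : Submodule.span A' (Set.range X.F₁) ≤ V := by
      rw [Submodule.span_le]
      rintro _ ⟨q, rfl⟩
      exact h5 q q.2
    rw [X.span_range] at this
    exact this trivial
  -- A'-combinations of elements of j(R) are A-combinations up to N, again because A' = A + N.
  have hspan : ∀ y ∈ Submodule.span A' (j '' R), ∃ x ∈ R, y - j x ∈ N • (⊤ : Submodule A' X.M) := by
    intro y hy
    induction hy using Submodule.span_induction with
    | zero => exact ⟨0, R.zero_mem, by simp⟩
    | mem y hy =>
      obtain ⟨x, hx, rfl⟩ := hy
      exact ⟨x, hx, by simp⟩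
    | add y z _ _ hy hz =>
      obtain ⟨x, hx, h⟩ := hy
      obtain ⟨x', hx', h'⟩ := hz
      refine ⟨x + x', R.add_mem hx hx', ?_⟩
      have : y + z - j (x + x') = (y - j x) + (z - j x') := by rw [map_add]; abel
      rw [this]; exact Submodule.add_mem _ h h'
    | smul s y _ hy =>
      obtain ⟨x, hx, h'⟩ := hy
      obtain ⟨a, ha⟩ := h.exists_sub_mem s
      refine ⟨a • x, R.smul_mem a hx, ?_⟩
      have : s • y - j (a • x) = s • (y - j x) + (s - algebraMap A A' a) • j x := by
        rw [map_smul, sub_smul, algebraMap_smul, smul_sub]; abel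
      rw [this]
      exact Submodule.add_mem _ (Submodule.smul_mem _ _ h') (Submodule.smul_mem_smul ha trivial)
  rw [← LinearMap.range_eq_top, eq_top_iff]
  refine Submodule.le_of_le_smul_of_le_jacobson_bot Module.Finite.fg_top
    (sup_le_jacobson 𝓕) fun m _ => ?_
  obtain ⟨y, hy, z, hz, e⟩ := Submodule.mem_sup.1 (hV (j m))
  obtain ⟨x, hx, hyx⟩ := hspan y hy
  have h6 : m - x ∈ (I ⊔ Ideal.span {(p : A)}) • (⊤ : Submodule A M) := by
    refine hj.mem_smul_top h.comap_sup ?_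
    have : j (m - x) = (y - j x) + z := by rw [map_sub, ← e]; abel
    rw [this]
    exact Submodule.add_mem _ (hNK hyx) hz
  rw [← add_sub_cancel x m]
  exact Submodule.add_mem _ (Submodule.mem_sup_left hx) (Submodule.mem_sup_right h6)

/-- Every maximal ideal contains p, and σ(a) ≡ aᵖ modulo p, so σ preserves and reflects membership
in maximal ideals. -/
lemma bijective_of_surjective [Fact p.Prime] (h : α.IsDescent N ξ) (Ψ : M →ₛₗ[𝓕.σ] M)
    (hΨ : Function.Surjective Ψ) : Function.Bijective Ψ := by
  refine ⟨LinearMap.injective_of_surjective_semilinear h.bijective (fun m hm a => ?_) Ψ hΨ, hΨ⟩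
  have hp : (p : A) ∈ m := Ideal.mem_sInf.1 𝓕.p_mem_rad ⟨bot_le, hm⟩
  have h1 : 𝓕.σ a - a ^ p ∈ m := (Ideal.span_singleton_le_iff_mem _).2 hp (𝓕.frobenius_lift a)
  have hp0 : 0 < p := (Fact.out : p.Prime).pos
  constructor
  · intro h2
    have := m.sub_mem h2 h1
    rw [sub_sub_cancel] at this
    exact hm.isPrime.mem_of_pow_mem _ this
  · intro h2
    have := m.add_mem h1 (m.pow_mem_of_mem h2 p hp0)
    rwa [sub_add_cancel] at this

end IsDescent

end WindowFrame.Hom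

/-! ### Successive approximation and essential surjectivity -/

namespace WindowFrame.Hom

variable {p : ℕ} {A A' : Type u} [CommRing A] [CommRing A'] [Algebra A A']
    {I : Ideal A} {I' : Ideal A'} {𝓕 : WindowFrame p A I} {𝓕' : WindowFrame p A' I'}
    {α : WindowFrame.Hom 𝓕 𝓕'} {N : Ideal A'} {ξ : I}

/-- A criterion for a window to be the base change of a given one. -/
lemma nonempty_baseChange_iso (Y : Window 𝓕) (X : Window 𝓕') [Module A X.M]
    [IsScalarTower A A' X.M] (g : Y.M →ₗ[A] X.M) (hgY : ∀ x ∈ Y.Q, g x ∈ X.Q)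
    (hgF : ∀ x, X.F (g x) = g (Y.F x))
    (hgF₁ : ∀ (x : Y.M) (hx : x ∈ Y.Q), X.F₁ ⟨g x, hgY x hx⟩ = (α.u : A') • g (Y.F₁ ⟨x, hx⟩))
    (hg : IsBaseChange A' g)
    (hle : X.Q ≤ Submodule.span A' (g '' Y.Q) ⊔ I' • ⊤) :
    Nonempty (α.baseChange.obj Y ≅ X) := by
  let J : A' ⊗[A] Y.M →ₗ[A'] X.M := hg.equiv.toLinearMap
  have hJb : Function.Bijective J := hg.equiv.bijective
  have hJ : ∀ s x, J (s ⊗ₜ x) = s • g x := hg.equiv_tmul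
  have hJQ : ∀ y ∈ baseQ Y I', J y ∈ X.Q := by
    intro y hy
    refine baseQ_induction Y (C := fun y _ => J y ∈ X.Q) (fun s x hx => ?_) (fun a ha y => ?_)
      (fun y _ z _ hy hz => ?_) y hy
    · rw [hJ]; exact X.Q.smul_mem s (hgY x hx)
    · rw [map_smul]; exact X.smul_mem (Submodule.smul_mem_smul ha trivial)
    · rw [map_add]; exact X.Q.add_mem hy hz
  have hJF : ∀ y, J (α.tensorMap Y.F y) = X.F (J y) := by
    intro y
    induction y with
    | zero => simp
    | add x y hx hy => simp only [map_add, hx, hy]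
    | tmul s x =>
      rw [α.tensorMap_tmul, hJ, hJ, map_smulₛₗ, hgF]
  let β : α.baseChange.obj Y ⟶ X :=
    { f := J
      map_mem := hJQ
      comm_F := hJF
      comm_F₁ := by
        rintro ⟨y, hy⟩
        refine baseQ_induction Y (C := fun y hy => J (α.baseF₁ Y ⟨y, hy⟩) =
          X.F₁ ⟨J y, hJQ y hy⟩) (fun s x hx => ?_) (fun a ha y => ?_)
          (fun y hy z hz hy' hz' => ?_) y hy
        · have e1 : (⟨J (s ⊗ₜ[A] x), hJQ _ (tmul_mem_baseQ Y s hx)⟩ : X.Q) =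
              s • ⟨g x, hgY x hx⟩ := Subtype.ext (hJ s x)
          have e2 := hJ (𝓕'.σ s * α.u) (Y.F₁ ⟨x, hx⟩)
          rw [e1, map_smulₛₗ, hgF₁, α.baseF₁_tmul Y s x hx, ← mul_smul]
          exact e2
        · have e1 : (⟨J (a • y), hJQ _ (smul_mem_baseQ Y ⟨a, ha⟩ y)⟩ : X.Q) =
              ⟨a • J y, X.smul_mem (Submodule.smul_mem_smul ha trivial)⟩ :=
            Subtype.ext (map_smul J a y)
          rw [e1, X.F₁_smul ⟨a, ha⟩ (J y), α.baseF₁_smul Y a ha, map_smul, hJF]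
        · have e1 : (⟨y + z, Submodule.add_mem _ hy hz⟩ : baseQ Y I') = ⟨y, hy⟩ + ⟨z, hz⟩ := rfl
          have e2 : (⟨J (y + z), hJQ _ (Submodule.add_mem _ hy hz)⟩ : X.Q) =
            ⟨J y, hJQ y hy⟩ + ⟨J z, hJQ z hz⟩ := Subtype.ext (map_add J y z)
          rw [e1, e2, map_add, map_add, map_add, hy', hz'] }
  have hβ : IsIso β := by
    refine Window.isIso_of_bijective β hJb fun y hy => ?_
    have hI : I' • (⊤ : Submodule A' X.M) ≤ (baseQ Y I').map J := by
      rw [← LinearMap.range_eq_top.2 hJb.2, ← Submodule.map_top, ← Submodule.map_smul'']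
      exact Submodule.map_mono le_sup_right
    have hle' : X.Q ≤ (baseQ Y I').map J := by
      refine hle.trans (sup_le (Submodule.span_le.2 ?_) hI)
      rintro _ ⟨x, hx, rfl⟩
      exact ⟨1 ⊗ₜ x, tmul_mem_baseQ Y 1 hx, (hJ 1 x).trans (one_smul _ _)⟩
    obtain ⟨z, hz, e⟩ := hle' hy
    rwa [← hJb.1 e]
  exact ⟨asIso β⟩

namespace IsDescent

section Iteration

variable (X : Window 𝓕') [Module A X.M] [IsScalarTower A A' X.M] {M : Type u} [AddCommGroup M]
  [Module A M] {π : M →ₗ[A] M} [Module.Finite A M] [Module.Projective A M] {j : M →ₗ[A] X.M}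

/-- One step of the successive approximation of a window over `A`. -/
lemma exists_next [Fact p.Prime] (h : α.IsDescent N ξ) (hj : IsBaseChange A' j)
    (hπ : ∀ x, π (π x) = π x) (hjQ : ∀ x, j (π x) ∈ X.Q)
    (hQ : X.Q ≤ Submodule.span A' (Set.range (j ∘ₗ π)) ⊔ I' • ⊤) (n : ℕ)
    (k : M →ₗ[A] (N • ⊤ : Submodule A' X.M)) (Ψ : M →ₛₗ[𝓕.σ] M) (E : M →ₛₗ[𝓕.σ] X.M)
    (hE : ∀ x, α.frobAlong X π (⟨j, hjQ⟩ + h.toAdapted X π k) x =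
      j (Ψ x) + k (Ψ x) + p ^ n • E x) :
    ∃ (H : M →ₗ[A] (N • ⊤ : Submodule A' X.M)) (E₀ : M →ₛₗ[𝓕.σ] M) (E' : M →ₛₗ[𝓕.σ] X.M),
      ∀ x, α.frobAlong X π (⟨j, hjQ⟩ + h.toAdapted X π (k + p ^ n • H)) x =
        j ((Ψ + p ^ n • E₀) x) + (k + p ^ n • H) ((Ψ + p ^ n • E₀) x) + p ^ (n + 1) • E' x := by
  obtain ⟨E₀, E₁, hE₁⟩ := hj.exists_semilinear_add h.exists_sub_mem k E
  -- Bijectivity is needed only after the correction by E₀; for n = 0 the map Ψ itself may be zero.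
  have hΨ : Function.Bijective (Ψ + p ^ n • E₀) := by
    refine h.bijective_of_surjective _ (h.surjective_of_frobAlong X hj hπ hjQ hQ k _ fun x => ?_)
    rw [hE, hE₁]
    have hN : N • (⊤ : Submodule A' X.M) ≤ (I' ⊔ Ideal.span {(p : A')}) • ⊤ :=
      Submodule.smul_mono_left (h.le.trans le_sup_left)
    have e : j (Ψ x) + k (Ψ x) + p ^ n • (j (E₀ x) + k (E₀ x) + E₁ x) - j ((Ψ + p ^ n • E₀) x) =
        ((k (Ψ x) + p ^ n • (k (E₀ x) + E₁ x) : (N • ⊤ : Submodule A' X.M)) : X.M) := by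
      simp only [LinearMap.add_apply, LinearMap.smul_apply, map_add, map_nsmul, Submodule.coe_add,
        smul_add, AddSubmonoidClass.coe_nsmul]
      abel
    rw [e]
    exact hN (Submodule.coe_mem _)
  let e := Equiv.ofBijective _ hΨ
  have he : ∀ x, (Ψ + p ^ n • E₀) (e.symm x) = x := e.apply_symm_apply
  -- H solves H ∘ (Ψ + pⁿE₀) = E₁, so adding pⁿH to k absorbs the N-part of the error on the
  -- right-hand side. It is A-linear because both σ-linear maps twist scalars by the same bijective
  -- σ.
  let H : M →ₗ[A] (N • ⊤ : Submodule A' X.M) :=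
    { toFun := fun x => E₁ (e.symm x)
      map_add' := fun x y => by
        rw [← map_add]; congr 1
        apply hΨ.1
        rw [he, map_add, he, he]
      map_smul' := fun a x => by
        obtain ⟨b, rfl⟩ := h.bijective.2 a
        rw [RingHom.id_apply, ← map_smulₛₗ]; congr 1
        apply hΨ.1
        rw [he, map_smulₛₗ, he] }
  have hH : ∀ x, H ((Ψ + p ^ n • E₀) x) = E₁ x := fun x => by
    change E₁ (e.symm _) = _
    congr 1
    exact e.symm_apply_apply x
  obtain ⟨E', hE'⟩ := h.exists_frobAlong_eq X (π := π) H
  refine ⟨H, E₀, E', fun x => ?_⟩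
  have hadd : h.toAdapted X π (k + p ^ n • H) = h.toAdapted X π k + p ^ n • h.toAdapted X π H := by
    rw [map_add, map_nsmul]
  have hH' : (k + p ^ n • H) ((Ψ + p ^ n • E₀) x) = k ((Ψ + p ^ n • E₀) x) + p ^ n • E₁ x := by
    rw [LinearMap.add_apply, LinearMap.smul_apply, hH]
  rw [hH', hadd, ← add_assoc, map_add, LinearMap.add_apply, hE, hE₁, map_nsmul,
    LinearMap.smul_apply, hE']
  simp only [LinearMap.add_apply, LinearMap.smul_apply, map_add, map_nsmul, Submodule.coe_add,
        smul_add, AddSubmonoidClass.coe_nsmul, pow_succ, mul_smul]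
  abel

omit [Module.Finite A M] [Module.Projective A M] in
/-- The map `frobAlong` is compatible with congruences modulo powers of `p`. -/
lemma exists_frobAlong_sub_eq (h : α.IsDescent N ξ) (k k' : M →ₗ[A] (N • ⊤ : Submodule A' X.M))
    (hjQ : ∀ x, j (π x) ∈ X.Q) (n : ℕ) (hk : ∀ x, ∃ z, k x = k' x + p ^ n • z) (x : M) :
    ∃ z, α.frobAlong X π (⟨j, hjQ⟩ + h.toAdapted X π k) x =
      α.frobAlong X π (⟨j, hjQ⟩ + h.toAdapted X π k') x + p ^ n • z := by
  rw [map_add, map_add, LinearMap.add_apply, LinearMap.add_apply, frobAlong_apply α X π (h.toAdapted X π k),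
    frobAlong_apply α X π (h.toAdapted X π k')]
  obtain ⟨z, hz⟩ := hk (π x)
  obtain ⟨w, hw⟩ := hk (x - π x)
  have hzQ : (z : X.M) ∈ X.Q := X.smul_mem (Submodule.smul_mono_left h.le z.2)
  have e1 : (⟨(h.toAdapted X π k).1 (π x), (h.toAdapted X π k).2 x⟩ : X.Q) =
      ⟨(h.toAdapted X π k').1 (π x), (h.toAdapted X π k').2 x⟩ + p ^ n • ⟨z, hzQ⟩ :=
    Subtype.ext (congrArg Subtype.val hz :)
  have e2 : (h.toAdapted X π k).1 (x - π x) = (h.toAdapted X π k').1 (x - π x) + p ^ n • (w : X.M) :=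
    congrArg Subtype.val hw
  refine ⟨(↑α.u⁻¹ : A') • X.F₁ ⟨z, hzQ⟩ + X.F w, ?_⟩
  rw [e1, e2, map_add, map_add, map_nsmul, map_nsmul, smul_add, smul_add, smul_comm _ (p ^ n)]
  abel

/-- The limit of the successive approximation. -/
lemma exists_fixed [Fact p.Prime] (h : α.IsDescent N ξ) (hj : IsBaseChange A' j)
    (hπ : ∀ x, π (π x) = π x) (hjQ : ∀ x, j (π x) ∈ X.Q)
    (hQ : X.Q ≤ Submodule.span A' (Set.range (j ∘ₗ π)) ⊔ I' • ⊤) :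
    ∃ (k : M →ₗ[A] (N • ⊤ : Submodule A' X.M)) (Ψ : M →ₛₗ[𝓕.σ] M), Function.Surjective Ψ ∧
      ∀ x, α.frobAlong X π (⟨j, hjQ⟩ + h.toAdapted X π k) x = j (Ψ x) + k (Ψ x) := by
  let St := (M →ₗ[A] (N • ⊤ : Submodule A' X.M)) × (M →ₛₗ[𝓕.σ] M)
  let C : ℕ → St → Prop := fun n s => ∃ E : M →ₛₗ[𝓕.σ] X.M, ∀ x,
    α.frobAlong X π (⟨j, hjQ⟩ + h.toAdapted X π s.1) x = j (s.2 x) + s.1 (s.2 x) + p ^ n • E x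
  -- With precision p⁰ everything is error, so the iteration can start from zero.
  have h0 : C 0 (0, 0) := ⟨α.frobAlong X π ⟨j, hjQ⟩, fun x => by simp⟩
  have hs : ∀ (n : ℕ) (s : { s // C n s }), ∃ d : St, C (n + 1) (s.1 + p ^ n • d) := by
    rintro n ⟨s, E, hE⟩
    obtain ⟨H, E₀, E', hE'⟩ := h.exists_next X hj hπ hjQ hQ n s.1 s.2 E hE
    exact ⟨(H, E₀), E', hE'⟩
  choose d hd using hs
  let s : (n : ℕ) → { s // C n s } := fun n =>
    Nat.rec ⟨(0, 0), h0⟩ (fun n s => ⟨s.1 + p ^ n • d n s, hd n s⟩) n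
  -- The iterates are partial sums of p-adic series of maps, which converge since NM' and M are
  -- p-adically complete.
  have hs : ∀ n, (s n).1 = ∑ i ∈ Finset.range n, p ^ i • d i (s i) := by
    intro n
    induction n with
    | zero => rfl
    | succ n ih => rw [Finset.sum_range_succ, ← ih]
  obtain ⟨k, hk⟩ := (PadicComplete.smul_top (V := X.M) h.padic_ideal).exists_sum_semilinear
    (fun n => (d n (s n)).1)
  obtain ⟨Ψ, hΨ⟩ := (PadicComplete.module (V := M) h.padic).exists_sum_semilinear
    (fun n => (d n (s n)).2)
  have hk' : ∀ n x, ∃ z, k x = (s n).1.1 x + p ^ n • z := fun n x => by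
    obtain ⟨z, hz⟩ := hk x n
    refine ⟨z, ?_⟩
    rw [hz, hs, Prod.fst_sum, LinearMap.sum_apply]
    rfl
  have hΨ' : ∀ n x, ∃ z, Ψ x = (s n).1.2 x + p ^ n • z := fun n x => by
    obtain ⟨z, hz⟩ := hΨ x n
    refine ⟨z, ?_⟩
    rw [hz, hs, Prod.snd_sum, LinearMap.sum_apply]
    rfl
  have key : ∀ x, α.frobAlong X π (⟨j, hjQ⟩ + h.toAdapted X π k) x = j (Ψ x) + k (Ψ x) := by
    intro x
    rw [← sub_eq_zero]
    refine (PadicComplete.module (V := X.M) h.padic').haus _ fun n => ?_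
    obtain ⟨E, hE⟩ := (s n).2
    obtain ⟨z, hz⟩ := h.exists_frobAlong_sub_eq X (π := π) k (s n).1.1 hjQ n (hk' n) x
    obtain ⟨w, hw⟩ := hΨ' n x
    obtain ⟨y, hy⟩ := hk' n (Ψ x)
    refine ⟨E x + z - j w - (s n).1.1 w - y, ?_⟩
    rw [hz, hE, hy, hw]
    simp only [map_add, map_nsmul, Submodule.coe_add, AddSubmonoidClass.coe_nsmul, smul_add, smul_sub]
    abel
  refine ⟨k, Ψ, h.surjective_of_frobAlong X hj hπ hjQ hQ k Ψ fun x => ?_, key⟩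
  rw [key, add_sub_cancel_left]
  exact Submodule.smul_mono_left (h.le.trans le_sup_left) (k (Ψ x)).2

end Iteration

/-- Base change along a descent homomorphism of frames is essentially surjective. -/
lemma essSurj [Fact p.Prime] (h : α.IsDescent N ξ) : α.baseChange.EssSurj where
  mem_essImage X := by
    let _ : Module A X.M := Module.compHom _ (algebraMap A A')
    have : IsScalarTower A A' X.M := ⟨fun a s x => by
      rw [Algebra.smul_def, mul_smul]; rfl⟩
    have := h.complete
    have hNI : ∀ a, algebraMap A A' a ∈ N → a ∈ I ⊔ Ideal.span {(p : A)} := fun a ha =>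
      Submodule.mem_sup_left (h.comap a (h.le ha))
    have hK : ∀ a ∈ I ⊔ Ideal.span {(p : A)},
        algebraMap A A' a ∈ Ideal.jacobson (⊥ : Ideal A') := by
      intro a ha
      have : I ⊔ Ideal.span {(p : A)} ≤ (Ideal.jacobson (⊥ : Ideal A')).comap (algebraMap A A') := by
        refine sup_le (fun a ha => 𝓕'.le_rad (α.map_mem a ha))
          ((Ideal.span_singleton_le_iff_mem _).2 ?_)
        rw [Ideal.mem_comap, map_natCast]; exact 𝓕'.p_mem_rad
      exact this ha
    obtain ⟨M, _, _, _, _, π, j, hj, hπ, hjQ, hQ⟩ := exists_model_of_window (N := N) _ hK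
      (h.le.trans 𝓕'.le_rad) hNI h.exists_sub_mem X
    obtain ⟨k, Ψ, hΨ, hk⟩ := h.exists_fixed X hj hπ hjQ hQ
    let Y : Window 𝓕 := Window.ofProjection ξ h.σ₁_gen π hπ Ψ hΨ
    let G : adaptedMaps X π := ⟨j, hjQ⟩ + h.toAdapted X π k
    let g : M →ₗ[A] X.M := G.1
    have hg : ∀ x, g x = j x + k x := fun x => rfl
    have hgQ : ∀ x, g (π x) ∈ X.Q := fun x => G.2 x
    have hG : ∀ x, (↑α.u⁻¹ : A') • X.F₁ ⟨g (π x), hgQ x⟩ + X.F (g (x - π x)) = g (Ψ x) := hk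
    have hF₁ : ∀ x, X.F₁ ⟨g (π x), hgQ x⟩ = (α.u : A') • g (Ψ (π x)) := by
      intro x
      have h1 := hG (π x)
      simp only [hπ, sub_self, map_zero, add_zero] at h1
      rw [← h1, smul_smul, Units.mul_inv, one_smul]
    have hF : ∀ x, X.F (g (x - π x)) = g (Ψ (x - π x)) := by
      intro x
      have h1 := hG (x - π x)
      have h5 : (⟨g (π (x - π x)), hgQ _⟩ : X.Q) = 0 := Subtype.ext (by simp [hπ])
      have h6 : x - π x - π (x - π x) = x - π x := by simp [hπ]
      rwa [h5, map_zero, smul_zero, zero_add, h6] at h1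
    have hkI : ∀ x, (k x : X.M) ∈ I' • (⊤ : Submodule A' X.M) := fun x =>
      Submodule.smul_mono_left h.le (k x).2
    have hgb : IsBaseChange A' g := by
      -- g = j + k agrees with j modulo I', which lies in the radical, so g inherits the base change
      -- property from j.
      have h1 : Function.Bijective (hj.lift g) := by
        refine LinearMap.bijective_of_sub_mem_smul_top 𝓕'.le_rad _ fun y => ?_
        refine hj.induction_add_smul (C := fun y => hj.lift g y - y ∈
          I' • (⊤ : Submodule A' X.M)) (fun s x => ?_) (fun x y hx hy => ?_) y
        · rw [map_smul, ← smul_sub, hj.lift_eq, hg, add_sub_cancel_left]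
          exact Submodule.smul_mem _ _ (hkI x)
        · rw [map_add, add_sub_add_comm]; exact Submodule.add_mem _ hx hy
      refine IsBaseChange.of_equiv (hj.equiv ≪≫ₗ LinearEquiv.ofBijective _ h1) fun x => ?_
      simp [hj.equiv_tmul, hj.lift_eq]
    have hIQ : ∀ x ∈ I • (⊤ : Submodule A M), g x ∈ I' • (⊤ : Submodule A' X.M) := by
      intro x hx
      refine Submodule.smul_induction_on (p := fun x => g x ∈ I' • (⊤ : Submodule A' X.M)) hx ?_ ?_
      · intro a ha x _
        rw [map_smul, ← algebraMap_smul A' a]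
        exact Submodule.smul_mem_smul (α.map_mem a ha) trivial
      · intro x y hx hy
        rw [map_add]; exact Submodule.add_mem _ hx hy
    have hYQ : ∀ x : M, x ∈ Y.Q ↔ x - π x ∈ I • (⊤ : Submodule A M) :=
      Window.mem_ofProjection_Q ξ h.σ₁_gen π hπ Ψ hΨ
    have hsplit : ∀ x, g x = g (π x) + g (x - π x) := fun x => by
      rw [← map_add]; congr 1; abel
    have hgY : ∀ x : M, x ∈ Y.Q → g x ∈ X.Q := by
      intro x hx
      rw [hsplit]
      exact X.Q.add_mem (hgQ x) (X.smul_mem (hIQ _ ((hYQ x).1 hx)))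
    have hgF : ∀ x : M, X.F (g x) = g (Y.F x) := by
      intro x
      have e : Y.F x = 𝓕.σ ξ • Ψ (π x) + Ψ (x - π x) :=
        Window.ofProjection_F ξ h.σ₁_gen π hπ Ψ hΨ x
      rw [hsplit, map_add, h.F_eq X _ (hgQ x), hF₁, hF, e, map_add, map_smul, smul_smul,
        mul_right_comm, Units.inv_mul, one_mul, α.comm_σ, algebraMap_smul]
    have hgF₁ : ∀ (x : M) (hx : x ∈ Y.Q),
        X.F₁ ⟨g x, hgY x hx⟩ = (α.u : A') • g (Y.F₁ ⟨x, hx⟩) := by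
      obtain ⟨K, hK1, hK2⟩ := Window.exists_ofProjection_F₁ ξ h.σ₁_gen π hπ Ψ hΨ
      have hδ : ∀ y ∈ I • (⊤ : Submodule A M), y - π y ∈ I • (⊤ : Submodule A M) := fun y hy =>
        (hYQ y).1 (Y.smul_mem hy)
      -- The statement concerns the ker π component. It is made for y − π y with y ∈ IM, so that it
      -- can be checked on generators y = az, where F = Ψ on z − π z applies.
      have h1 : ∀ y (hy : y ∈ I • (⊤ : Submodule A M)),
          X.F₁ ⟨g (y - π y), X.smul_mem (hIQ _ (hδ y hy))⟩ =
            (α.u : A') • g (K ⟨y - π y, hδ y hy⟩) := by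
        intro y hy
        induction hy using Submodule.smul_induction_on' with
        | smul a ha z hz =>
          have e1 : a • z - π (a • z) = a • (z - π z) := by rw [map_smul, smul_sub]
          have e2 : (⟨a • z - π (a • z), hδ _ (Submodule.smul_mem_smul ha hz)⟩ :
              (I • ⊤ : Submodule A M)) = ⟨a • (z - π z), Submodule.smul_mem_smul ha trivial⟩ :=
            Subtype.ext e1
          have e3 : (⟨g (a • z - π (a • z)), X.smul_mem (hIQ _ (hδ _ (Submodule.smul_mem_smul ha hz)))⟩ :
              X.Q) = ⟨algebraMap A A' a • g (z - π z), X.smul_mem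
                (Submodule.smul_mem_smul (α.map_mem a ha) trivial)⟩ :=
            Subtype.ext ((congrArg g e1).trans ((map_smul g a _).trans (algebraMap_smul A' a _).symm))
          have e4 := X.F₁_smul ⟨algebraMap A A' a, α.map_mem a ha⟩ (g (z - π z))
          have e5 := hK1 ⟨a, ha⟩ (z - π z)
          have e6 := α.comm_σ₁ ⟨a, ha⟩
          simp only at e4 e5 e6
          rw [e2, e3, e4, e5, e6, hF, map_smul, mul_smul, algebraMap_smul]
        | add x hx y hy ihx ihy =>
          have e1 : x + y - π (x + y) = (x - π x) + (y - π y) := by rw [map_add]; abel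
          have e2 : (⟨x + y - π (x + y), hδ _ (Submodule.add_mem _ hx hy)⟩ :
              (I • ⊤ : Submodule A M)) = ⟨x - π x, hδ x hx⟩ + ⟨y - π y, hδ y hy⟩ :=
            Subtype.ext e1
          have e3 : (⟨g (x + y - π (x + y)), X.smul_mem (hIQ _ (hδ _ (Submodule.add_mem _ hx hy)))⟩ :
              X.Q) = ⟨g (x - π x), X.smul_mem (hIQ _ (hδ x hx))⟩ +
                ⟨g (y - π y), X.smul_mem (hIQ _ (hδ y hy))⟩ :=
            Subtype.ext ((congrArg g e1).trans (map_add g _ _))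
          rw [e2, e3, map_add, map_add, map_add, smul_add, ihx, ihy]
      intro x hx
      have hx' := (hYQ x).1 hx
      have h2 := h1 _ hx'
      have e0 : x - π x - π (x - π x) = x - π x := by simp [hπ]
      have h3 : (⟨g (x - π x - π (x - π x)), X.smul_mem (hIQ _ (hδ _ hx'))⟩ : X.Q) =
          ⟨g (x - π x), X.smul_mem (hIQ _ hx')⟩ := Subtype.ext (congrArg g e0)
      have h4 : (⟨x - π x - π (x - π x), hδ _ hx'⟩ : (I • ⊤ : Submodule A M)) = ⟨x - π x, hx'⟩ :=
        Subtype.ext e0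
      rw [h3, h4] at h2
      have e1 : (⟨g x, hgY x hx⟩ : X.Q) = ⟨g (π x), hgQ x⟩ + ⟨g (x - π x), X.smul_mem (hIQ _ hx')⟩ :=
        Subtype.ext (hsplit x)
      have e2 : Y.F₁ ⟨x, hx⟩ = Ψ (π x) + K ⟨x - π x, hx'⟩ := hK2 x hx
      rw [e1, map_add, hF₁, h2, e2, map_add, smul_add]
    refine ⟨Y, nonempty_baseChange_iso Y X g hgY hgF hgF₁ hgb (hQ.trans
      (sup_le (Submodule.span_le.2 ?_) le_sup_right))⟩
    rintro _ ⟨x, rfl⟩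
    -- Since k takes values in I'X.M, the generators j(π x) of X.Q may be exchanged for g(π x).
    have e1 : (j ∘ₗ π) x = g (π x) - k (π x) := by
      rw [hg, add_sub_cancel_right]; rfl
    rw [e1]
    refine Submodule.sub_mem _ (Submodule.mem_sup_left (Submodule.subset_span ⟨π x, ?_, rfl⟩))
      (Submodule.mem_sup_right (hkI _))
    refine (hYQ _).2 ?_
    rw [hπ, sub_self]
    exact Submodule.zero_mem _

/-- Base change along a descent homomorphism of frames is an equivalence. -/
lemma isEquivalence [Fact p.Prime] (h : α.IsDescent N ξ) : α.baseChange.IsEquivalence where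
  faithful := h.faithful
  full := h.full
  essSurj := h.essSurj

end IsDescent

end WindowFrame.Hom

/-! ### Witt vectors of perfect rings: divisibility and completeness -/

namespace WittVector

variable {p : ℕ} [Fact p.Prime] {S : Type u} [CommRing S] [Algebra (ZMod p) S] [PerfectRing S p]

lemma frobenius_bijective_of_perfect :
    Function.Bijective (frobenius : WittVector p S →+* WittVector p S) := by
  -- The zero ring is a perfect 𝔽ₚ-algebra here, but it does not satisfy `CharP S p`, so it is split
  -- off.
  rcases subsingleton_or_charP p S with h | h
  · have := subsingleton_of (p := p) (S := S)
    exact ⟨fun _ _ _ => Subsingleton.elim _ _, fun x => ⟨x, Subsingleton.elim _ _⟩⟩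
  · exact frobenius_bijective p S

/-- [x₀] and pw have disjoint supports, so their coefficients add without carries. In particular x₁
= w₀ᵖ, which makes w a unit if x₁ is one. -/
lemma exists_eq_teichmuller_add (x : WittVector p S) :
    ∃ w, x = teichmuller p (x.coeff 0) + p * w ∧ (IsUnit (x.coeff 1) → IsUnit w) := by
  rcases subsingleton_or_charP p S with h | h
  · have := subsingleton_of (p := p) (S := S)
    exact ⟨0, Subsingleton.elim _ _, fun _ => isUnit_of_subsingleton _⟩
  · have h1 : x - teichmuller p (x.coeff 0) ∈ Ideal.span {(p : WittVector p S)} := by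
      rw [← ker_constantCoeff, RingHom.mem_ker, map_sub, sub_eq_zero]
      exact (teichmuller_coeff_zero p _).symm
    obtain ⟨w, hw⟩ := Ideal.mem_span_singleton.1 h1
    have hx : x = teichmuller p (x.coeff 0) + p * w := by rw [← hw]; ring
    refine ⟨w, hx, fun hu => isUnit_of_coeff_zero ?_⟩
    have h2 : x.coeff 1 = w.coeff 0 ^ p := by
      have h3 : ∀ n, (teichmuller p (x.coeff 0)).coeff n = 0 ∨ ((p : WittVector p S) * w).coeff n = 0 := by
        intro n
        cases n with
        | zero => right; rw [mul_comm]; exact mul_charP_coeff_zero w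
        | succ n => left; exact teichmuller_coeff_pos _ _ _ n.succ_pos
      conv_lhs => rw [hx]
      rw [coeff_add_of_disjoint _ _ _ h3, teichmuller_coeff_pos _ _ _ one_pos, zero_add, mul_comm,
        mul_charP_coeff_succ]
    exact (isUnit_pow_iff (Fact.out : p.Prime).ne_zero).1 (h2 ▸ hu)

lemma eq_zero_of_pow_eq_zero (p : ℕ) [Fact p.Prime] {S : Type*} [CommRing S] [Algebra (ZMod p) S]
    [PerfectRing S p] {s : S} {n : ℕ} (h : s ^ n = 0) : s = 0 := by
  rcases subsingleton_or_charP p S with h' | h'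
  · exact Subsingleton.elim _ _
  · have h1 : (iterateFrobenius S p n) s = 0 := by
      rw [iterateFrobenius_def]
      exact pow_eq_zero_of_le (Nat.lt_pow_self (Fact.out : p.Prime).one_lt).le h
    exact (bijective_iterateFrobenius S p n).1 (h1.trans (map_zero _).symm)

/-- Elements of `W(S)` whose product with a power of `[t]` is divisible by a power of `p`. -/
lemma exists_add_of_pow_dvd (t : S) {m : ℕ} (hm : m ≠ 0) (v : ℕ) (a : WittVector p S)
    (h : (p : WittVector p S) ^ v ∣ teichmuller p t ^ m * a) :
    ∃ c ∈ Ideal.span {x | ∃ d : S, t * d = 0 ∧ x = teichmuller p d}, ∃ b, a = c + p ^ v * b := by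
  induction v generalizing a with
  | zero => exact ⟨0, Ideal.zero_mem _, a, by simp⟩
  | succ v ih =>
    obtain ⟨w, hw, -⟩ := exists_eq_teichmuller_add a
    -- Modulo p one gets tᵐa₀ = 0, and S is reduced because it is perfect. Then [t] kills [a₀], and
    -- a factor p can be cancelled from the hypothesis.
    have h0 : t * a.coeff 0 = 0 := by
      rcases subsingleton_or_charP p S with h' | h'
      · exact Subsingleton.elim _ _
      · have h1 : teichmuller p t ^ m * a ∈ Ideal.span {(p : WittVector p S)} :=
          Ideal.mem_span_singleton.2 ((dvd_pow_self _ v.succ_ne_zero).trans h)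
        rw [← ker_constantCoeff, RingHom.mem_ker, map_mul, map_pow] at h1
        have h2 : t ^ m * a.coeff 0 = 0 := by
          rwa [show constantCoeff (teichmuller p t) = t from teichmuller_coeff_zero p t] at h1
        refine eq_zero_of_pow_eq_zero p (n := m) ?_
        obtain ⟨k, rfl⟩ := Nat.exists_eq_succ_of_ne_zero hm
        rw [mul_pow, pow_succ (a.coeff 0), mul_left_comm, h2, mul_zero]
    have e : teichmuller p t ^ m * a = p * (teichmuller p t ^ m * w) := by
      conv_lhs => rw [hw]
      obtain ⟨k, rfl⟩ := Nat.exists_eq_succ_of_ne_zero hm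
      rw [mul_add, pow_succ, mul_assoc _ _ (teichmuller p (a.coeff 0)), ← map_mul, h0, teichmuller_zero]
      ring
    obtain ⟨c, hc, b, hb⟩ := ih w (by
      obtain ⟨y, hy⟩ := h
      refine ⟨y, p_mul_cancel (p := p) ?_⟩
      rw [← e, hy]; ring)
    refine ⟨teichmuller p (a.coeff 0) + p * c, Ideal.add_mem _ (Ideal.subset_span ⟨_, h0, rfl⟩)
      (Ideal.mul_mem_left _ _ hc), b, ?_⟩
    conv_lhs => rw [hw, hb]
    ring

/-- Every `d` has a `p`-power root annihilated by the same elements. -/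
lemma exists_pow_eq_of_mul_eq_zero (p : ℕ) [Fact p.Prime] {S : Type*} [CommRing S]
    [Algebra (ZMod p) S] [PerfectRing S p] (t d : S) (h : t * d = 0) (n : ℕ) : ∃ e r, t * e = 0 ∧ d = e ^ n * r := by
  rcases subsingleton_or_charP p S with h' | h'
  · exact ⟨0, 0, Subsingleton.elim _ _, Subsingleton.elim _ _⟩
  · obtain ⟨e, rfl⟩ := (bijective_iterateFrobenius S p n).2 d
    have hn : n ≤ p ^ n := (Nat.lt_pow_self (Fact.out : p.Prime).one_lt).le
    rw [iterateFrobenius_def] at h ⊢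
    -- Here e is the pⁿ-th root of d, and (te)^(pⁿ) is a multiple of t·d = 0.
    refine ⟨e, e ^ (p ^ n - n), eq_zero_of_pow_eq_zero p (n := p ^ n) ?_, ?_⟩
    · have hp : 0 < p ^ n := pow_pos (Fact.out : p.Prime).pos _
      obtain ⟨k, hk⟩ := Nat.exists_eq_succ_of_ne_zero hp.ne'
      rw [mul_pow]
      conv_lhs => rw [hk, pow_succ, mul_assoc, ← hk, h, mul_zero]
    · rw [← pow_add]; congr 1; omega

lemma isUnit_natCast {m : ℕ} (h : ¬ p ∣ m) : IsUnit (m : WittVector p S) := by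
  apply isUnit_of_coeff_zero
  have h1 : IsUnit (m : ZMod p) := by
    rw [isUnit_iff_ne_zero, Ne, ZMod.natCast_eq_zero_iff]; exact h
  have h2 := h1.map (algebraMap (ZMod p) S)
  rw [map_natCast] at h2
  have h3 : (m : WittVector p S).coeff 0 = constantCoeff (m : WittVector p S) := rfl
  rwa [h3, map_natCast]

lemma exists_natCast_eq {n : ℕ} (h : n ≠ 0) :
    ∃ u : (WittVector p S)ˣ, (n : WittVector p S) = p ^ padicValNat p n * u := by
  obtain ⟨m, hm⟩ := pow_padicValNat_dvd (p := p) (n := n)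
  have h1 : ¬ p ∣ m := by
    rintro ⟨k, rfl⟩
    refine pow_succ_padicValNat_not_dvd (p := p) h ⟨k, ?_⟩
    rw [pow_succ, mul_assoc]; exact hm
  refine ⟨(isUnit_natCast h1).unit, ?_⟩
  conv_lhs => rw [hm]
  push_cast
  rfl

lemma natCast_mul_cancel {n : ℕ} (h : n ≠ 0) {x y : WittVector p S} (e : n * x = n * y) : x = y := by
  obtain ⟨u, hu⟩ := exists_natCast_eq (p := p) (S := S) h
  rw [hu, mul_assoc, mul_assoc] at e
  have : ∀ v, (p : WittVector p S) ^ v * (u * x) = p ^ v * (u * y) → u * x = u * y := by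
    intro v
    induction v with
    | zero => simp
    | succ v ih => intro h; rw [pow_succ', mul_assoc, mul_assoc] at h; exact ih (p_mul_cancel h)
  exact u.mul_right_inj.1 (this _ e)

section Complete

variable (p) in
/-- The ideal of Witt vectors whose first `k` coefficients are divisible by `t ^ k`. -/
noncomputable def coeffIdeal (t : S) (k : ℕ) : Ideal (WittVector p S) :=
  RingHom.ker ((truncate k).comp (map (Ideal.Quotient.mk (Ideal.span {t ^ k}))))

omit [Algebra (ZMod p) S] [PerfectRing S p] in
lemma mem_coeffIdeal {t : S} {k : ℕ} {x : WittVector p S} :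
    x ∈ coeffIdeal p t k ↔ ∀ i < k, t ^ k ∣ x.coeff i := by
  rw [coeffIdeal, ← RingHom.comap_ker, Ideal.mem_comap, mem_ker_truncate]
  simp only [map_coeff, Ideal.Quotient.eq_zero_iff_mem, Ideal.mem_span_singleton]

omit [Algebra (ZMod p) S] [PerfectRing S p] in
lemma sub_mem_coeffIdeal {t : S} {k : ℕ} {x y : WittVector p S} :
    x - y ∈ coeffIdeal p t k ↔ ∀ i < k, t ^ k ∣ x.coeff i - y.coeff i := by
  rw [coeffIdeal, ← RingHom.comap_ker, Ideal.mem_comap, mem_ker_truncate, map_sub,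
    ← le_coeff_eq_iff_le_sub_coeff_eq_zero]
  simp only [map_coeff, ← Ideal.mem_span_singleton, ← Ideal.Quotient.eq_zero_iff_mem, map_sub,
    sub_eq_zero]

omit [PerfectRing S p] in
-- Together with `coeffIdeal_le_pow` this identifies the (p,[t])-adic topology of W(S) with the
-- coefficientwise t-adic one. With exponent k + k every monomial in p and [t] contains pᵏ or [t]ᵏ.
lemma pow_le_coeffIdeal (t : S) (k : ℕ) :
    (Ideal.span {(p : WittVector p S)} ⊔ Ideal.span {teichmuller p t}) ^ (k + k) ≤
      coeffIdeal p t k := by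
  rcases subsingleton_or_charP p S with h | h
  · have := subsingleton_of (p := p) (S := S)
    intro x _
    rw [Subsingleton.elim x 0]; exact Ideal.zero_mem _
  refine Ideal.sup_pow_add_le_pow_sup_pow.trans (sup_le ?_ ?_)
  · rw [Ideal.span_singleton_pow, Ideal.span_singleton_le_iff_mem, mem_coeffIdeal]
    intro i hi
    rw [coeff_p_pow_eq_zero p S hi.ne]
    exact dvd_zero _
  · rw [Ideal.span_singleton_pow, Ideal.span_singleton_le_iff_mem, mem_coeffIdeal, ← map_pow]
    intro i _
    cases i with
    | zero => rw [teichmuller_coeff_zero]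
    | succ i => rw [teichmuller_coeff_pos _ _ _ i.succ_pos]; exact dvd_zero _

/-- Modulo pⁿ, x is a sum of terms [xᵢ^(1/pⁱ)]pⁱ. Extracting a pⁱ-th root divides the exponent of t
by pⁱ ≤ pⁿ, so divisibility of xᵢ by t^(npⁿ) leaves a factor [t]ⁿ. -/
lemma coeffIdeal_le_pow (t : S) (n : ℕ) : coeffIdeal p t (n * p ^ n) ≤
    (Ideal.span {(p : WittVector p S)} ⊔ Ideal.span {teichmuller p t}) ^ n := by
  rcases subsingleton_or_charP p S with h | h
  · have := subsingleton_of (p := p) (S := S)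
    intro x _
    rw [Subsingleton.elim x 0]; exact Ideal.zero_mem _
  intro x hx
  cases n with
  | zero => simp
  | succ n =>
  set K := Ideal.span {(p : WittVector p S)} ⊔ Ideal.span {teichmuller p t}
  have hpK : (p : WittVector p S) ∈ K := Ideal.mem_sup_left (Ideal.mem_span_singleton_self _)
  have htK : teichmuller p t ∈ K := Ideal.mem_sup_right (Ideal.mem_span_singleton_self _)
  obtain ⟨y, hy⟩ := dvd_sub_sum_teichmuller_iterateFrobeniusEquiv_coeff x n
  rw [sub_eq_iff_eq_add] at hy
  rw [hy]
  refine Ideal.add_mem _ (Ideal.mul_mem_right _ _ (Ideal.pow_mem_pow hpK _))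
    (Ideal.sum_mem _ fun i hi => Ideal.mul_mem_right _ _ ?_)
  have hi' : i ≤ n + 1 := (Finset.mem_Iic.1 hi).trans n.le_succ
  have hp : 0 < p ^ (n + 1) := pow_pos (Fact.out : p.Prime).pos _
  obtain ⟨s, hs⟩ := mem_coeffIdeal.1 hx i (by
    have := Finset.mem_Iic.1 hi
    nlinarith)
  obtain ⟨r, rfl⟩ := (bijective_iterateFrobenius S p i).2 s
  have e : ((_root_.frobeniusEquiv S p).symm ^ i) (x.coeff i) =
      t ^ (n + 1) * (t ^ ((n + 1) * p ^ (n + 1 - i) - (n + 1)) * r) := by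
    rw [← iterateFrobeniusEquiv_symm, RingEquiv.symm_apply_eq, iterateFrobeniusEquiv_def, hs,
      iterateFrobenius_def, ← mul_assoc, ← pow_add, mul_pow, ← pow_mul]
    congr 2
    have h1 : n + 1 ≤ (n + 1) * p ^ (n + 1 - i) :=
      Nat.le_mul_of_pos_right _ (pow_pos (Fact.out : p.Prime).pos _)
    rw [Nat.add_sub_cancel' h1, mul_assoc, ← pow_add, Nat.sub_add_cancel hi']
  rw [e, map_mul, map_pow]
  exact Ideal.mul_mem_right _ _ (Ideal.pow_mem_pow htK _)

lemma isAdicComplete_sup {t : S} (ht : IsAdicComplete (Ideal.span {t}) S) :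
    IsAdicComplete (Ideal.span {(p : WittVector p S)} ⊔ Ideal.span {teichmuller p t})
      (WittVector p S) := by
  set K := Ideal.span {(p : WittVector p S)} ⊔ Ideal.span {teichmuller p t} with hK
  have keyS : ∀ (n : ℕ) (x y : S), x ≡ y [SMOD (Ideal.span {t} ^ n • ⊤ : Ideal S)] ↔
      t ^ n ∣ x - y := by
    intro n x y
    rw [SModEq.sub_mem, smul_eq_mul, Ideal.mul_top, Ideal.span_singleton_pow,
      Ideal.mem_span_singleton]
  have keyW : ∀ (n : ℕ) (x y : WittVector p S), x ≡ y [SMOD (K ^ n • ⊤ : Ideal (WittVector p S))] ↔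
      x - y ∈ K ^ n := by
    intro n x y
    rw [SModEq.sub_mem, smul_eq_mul, Ideal.mul_top]
  refine { haus' := fun x hx => ?_, prec' := fun f hf => ?_ }
  · simp only [keyW, sub_zero] at hx
    ext i
    rw [zero_coeff]
    refine ht.haus _ fun n => (keyS _ _ _).2 ?_
    rw [sub_zero]
    exact (pow_dvd_pow t (by omega : n ≤ n + i + 1)).trans
      (mem_coeffIdeal.1 (pow_le_coeffIdeal t (n + i + 1) (hx _)) i (by omega))
  · simp only [keyW] at hf ⊢
    have hc : ∀ i m n, i < m → m ≤ n →
        t ^ m ∣ (f (m + m)).coeff i - (f (n + n)).coeff i := fun i m n him hmn =>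
      sub_mem_coeffIdeal.1 (pow_le_coeffIdeal t m (hf (add_le_add hmn hmn))) i him
    -- The limit is formed coefficient by coefficient. The index is shifted by i because `coeffIdeal
    -- p t k` controls the i-th coefficient only for i < k.
    have hz : ∀ i, ∃ z, ∀ n, t ^ n ∣ (f (n + i + 1 + (n + i + 1))).coeff i - z := by
      intro i
      obtain ⟨z, hz⟩ := ht.prec (f := fun n => (f (n + i + 1 + (n + i + 1))).coeff i) (by
        intro m n hmn
        rw [keyS]
        exact (pow_dvd_pow t (by omega : m ≤ m + i + 1)).trans
          (hc i (m + i + 1) (n + i + 1) (by omega) (by omega)))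
      exact ⟨z, fun n => (keyS _ _ _).1 (hz n)⟩
    choose z hz using hz
    refine ⟨WittVector.mk p z, fun n => ?_⟩
    let m := n * p ^ n
    have hm : n ≤ m := Nat.le_mul_of_pos_right n (pow_pos (Fact.out : p.Prime).pos _)
    have h1 : f (m + m + (m + m)) - WittVector.mk p z ∈ coeffIdeal p t m := by
      rw [sub_mem_coeffIdeal]
      intro i hi
      have h2 := hz i (m + m - i - 1)
      have h3 : m + m - i - 1 + i + 1 = m + m := by omega
      rw [h3] at h2
      exact (pow_dvd_pow t (by omega)).trans h2
    have h2 := hf (show n ≤ m + m + (m + m) by omega)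
    have h3 := Ideal.add_mem _ h2 (coeffIdeal_le_pow t n h1)
    rwa [sub_add_sub_cancel] at h3

end Complete

end WittVector

/-! ### The divided powers of p -/

namespace PadicInt

lemma factorial_mul_dpowP (p : ℕ) [Fact p.Prime] (n : ℕ) :
    (n.factorial : ℤ_[p]) * dpowP p n = p ^ n :=
  (PadicInt.dividedPowers p).factorial_mul_dpow_eq_pow (Ideal.mem_span_singleton_self _)

end PadicInt

/-! ### Generators of J and of its divided power envelope -/

namespace PerfectoidPresentation

variable {p : ℕ} [Fact p.Prime] {S : Type u} {R : Type v} [CommRing S] [Algebra (ZMod p) S]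
  [PerfectRing S p] [CommRing R] (P : PerfectoidPresentation p S R)

lemma J_eq : P.J = Ideal.span {(p : WittVector p S)} ⊔ Ideal.span {P.ξ} := by
  refine le_antisymm (fun a ha => ?_) (sup_le ((Ideal.span_singleton_le_iff_mem _).2 P.p_mem_J)
    ((Ideal.span_singleton_le_iff_mem _).2 ?_))
  · obtain ⟨r, hr⟩ := Ideal.mem_span_singleton.1 ha
    obtain ⟨b, rfl⟩ := P.surjective r
    have h : a - p * b ∈ RingHom.ker P.π := by
      rw [RingHom.mem_ker, map_sub, hr, map_mul, map_natCast, sub_self]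
    rw [P.ker_eq] at h
    have := Ideal.add_mem _ (Ideal.mem_sup_right h)
      (Ideal.mem_sup_left (Ideal.mul_mem_right b _ (Ideal.mem_span_singleton_self (p : WittVector p S))))
    rwa [sub_add_cancel] at this
  · have h : P.π P.ξ = 0 := by
      rw [← RingHom.mem_ker, P.ker_eq]; exact Ideal.mem_span_singleton_self _
    rw [J, Ideal.mem_comap, h]; exact Ideal.zero_mem _

/-- The Teichmüller representative of `ξ₀`. -/
noncomputable def T : WittVector p S := WittVector.teichmuller p (P.ξ.coeff 0)

/-- The unit condition on ξ₁ enters here; later it makes σ(ξ)/p a unit of A_cris. -/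
lemma exists_xi_eq : ∃ w : WittVector p S, IsUnit w ∧ P.ξ = P.T + p * w := by
  obtain ⟨w, h1, h2⟩ := WittVector.exists_eq_teichmuller_add P.ξ
  exact ⟨w, h2 P.distinguished.isUnit_coeff_one, h1⟩

/-- The generator [ξ₀] complements ξ: it satisfies σ(T) = Tᵖ, and the annihilator of ξ₀ in S can be
lifted multiplicatively to W(S). -/
lemma J_eq_sup_T : P.J = Ideal.span {(p : WittVector p S)} ⊔ Ideal.span {P.T} := by
  obtain ⟨w, -, hw⟩ := P.exists_xi_eq
  have h1 : P.T = P.ξ - p * w := by rw [hw]; ring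
  rw [J_eq]
  have hp : ∀ I : Ideal (WittVector p S), (p : WittVector p S) * w ∈
      Ideal.span {(p : WittVector p S)} ⊔ I := fun I =>
    Ideal.mem_sup_left (Ideal.mul_mem_right _ _ (Ideal.mem_span_singleton_self _))
  refine le_antisymm (sup_le le_sup_left ((Ideal.span_singleton_le_iff_mem _).2 ?_))
    (sup_le le_sup_left ((Ideal.span_singleton_le_iff_mem _).2 ?_))
  · rw [hw]; exact Ideal.add_mem _ (Ideal.mem_sup_right (Ideal.mem_span_singleton_self _)) (hp _)
  · rw [h1]; exact Ideal.sub_mem _ (Ideal.mem_sup_right (Ideal.mem_span_singleton_self _)) (hp _)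

lemma isAdicComplete_J : IsAdicComplete P.J (WittVector p S) := by
  rw [J_eq_sup_T]; exact WittVector.isAdicComplete_sup P.distinguished.complete

/-- `ξ` as an element of `J`. -/
noncomputable def ξJ : P.J :=
  ⟨P.ξ, P.J_eq ▸ Ideal.mem_sup_right (Ideal.mem_span_singleton_self _)⟩

/-- `[ξ₀]` as an element of `J`. -/
noncomputable def TJ : P.J :=
  ⟨P.T, P.J_eq_sup_T ▸ Ideal.mem_sup_right (Ideal.mem_span_singleton_self _)⟩

lemma γ_zero (a : P.J) : P.γ 0 a = 1 := by rw [γ, DividedPowerAlgebra.dp_zero, map_one]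

lemma γ_smul (n : ℕ) (r : WittVector p S) (a : P.J) : P.γ n (r • a) = r ^ n • P.γ n a := by
  rw [γ, DividedPowerAlgebra.dp_smul, map_smul]; rfl

lemma γ_null {n : ℕ} (hn : n ≠ 0) : P.γ n 0 = 0 := by
  rw [γ, DividedPowerAlgebra.dp_null_of_ne_zero hn, map_zero]

lemma γ_mul (m n : ℕ) (a : P.J) : P.γ m a * P.γ n a = (m + n).choose m • P.γ (m + n) a := by
  simp only [γ]; rw [← map_mul, DividedPowerAlgebra.dp_mul, map_nsmul]

lemma γ_add (n : ℕ) (a b : P.J) : P.γ n (a + b) =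
    ∑ k ∈ Finset.HasAntidiagonal.antidiagonal n, P.γ k.1 a * P.γ k.2 b := by
  rw [γ, DividedPowerAlgebra.dp_add, map_sum]
  simp only [map_mul]; rfl

lemma factorial_mul_γ (n : ℕ) (a : P.J) :
    (n.factorial : P.PDEnvelope) * P.γ n a = algebraMap _ _ (a : WittVector p S) ^ n := by
  induction n with
  | zero => simp [γ_zero]
  | succ n ih =>
    have h := P.γ_mul 1 n a
    rw [γ_one, add_comm 1 n, Nat.choose_one_right, nsmul_eq_mul] at h
    rw [Nat.factorial_succ, pow_succ, ← ih, Nat.cast_mul, mul_right_comm, ← h]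
    ring

/-- The p-th power is an integral multiple of γ_{pn}(a), and the last binomial factor is C(pn, n) =
p·C(pn − 1, n − 1). -/
lemma exists_γ_pow_eq {n : ℕ} (hn : n ≠ 0) (a : P.J) : ∃ y, P.γ n a ^ p = p * y := by
  have h : ∀ k : ℕ, ∃ m : ℕ, P.γ n a ^ k = m • P.γ (k * n) a := by
    intro k
    induction k with
    | zero => exact ⟨1, by simp [γ_zero]⟩
    | succ k ih =>
      obtain ⟨m, hm⟩ := ih
      refine ⟨m * (k * n + n).choose (k * n), ?_⟩
      rw [pow_succ, hm, smul_mul_assoc, γ_mul, smul_smul, Nat.succ_mul]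
  obtain ⟨k, hk⟩ := Nat.exists_eq_succ_of_ne_zero (Fact.out : p.Prime).ne_zero
  obtain ⟨m, hm⟩ := h k
  have hd : p ∣ (k * n + n).choose (k * n) := by
    obtain ⟨l, rfl⟩ := Nat.exists_eq_succ_of_ne_zero hn
    have h1 : k * (l + 1) + (l + 1) = (k * (l + 1) + l) + 1 := by ring
    have h2 := Nat.add_one_mul_choose_eq (k * (l + 1) + l) l
    have h3 : (k * (l + 1) + (l + 1)).choose (k * (l + 1)) = (k * (l + 1) + (l + 1)).choose (l + 1) := by
      exact Nat.choose_symm_add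
    have h4 : k * (l + 1) + l + 1 = p * (l + 1) := by rw [hk, Nat.succ_eq_add_one]; ring
    rw [h4, mul_assoc, mul_comm (Nat.choose _ _), mul_left_comm, ← h4] at h2
    rw [h3]
    exact ⟨_, (Nat.eq_of_mul_eq_mul_left l.succ_pos h2).symm⟩
  obtain ⟨c, hc⟩ := hd
  refine ⟨(m * c) • P.γ (k * n + n) a, ?_⟩
  have e : P.γ n a ^ p = P.γ n a ^ (k + 1) := congrArg (P.γ n a ^ ·) hk
  rw [e, pow_succ, hm, smul_mul_assoc, γ_mul, hc]
  simp only [nsmul_eq_mul]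
  push_cast
  ring

/-- Write a ∈ J as yp + zτ. The divided powers of p are scalars, so γₙ(a) is a combination of the
γₘ(τ), and products of these are again multiples of such. It is applied with τ = [ξ₀] for torsion
questions and with τ = ξ for the Frobenius. -/
lemma mem_span_γ {τ : P.J} (hτ : P.J ≤ Ideal.span {(p : WittVector p S)} ⊔ Ideal.span {(τ : WittVector p S)})
    (x : P.PDEnvelope) :
    x ∈ Submodule.span (WittVector p S) (Set.range fun n => P.γ n τ) := by
  set E := Submodule.span (WittVector p S) (Set.range fun n => P.γ n τ) with hE
  have h0 : ∀ n, P.γ n τ ∈ E := fun n => Submodule.subset_span ⟨n, rfl⟩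
  have hmul : ∀ x ∈ E, ∀ y ∈ E, x * y ∈ E := by
    intro x hx y hy
    induction hx using Submodule.span_induction with
    | zero => rw [zero_mul]; exact E.zero_mem
    | add a b _ _ ha hb => rw [add_mul]; exact E.add_mem ha hb
    | smul r a _ ha => rw [smul_mul_assoc]; exact E.smul_mem _ ha
    | mem a ha =>
      obtain ⟨m, rfl⟩ := ha
      induction hy using Submodule.span_induction with
      | zero => rw [mul_zero]; exact E.zero_mem
      | add a b _ _ ha hb => rw [mul_add]; exact E.add_mem ha hb
      | smul r a _ ha => rw [mul_smul_comm]; exact E.smul_mem _ ha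
      | mem b hb =>
        obtain ⟨n, rfl⟩ := hb
        simp only [γ_mul]
        exact nsmul_mem (h0 _) _
  have halg : ∀ a, algebraMap (WittVector p S) P.PDEnvelope a ∈ E := fun a => by
    rw [Algebra.algebraMap_eq_smul_one, ← P.γ_zero τ]
    exact E.smul_mem _ (h0 0)
  have hγ : ∀ n a, P.γ n a ∈ E := by
    intro n a
    obtain ⟨y, hy, z, hz, e⟩ := Submodule.mem_sup.1 (hτ a.2)
    obtain ⟨y, rfl⟩ := Ideal.mem_span_singleton'.1 hy
    obtain ⟨z, rfl⟩ := Ideal.mem_span_singleton'.1 hz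
    have e' : a = y • ⟨p, P.p_mem_J⟩ + z • τ := Subtype.ext e.symm
    rw [e', γ_add]
    refine E.sum_mem fun k _ => ?_
    rw [γ_smul, γ_smul, γ_p]
    exact hmul _ (E.smul_mem _ (halg _)) _ (E.smul_mem _ (h0 _))
  obtain ⟨x, rfl⟩ := Ideal.Quotient.mk_surjective x
  change PDEnvelope.mk P x ∈ E
  induction x using DividedPowerAlgebra.induction_on with
  | C a => exact (PDEnvelope.mk P).commutes a ▸ halg a
  | add f g hf hg => rw [map_add]; exact E.add_mem hf hg
  | dp f n m hf => rw [map_mul]; exact hmul _ hf _ (hγ n m)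

lemma exists_eq_sum_γ {τ : P.J}
    (hτ : P.J ≤ Ideal.span {(p : WittVector p S)} ⊔ Ideal.span {(τ : WittVector p S)})
    (x : P.PDEnvelope) :
    ∃ (N : ℕ) (b : ℕ → WittVector p S), x = ∑ n ∈ Finset.range (N + 1), b n • P.γ n τ := by
  obtain ⟨c, rfl⟩ := Finsupp.mem_span_range_iff_exists_finsupp.1 (P.mem_span_γ hτ x)
  refine ⟨c.support.sup id, c, Finsupp.sum_of_support_subset _ (fun i hi => ?_) _ (by simp)⟩
  rw [Finset.mem_range, Nat.lt_succ_iff]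
  exact Finset.le_sup (f := id) hi

end PerfectoidPresentation

/-! ### Embedding W(S) into a ring with invertible integers -/

namespace WittVector

variable {p : ℕ} [Fact p.Prime] {S : Type u} [CommRing S] [Algebra (ZMod p) S] [PerfectRing S p]

variable (p S) in
/-- There is an injective homomorphism from `W(S)` to a ring in which nonzero integers are units. -/
lemma exists_injective_isUnit_natCast : ∃ (B : Type u) (_ : CommRing B) (f : WittVector p S →+* B),
    Function.Injective f ∧ ∀ n : ℕ, n ≠ 0 → IsUnit (n : B) := by
  let M : Submonoid (WittVector p S) := (nonZeroDivisors ℕ).map (Nat.castRingHom _)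
  have hM : M ≤ nonZeroDivisors (WittVector p S) := by
    rintro _ ⟨n, hn, rfl⟩
    have hn0 : n ≠ 0 := nonZeroDivisors.ne_zero hn
    refine mem_nonZeroDivisors_iff_right.2 fun x hx => natCast_mul_cancel (p := p) hn0 ?_
    rw [mul_zero, mul_comm]; exact hx
  refine ⟨Localization M, inferInstance, algebraMap _ _, IsLocalization.injective _ hM,
    fun n hn => ?_⟩
  have := IsLocalization.map_units (Localization M)
    (⟨(n : WittVector p S), n, mem_nonZeroDivisors_of_ne_zero hn, rfl⟩ : M)
  rwa [map_natCast] at this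

end WittVector

/-- The top term is absorbed into the preceding one, which shortens an expansion in divided powers.
-/
lemma Finset.sum_range_succ_smul_eq {A M : Type*} [Ring A] [AddCommGroup M] [Module A M] (b : ℕ → A)
    (x : ℕ → M) (N : ℕ) (c : A) (h : b (N + 1) • x (N + 1) = c • x N) :
    ∑ n ∈ Finset.range (N + 1 + 1), b n • x n =
      ∑ n ∈ Finset.range (N + 1), (if n = N then b N + c else b n) • x n := by
  rw [Finset.sum_range_succ, h, Finset.sum_range_succ, Finset.sum_range_succ, if_pos rfl,
    add_smul, add_assoc]
  congr 1
  refine Finset.sum_congr rfl fun n hn => ?_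
  rw [if_neg (Finset.mem_range.1 hn).ne]

/-! ### Torsion in the envelope and its intersection with W(S) -/

namespace PerfectoidPresentation

variable {p : ℕ} [Fact p.Prime] {S : Type u} {R : Type v} [CommRing S] [Algebra (ZMod p) S]
  [PerfectRing S p] [CommRing R] (P : PerfectoidPresentation p S R)

/-- A homomorphism from the divided power envelope to a ring in which nonzero integers are units. -/
lemma exists_hom_isUnit : ∃ (B : Type u) (_ : CommRing B) (f : WittVector p S →+* B)
    (φ : P.PDEnvelope →+* B), Function.Injective f ∧ (∀ n : ℕ, n ≠ 0 → IsUnit (n : B)) ∧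
    ∀ w, φ (algebraMap _ _ w) = f w := by
  obtain ⟨B, _, f, hf, hB⟩ := WittVector.exists_injective_isUnit_natCast p S
  have hfac : ∀ n : ℕ, IsUnit (n.factorial : B) := fun n => hB _ n.factorial_ne_zero
  choose g hg using fun n => (hfac n).exists_left_inv
  have key : ∀ (n : ℕ) {x y : B}, (n.factorial : B) * x = n.factorial * y → x = y := fun n x y h =>
    (hfac n).mul_left_cancel h
  have hg' : ∀ n : ℕ, (n.factorial : B) * g n = 1 := fun n => by rw [mul_comm, hg]
  -- With n! invertible, f(a)ⁿ/n! is the only possible divided power.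
  obtain ⟨φ, h1, -⟩ := P.exists_lift f (fun n a => g n * f a ^ n)
    (fun a => by simpa using hg 0)
    (fun n r a => by
      change g n * f (r * a) ^ n = _
      rw [map_mul, mul_pow]; ring)
    (fun m n a => by
      refine key (m + n) ?_
      have h := Nat.add_choose_mul_factorial_mul_factorial m n
      rw [← Nat.choose_symm_add] at h
      have h' := congrArg (Nat.cast : ℕ → B) h
      push_cast at h'
      rw [nsmul_eq_mul]
      calc _ = ((m + n).choose m * m.factorial * n.factorial) * (g m * f a ^ m * (g n * f a ^ n)) := by
            rw [h']
        _ = (m + n).choose m * (m.factorial * g m) * (n.factorial * g n) * f a ^ (m + n) := by ring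
        _ = (m + n).choose m * ((m + n).factorial * g (m + n)) * f a ^ (m + n) := by
            rw [hg', hg', hg']; ring
        _ = _ := by ring)
    (fun n a b => by
      refine key n ?_
      rw [← mul_assoc, hg', one_mul]
      change f ((a : WittVector p S) + b) ^ n = _
      rw [map_add, (Commute.all _ _).add_pow', Finset.mul_sum]
      refine Finset.sum_congr rfl fun k hk => ?_
      obtain rfl := Finset.HasAntidiagonal.mem_antidiagonal.1 hk
      have h := Nat.add_choose_mul_factorial_mul_factorial k.1 k.2
      rw [← Nat.choose_symm_add] at h
      have h' := congrArg (Nat.cast : ℕ → B) h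
      push_cast at h'
      rw [← h', nsmul_eq_mul]
      calc _ = (k.1 + k.2).choose k.1 * (k.1.factorial * g k.1) * (k.2.factorial * g k.2) *
            (f a ^ k.1 * f b ^ k.2) := by rw [hg', hg']; ring
        _ = _ := by ring)
    (fun a => by
      have := hg 1
      rw [Nat.factorial_one, Nat.cast_one, mul_one] at this
      rw [this]; ring)
    (fun n => by
      refine key n ?_
      have h := congrArg (fun x => f (WittVector.ofPadicInt p S x)) (PadicInt.factorial_mul_dpowP p n)
      simp only [map_mul, map_natCast, map_pow] at h
      rw [h, ← mul_assoc, hg', map_natCast, one_mul])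
  exact ⟨B, inferInstance, f, φ, hf, hB, h1⟩

lemma algebraMap_injective : Function.Injective (algebraMap (WittVector p S) P.PDEnvelope) := by
  obtain ⟨B, _, f, φ, hf, -, h⟩ := P.exists_hom_isUnit
  intro x y e
  exact hf (by rw [← h, e, h])

/-- If ξ₀d = 0, write d = eⁿr with ξ₀e = 0; then [d]γₙ([ξ₀]) = [r]γₙ([e][ξ₀]) = 0. -/
lemma smul_γ_TJ_eq_zero {c : WittVector p S} (hc : c ∈ Ideal.span {x | ∃ d : S,
    P.ξ.coeff 0 * d = 0 ∧ x = WittVector.teichmuller p d}) {n : ℕ} (hn : n ≠ 0) :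
    c • P.γ n P.TJ = 0 := by
  induction hc using Submodule.span_induction with
  | zero => exact zero_smul _ _
  | add x y _ _ hx hy => rw [add_smul, hx, hy, add_zero]
  | smul r x _ hx => rw [smul_eq_mul, mul_smul, hx, smul_zero]
  | mem x hx =>
    obtain ⟨d, hd, rfl⟩ := hx
    obtain ⟨e, r, he, rfl⟩ := WittVector.exists_pow_eq_of_mul_eq_zero p (P.ξ.coeff 0) d hd n
    have h0 : WittVector.teichmuller p e • P.TJ = 0 := Subtype.ext (by
      change WittVector.teichmuller p e * WittVector.teichmuller p (P.ξ.coeff 0) = 0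
      rw [← map_mul, mul_comm, he, WittVector.teichmuller_zero])
    rw [map_mul, map_pow, mul_comm, mul_smul, ← γ_smul, h0, γ_null _ hn, smul_zero]

/-- Elements annihilating `[ξ₀]`, up to multiples of an integer. -/
lemma exists_add_of_dvd {m : ℕ} (hm : m ≠ 0) {q : ℕ} (hq : q ≠ 0) {a : WittVector p S}
    (h : (q : WittVector p S) ∣ P.T ^ m * a) :
    ∃ c b, a = c + q * b ∧ ∀ n ≠ 0, c • P.γ n P.TJ = 0 := by
  obtain ⟨u, hu⟩ := WittVector.exists_natCast_eq (p := p) (S := S) hq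
  obtain ⟨c, hc, b, rfl⟩ := WittVector.exists_add_of_pow_dvd (P.ξ.coeff 0) hm _ a
    ((Dvd.intro _ hu.symm).trans h)
  refine ⟨c, ↑u⁻¹ * b, ?_, fun n hn => P.smul_γ_TJ_eq_zero hc hn⟩
  rw [hu, mul_assoc, u.mul_inv_cancel_left]

lemma mul_T_eq_zero {c : WittVector p S} (h : ∀ n ≠ 0, c • P.γ n P.TJ = 0) : c * P.T = 0 := by
  have h1 := h 1 one_ne_zero
  rw [γ_one, Algebra.smul_def, ← map_mul] at h1
  exact P.algebraMap_injective (h1.trans (map_zero _).symm)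

lemma descFactorial_smul_γ {n N : ℕ} (h : n ≤ N) (a : P.J) :
    (N.factorial : P.PDEnvelope) * P.γ n a =
      algebraMap _ _ (((N.factorial / n.factorial : ℕ) : WittVector p S) * (a : WittVector p S) ^ n) := by
  obtain ⟨k, hk⟩ := Nat.factorial_dvd_factorial h
  rw [hk, Nat.mul_div_cancel_left _ n.factorial_pos, map_mul, map_natCast, map_pow,
    ← factorial_mul_γ]
  push_cast; ring

/-- Multiplication by (N + 1)! moves an expansion into W(S), where modulo N + 1 only the top term
survives. -/
lemma exists_factorial_mul_sum_eq (N : ℕ) (b : ℕ → WittVector p S) :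
    ∃ y, (((N + 1).factorial : ℕ) : P.PDEnvelope) *
      (∑ n ∈ Finset.range (N + 1 + 1), b n • P.γ n P.TJ) =
      algebraMap _ _ (P.T ^ (N + 1) * b (N + 1) + ((N + 1 : ℕ) : WittVector p S) * y) := by
  refine ⟨∑ n ∈ Finset.range (N + 1), b n *
    (((N.factorial / n.factorial : ℕ) : WittVector p S) * P.T ^ n), ?_⟩
  rw [Finset.sum_range_succ, mul_add, map_add, add_comm]
  congr 1
  · rw [Algebra.smul_def, mul_left_comm, factorial_mul_γ, ← map_pow, ← map_mul, mul_comm]; rfl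
  · rw [Nat.factorial_succ, Nat.cast_mul, mul_assoc, map_mul, map_natCast]
    congr 1
    rw [Finset.mul_sum, map_sum]
    refine Finset.sum_congr rfl fun n hn => ?_
    rw [Algebra.smul_def, mul_left_comm,
      P.descFactorial_smul_γ (Nat.lt_succ_iff.1 (Finset.mem_range.1 hn)), ← map_mul]
    rfl

/-- Induction on the length. If the image vanishes, N + 1 divides T^(N+1)·b(N+1), so b(N+1) = c + (N
+ 1)b' with c killing the γₙ(T) for n > 0. Then (N + 1)γ_{N+1}(T) = Tγ_N(T) turns the top term into
a multiple of γ_N(T). -/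
lemma eq_zero_of_hom_eq_zero {B : Type*} [CommRing B] {f : WittVector p S →+* B}
    {φ : P.PDEnvelope →+* B} (hf : Function.Injective f) (hφ : ∀ w, φ (algebraMap _ _ w) = f w)
    (N : ℕ) (b : ℕ → WittVector p S)
    (h : φ (∑ n ∈ Finset.range (N + 1), b n • P.γ n P.TJ) = 0) :
    ∑ n ∈ Finset.range (N + 1), b n • P.γ n P.TJ = 0 := by
  induction N generalizing b with
  | zero =>
    rw [zero_add, Finset.sum_range_one, γ_zero, ← Algebra.algebraMap_eq_smul_one, hφ] at h
    rw [zero_add, Finset.sum_range_one, hf (h.trans (map_zero f).symm), zero_smul]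
  | succ N ih =>
    have h1 : ((N + 1 : ℕ) : WittVector p S) ∣ P.T ^ (N + 1) * b (N + 1) := by
      obtain ⟨y, hy⟩ := P.exists_factorial_mul_sum_eq N b
      have h2 := congrArg φ hy
      rw [map_mul, h, mul_zero, hφ] at h2
      have h3 := hf (h2.symm.trans (map_zero f).symm)
      exact ⟨-y, by linear_combination h3⟩
    obtain ⟨c, b', hb, hc⟩ := P.exists_add_of_dvd N.succ_ne_zero N.succ_ne_zero h1
    have e1 : b (N + 1) • P.γ (N + 1) P.TJ = (b' * P.T) • P.γ N P.TJ := by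
      have h2 := P.γ_mul 1 N P.TJ
      rw [γ_one, add_comm 1 N, Nat.choose_one_right] at h2
      calc b (N + 1) • P.γ (N + 1) P.TJ = (((N + 1 : ℕ) : WittVector p S) * b') • P.γ (N + 1) P.TJ := by
            rw [hb, add_smul, hc _ N.succ_ne_zero, zero_add]
        _ = b' • ((N + 1 : ℕ) • P.γ (N + 1) P.TJ) := by
            rw [mul_comm, mul_smul, Nat.cast_smul_eq_nsmul]
        _ = b' • (P.T • P.γ N P.TJ) := by rw [← h2, Algebra.smul_def P.T]; rfl
        _ = _ := by rw [mul_smul]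
    rw [Finset.sum_range_succ_smul_eq b _ N _ e1] at h ⊢
    exact ih _ h

lemma natCast_mul_eq_zero {n : ℕ} (hn : n ≠ 0) {x : P.PDEnvelope} (h : (n : P.PDEnvelope) * x = 0) :
    x = 0 := by
  obtain ⟨B, _, f, φ, hf, hB, hφ⟩ := P.exists_hom_isUnit
  obtain ⟨N, b, rfl⟩ := P.exists_eq_sum_γ (τ := P.TJ) P.J_eq_sup_T.le x
  refine P.eq_zero_of_hom_eq_zero hf hφ N b ((hB n hn).mul_left_cancel ?_)
  have := congrArg φ h
  rwa [map_mul, map_zero, map_natCast, ← mul_zero (n : B)] at this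

lemma natCast_mul_cancel {n : ℕ} (hn : n ≠ 0) {x y : P.PDEnvelope}
    (h : (n : P.PDEnvelope) * x = n * y) : x = y := by
  rw [← sub_eq_zero] at h ⊢
  exact P.natCast_mul_eq_zero hn (by rw [mul_sub, h])

lemma padicValNat_factorial_le (n : ℕ) : padicValNat p n.factorial ≤ n := by
  have h1 := sub_one_mul_padicValNat_factorial (p := p) n
  have h2 := (Fact.out : p.Prime).two_le
  nlinarith [Nat.sub_le n (p.digits n).sum, Nat.sub_add_cancel (show 1 ≤ p by omega)]

/-- With v the p-adic valuation of n!, pᵏTⁿ/n! is a unit times p^(k−v)Tⁿ; since v ≤ n, this lies in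
Jᵏ. -/
lemma pow_mul_γ_mem {n k : ℕ} (h : n ≤ k) :
    ∃ c ∈ P.J ^ k, (p : P.PDEnvelope) ^ k * P.γ n P.TJ = algebraMap _ _ c := by
  obtain ⟨u, hu⟩ := WittVector.exists_natCast_eq (p := p) (S := S) n.factorial_ne_zero
  set v := padicValNat p n.factorial with hv
  have hvn : v ≤ n := padicValNat_factorial_le n
  refine ⟨↑u⁻¹ * (p ^ (k - v) * P.T ^ n), Ideal.mul_mem_left _ _ ?_, ?_⟩
  · refine Ideal.pow_le_pow_right (by omega : k ≤ (k - v) + n) ?_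
    rw [pow_add]
    exact Ideal.mul_mem_mul (Ideal.pow_mem_pow P.p_mem_J _) (Ideal.pow_mem_pow P.TJ.2 _)
  · have h1 := P.factorial_mul_γ n P.TJ
    have h2 := congrArg (algebraMap (WittVector p S) P.PDEnvelope) hu
    rw [map_natCast, map_mul, map_pow, map_natCast] at h2
    rw [h2] at h1
    rw [map_mul, map_mul, map_pow, map_pow, map_natCast]
    change _ = _ * (_ * algebraMap _ _ (P.TJ : WittVector p S) ^ n)
    rw [← h1]
    have h3 : algebraMap (WittVector p S) P.PDEnvelope ↑u⁻¹ * algebraMap _ _ (u : WittVector p S) = 1 := by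
      rw [← map_mul, Units.inv_mul, map_one]
    have h4 : (p : P.PDEnvelope) ^ k = p ^ (k - v) * p ^ v := by rw [← pow_add]; congr 1; omega
    rw [h4]
    linear_combination (-((p : P.PDEnvelope) ^ (k - v) * p ^ v * P.γ n P.TJ)) * h3

/-- Elements of `W(S)` that are divisible by `p ^ k` in the divided power envelope. -/
lemma mem_J_pow {a : WittVector p S} {k : ℕ} {x : P.PDEnvelope}
    (h : algebraMap _ _ a = (p : P.PDEnvelope) ^ k * x) : a ∈ P.J ^ k := by
  rcases eq_or_ne k 0 with rfl | hk
  · simp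
  obtain ⟨N, b, rfl⟩ := P.exists_eq_sum_γ (τ := P.TJ) P.J_eq_sup_T.le x
  rw [Finset.mul_sum] at h
  -- Each term pᵏbₙγₙ(T) either lies in Jᵏ (for n ≤ k) or becomes a multiple of Tᵏ after
  -- multiplication by N! (for n ≥ k).
  have hc : ∀ n, ∃ c ∈ P.J ^ k, ∃ y, (N.factorial : P.PDEnvelope) *
      ((if n ≤ N then (p : P.PDEnvelope) ^ k * (b n • P.γ n P.TJ) else 0) - algebraMap _ _ c) =
        algebraMap _ _ (P.T ^ k * y) := by
    intro n
    by_cases hnN : n ≤ N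
    · simp only [if_pos hnN]
      rcases le_total n k with hn | hn
      · obtain ⟨c, hc, e⟩ := P.pow_mul_γ_mem hn
        refine ⟨b n * c, Ideal.mul_mem_left _ _ hc, 0, ?_⟩
        rw [mul_smul_comm, e, Algebra.smul_def, ← map_mul, sub_self, mul_zero, mul_zero, map_zero]
      · refine ⟨0, Ideal.zero_mem _, p ^ k * (b n * (((N.factorial / n.factorial : ℕ) :
          WittVector p S) * P.T ^ (n - k))), ?_⟩
        rw [map_zero, sub_zero, Algebra.smul_def, mul_left_comm, mul_left_comm (N.factorial : P.PDEnvelope),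
          P.descFactorial_smul_γ hnN, ← map_natCast (algebraMap (WittVector p S) P.PDEnvelope) p,
          ← map_pow, ← map_mul, ← map_mul]
        congr 1
        change _ * (_ * (_ * P.T ^ n)) = _
        rw [← Nat.sub_add_cancel hn, pow_add, Nat.sub_add_cancel hn]
        ring
    · exact ⟨0, Ideal.zero_mem _, 0, by simp [if_neg hnN]⟩
  choose c hcJ y hy using hc
  have e : (N.factorial : WittVector p S) * (a - ∑ n ∈ Finset.range (N + 1), c n) =
      P.T ^ k * ∑ n ∈ Finset.range (N + 1), y n := by
    apply P.algebraMap_injective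
    rw [map_mul, map_natCast, map_sub, h, map_sum, ← Finset.sum_sub_distrib, Finset.mul_sum,
      Finset.mul_sum, map_sum]
    refine Finset.sum_congr rfl fun n hn => ?_
    rw [← hy n, if_pos (Nat.lt_succ_iff.1 (Finset.mem_range.1 hn))]
  -- N! can be cancelled against the cofactor of Tᵏ up to an element killed by T; since k ≠ 0, that
  -- element disappears after multiplication by Tᵏ.
  obtain ⟨c', b', hb, hc'⟩ := P.exists_add_of_dvd hk N.factorial_ne_zero (Dvd.intro _ e)
  have hT : c' * P.T = 0 := P.mul_T_eq_zero hc'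
  have e2 : a - ∑ n ∈ Finset.range (N + 1), c n = P.T ^ k * b' := by
    refine WittVector.natCast_mul_cancel (p := p) N.factorial_ne_zero ?_
    obtain ⟨l, rfl⟩ := Nat.exists_eq_succ_of_ne_zero hk
    rw [e, hb, mul_add, pow_succ, mul_assoc _ P.T c', mul_comm P.T c', hT]
    ring
  rw [sub_eq_iff_eq_add] at e2
  rw [e2]
  exact Ideal.add_mem _ (Ideal.mul_mem_right _ _ (Ideal.pow_mem_pow P.TJ.2 _))
    (Ideal.sum_mem _ fun n _ => hcJ n)

end PerfectoidPresentation

/-! ### p-adic completions -/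

section PadicCompletion

variable (p : ℕ) (D : Type*) [CommRing D]

lemma AdicCompletion.isAdicComplete_natCast :
    IsAdicComplete (Ideal.span {(p : AdicCompletion (Ideal.span {(p : D)}) D)})
      (AdicCompletion (Ideal.span {(p : D)}) D) := by
  have h1 : IsAdicComplete (Ideal.span {(p : D)}) (AdicCompletion (Ideal.span {(p : D)}) D) :=
    AdicCompletion.isAdicComplete ⟨{(p : D)}, by simp⟩
  have h2 := (IsAdicComplete.map_algebraMap_iff (S := AdicCompletion (Ideal.span {(p : D)}) D)
    (Ideal.span {(p : D)}) (AdicCompletion (Ideal.span {(p : D)}) D)).2 h1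
  rwa [Ideal.map_span, Set.image_singleton, map_natCast] at h2

variable {D}

lemma AdicCompletion.exists_eq_add_pow_mul (x : AdicCompletion (Ideal.span {(p : D)}) D) (k : ℕ) :
    ∃ d y, x = algebraMap D _ d + p ^ k * y := by
  obtain ⟨d, hd⟩ := Ideal.Quotient.mk_surjective (AdicCompletion.eval (Ideal.span {(p : D)}) D k x)
  have h1 : x - algebraMap D _ d ∈
      (AdicCompletion.eval (Ideal.span {(p : D)}) D k).ker := by
    rw [LinearMap.mem_ker, map_sub, sub_eq_zero]
    exact hd.symm
  rw [← AdicCompletion.pow_smul_top_eq_ker_eval ⟨{(p : D)}, by simp⟩, Ideal.span_singleton_pow,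
    Submodule.ideal_span_singleton_smul] at h1
  obtain ⟨y, -, hy⟩ := h1
  refine ⟨d, y, ?_⟩
  rw [← sub_eq_iff_eq_add', ← hy]
  change ((p : D) ^ k) • y = _
  rw [Algebra.smul_def, map_pow, map_natCast]

lemma AdicCompletion.exists_eq_pow_mul {d : D} {k : ℕ}
    {y : AdicCompletion (Ideal.span {(p : D)}) D} (h : algebraMap D _ d = p ^ k * y) :
    ∃ d', d = p ^ k * d' := by
  have h1 := congrArg (AdicCompletion.evalₐ (Ideal.span {(p : D)}) k) h
  rw [map_mul, map_pow, map_natCast] at h1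
  have h2 : ((p : D ⧸ Ideal.span {(p : D)} ^ k)) ^ k = 0 := by
    rw [← map_natCast (Ideal.Quotient.mk _), ← map_pow, Ideal.Quotient.eq_zero_iff_mem]
    exact Ideal.pow_mem_pow (Ideal.mem_span_singleton_self _) _
  rw [h2, zero_mul] at h1
  have h3 : Ideal.Quotient.mk (Ideal.span {(p : D)} ^ k) d = 0 := by
    rw [← h1]; exact (AdicCompletion.evalₐ_of (Ideal.span {(p : D)}) k d).symm
  rwa [Ideal.Quotient.eq_zero_iff_mem, Ideal.span_singleton_pow, Ideal.mem_span_singleton] at h3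

/-- If px = 0 and d ∈ D approximates x modulo pᵏ⁺¹, then pd is divisible by pᵏ⁺² already in D, so d
is divisible by pᵏ⁺¹, and x by pᵏ for every k. -/
lemma AdicCompletion.eq_zero_of_natCast_mul (hp : ∀ d : D, (p : D) * d = 0 → d = 0)
    {x : AdicCompletion (Ideal.span {(p : D)}) D} (h : p * x = 0) : x = 0 := by
  have := AdicCompletion.isAdicComplete_natCast p D
  refine (PadicComplete.of_isAdicComplete (p := p)
    (A := AdicCompletion (Ideal.span {(p : D)}) D)).haus x fun k => ?_
  obtain ⟨d, y, rfl⟩ := AdicCompletion.exists_eq_add_pow_mul p x (k + 1)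
  have h1 : algebraMap D (AdicCompletion (Ideal.span {(p : D)}) D) (p * d) = p ^ (k + 2) * (-y) := by
    rw [map_mul, map_natCast]
    linear_combination h
  obtain ⟨d', hd'⟩ := AdicCompletion.exists_eq_pow_mul p h1
  have h2 : d = p ^ (k + 1) * d' := by
    rw [← sub_eq_zero]
    refine hp _ ?_
    rw [mul_sub, hd']; ring
  refine ⟨p * (algebraMap D _ d' + y), ?_⟩
  rw [h2, map_mul, map_pow, map_natCast, nsmul_eq_mul]
  push_cast
  ring

end PadicCompletion

/-! ### A_cris and the topology it induces on W(S) -/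

namespace PerfectoidPresentation

variable {p : ℕ} [Fact p.Prime] {S : Type u} {R : Type v} [CommRing S] [Algebra (ZMod p) S]
  [PerfectRing S p] [CommRing R] (P : PerfectoidPresentation p S R)

/-- The map from the divided power envelope to its `p`-adic completion. -/
noncomputable def ofEnv : P.PDEnvelope →+* P.Acris :=
  algebraMap P.PDEnvelope (AdicCompletion (Ideal.span {(p : P.PDEnvelope)}) P.PDEnvelope)

lemma ofEnv_algebraMap (a : WittVector p S) : P.ofEnv (algebraMap _ _ a) = algebraMap _ _ a := rfl

lemma acrisFrob_ofEnv (x : P.PDEnvelope) : P.acrisFrob (P.ofEnv x) = P.ofEnv (P.envFrob x) :=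
  padicCompletionMap_of p P.envFrob x

lemma acrisToR_ofEnv (x : P.PDEnvelope) : P.acrisToR (P.ofEnv x) = P.envToR x := by
  have := P.isAdicComplete
  change (AdicCompletion.ofAlgEquiv (Ideal.span {(p : R)})).symm
    (padicCompletionMap p P.envToR (algebraMap P.PDEnvelope _ x)) = _
  rw [padicCompletionMap_of, AlgEquiv.symm_apply_eq]; rfl

lemma isAdicComplete_acris : IsAdicComplete (Ideal.span {(p : P.Acris)}) P.Acris :=
  AdicCompletion.isAdicComplete_natCast p P.PDEnvelope

lemma padicComplete_acris : PadicComplete p P.Acris :=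
  haveI := P.isAdicComplete_acris
  PadicComplete.of_isAdicComplete

lemma p_mem_jacobson_acris : (p : P.Acris) ∈ Ideal.jacobson (⊥ : Ideal P.Acris) := by
  have := P.isAdicComplete_acris
  exact IsAdicComplete.le_jacobson_bot _ (Ideal.mem_span_singleton_self _)

lemma exists_eq_ofEnv_add (x : P.Acris) (k : ℕ) : ∃ d y, x = P.ofEnv d + p ^ k * y :=
  AdicCompletion.exists_eq_add_pow_mul p x k

lemma exists_eq_of_ofEnv_eq {d : P.PDEnvelope} {k : ℕ} {y : P.Acris} (h : P.ofEnv d = p ^ k * y) :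
    ∃ d', d = p ^ k * d' :=
  AdicCompletion.exists_eq_pow_mul p h

lemma acris_torsionFree (x : P.Acris) (h : (p : P.Acris) * x = 0) : x = 0 :=
  AdicCompletion.eq_zero_of_natCast_mul p
    (fun _ => P.natCast_mul_eq_zero (Fact.out : p.Prime).ne_zero) h

lemma mem_J_pow_of_acris {a : WittVector p S} {k : ℕ} {y : P.Acris}
    (h : algebraMap _ _ a = (p : P.Acris) ^ k * y) : a ∈ P.J ^ k := by
  obtain ⟨d, hd⟩ := P.exists_eq_of_ofEnv_eq h
  exact P.mem_J_pow hd

lemma eq_zero_of_mem_J_pow {a : WittVector p S} (h : ∀ k, a ∈ P.J ^ k) : a = 0 := by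
  refine P.isAdicComplete_J.haus _ fun n => ?_
  rw [SModEq.sub_mem, sub_zero, smul_eq_mul, Ideal.mul_top]
  exact h n

lemma algebraMap_acris_injective : Function.Injective (algebraMap (WittVector p S) P.Acris) := by
  refine (injective_iff_map_eq_zero _).2 fun a ha => P.eq_zero_of_mem_J_pow fun k => ?_
  exact P.mem_J_pow_of_acris (y := 0) (by rw [ha, mul_zero])

/-- Large powers of `J` become divisible by powers of `p` in `A_cris`. -/
lemma exists_eq_pow_mul_of_mem_J_pow {a : WittVector p S} {r : ℕ} (h : a ∈ P.J ^ (r + p * r)) :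
    ∃ y : P.Acris, algebraMap _ _ a = p ^ r * y := by
  have h1 : P.J ^ (r + p * r) ≤ (Ideal.span {(p : P.Acris) ^ r}).comap (algebraMap _ _) := by
    rw [J_eq_sup_T]
    -- The power of (p, T) lies in (pʳ) + (T^(pr)), and Tᵖ = p!·γₚ(T) is divisible by p.
    refine Ideal.sup_pow_add_le_pow_sup_pow.trans (sup_le ?_ ?_)
    · rw [Ideal.span_singleton_pow, Ideal.span_singleton_le_iff_mem, Ideal.mem_comap, map_pow,
        map_natCast]
      exact Ideal.mem_span_singleton_self _
    · rw [Ideal.span_singleton_pow, Ideal.span_singleton_le_iff_mem, Ideal.mem_comap, map_pow,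
        pow_mul, Ideal.mem_span_singleton]
      refine pow_dvd_pow_of_dvd ?_ r
      have h2 := congrArg P.ofEnv (P.factorial_mul_γ p P.TJ)
      rw [map_mul, map_natCast, map_pow, ofEnv_algebraMap] at h2
      change _ ∣ algebraMap (WittVector p S) P.Acris (P.TJ : WittVector p S) ^ p
      rw [← h2, ← Nat.mul_factorial_pred (Fact.out : p.Prime).ne_zero, Nat.cast_mul, mul_assoc]
      exact dvd_mul_right _ _
  exact Ideal.mem_span_singleton.1 (h1 h)

/-- Approximations of x from W(S) form a J-adic Cauchy sequence, as W(S) ∩ pᵏA_cris ⊆ Jᵏ. Their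
J-adic limit is also their p-adic limit, because J^(r+pr) maps into pʳA_cris. -/
lemma exists_algebraMap_eq_of_forall (x : P.Acris)
    (h : ∀ k : ℕ, ∃ a y, x = algebraMap (WittVector p S) P.Acris a + p ^ k • y) :
    ∃ a, algebraMap (WittVector p S) P.Acris a = x := by
  choose a y h using h
  have hc : ∀ {m n}, m ≤ n → a m - a n ∈ P.J ^ m := by
    intro m n hmn
    refine P.mem_J_pow_of_acris (y := p ^ (n - m) * y n - y m) ?_
    have h1 := (h m).symm.trans (h n)
    have h2 : (p : P.Acris) ^ n = p ^ m * p ^ (n - m) := by rw [← pow_add]; congr 1; omega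
    simp only [nsmul_eq_mul, Nat.cast_pow] at h1
    rw [map_sub]
    linear_combination h1 + y n * h2
  obtain ⟨L, hL⟩ := P.isAdicComplete_J.prec (f := a) (by
    intro m n hmn
    rw [SModEq.sub_mem, smul_eq_mul, Ideal.mul_top]
    exact hc hmn)
  refine ⟨L, (sub_eq_zero.1 (P.padicComplete_acris.haus _ fun r => ?_)).symm⟩
  have h1 := hL (r + p * r)
  rw [SModEq.sub_mem, smul_eq_mul, Ideal.mul_top] at h1
  obtain ⟨z, hz⟩ := P.exists_eq_pow_mul_of_mem_J_pow h1
  rw [map_sub] at hz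
  refine ⟨z + p ^ (p * r) * y (r + p * r), ?_⟩
  have h2 := h (r + p * r)
  rw [nsmul_eq_mul] at h2 ⊢
  push_cast at h2 ⊢
  rw [pow_add] at h2
  linear_combination h2 + hz

end PerfectoidPresentation

/-! ### Divisibility of pⁿ/n! by p² -/

namespace PadicInt

/-- By Legendre's formula (p − 1)v(n!) ≤ n − 1, hence 2v(n!) ≤ n − 1 and v(n!) ≤ n − 2. The bound on
p is essential: for p = n = 2 the quotient is 2. -/
lemma p_sq_dvd_dpowP {p : ℕ} [Fact p.Prime] (hp : 3 ≤ p) {n : ℕ} (hn : 2 ≤ n) :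
    (p : ℤ_[p]) ^ 2 ∣ dpowP p n := by
  have h1 := factorial_mul_dpowP p n
  set v := padicValNat p n.factorial with hv
  have h2 := sub_one_mul_padicValNat_factorial (p := p) n
  have h3 : 0 < (p.digits n).sum := by
    refine Nat.pos_of_ne_zero fun h0 => ?_
    have hn0 : n ≠ 0 := by omega
    exact Nat.getLast_digit_ne_zero p hn0 (List.sum_eq_zero_iff.1 h0 _ (List.getLast_mem _))
  have h4 : v + 2 ≤ n := by
    rw [← hv] at h2
    have h5 : 2 * v ≤ n - 1 := by
      refine (Nat.mul_le_mul_right v (by omega : 2 ≤ p - 1)).trans ?_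
      omega
    omega
  obtain ⟨m, hm⟩ := pow_padicValNat_dvd (p := p) (n := n.factorial)
  rw [← hv] at hm
  have h6 : ¬ p ∣ m := by
    rintro ⟨k, rfl⟩
    refine pow_succ_padicValNat_not_dvd (p := p) n.factorial_ne_zero ⟨k, ?_⟩
    rw [pow_succ, mul_assoc]; exact hm
  have h7 : IsCoprime ((p ^ 2 : ℕ) : ℤ_[p]) (m : ℤ_[p]) :=
    (Nat.Coprime.pow_left 2 (((Fact.out : p.Prime).coprime_iff_not_dvd).2 h6)).cast
  rw [Nat.cast_pow] at h7
  refine h7.dvd_of_dvd_mul_left ⟨p ^ (n - v - 2), ?_⟩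
  have h8 : (p : ℤ_[p]) ^ v ≠ 0 := pow_ne_zero _ (Nat.cast_ne_zero.2 (Fact.out : p.Prime).ne_zero)
  refine mul_left_cancel₀ h8 ?_
  rw [← pow_add, ← pow_add, ← mul_assoc]
  have h9 : v + (2 + (n - v - 2)) = n := by omega
  rw [h9, ← h1, hm]
  push_cast
  rfl

end PadicInt

/-! ### Frobenius on A_cris and the contracting ideal -/

namespace PerfectoidPresentation

variable {p : ℕ} [Fact p.Prime] {S : Type u} {R : Type v} [CommRing S] [Algebra (ZMod p) S]
  [PerfectRing S p] [CommRing R] (P : PerfectoidPresentation p S R)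

lemma π_xi : P.π P.ξ = 0 := by
  rw [← RingHom.mem_ker, P.ker_eq]; exact Ideal.mem_span_singleton_self _

/-- The p-th power is divisible by p, which lies in the Jacobson radical. -/
lemma ofEnv_γ_mem_jacobson {n : ℕ} (hn : n ≠ 0) (a : P.J) :
    P.ofEnv (P.γ n a) ∈ Ideal.jacobson (⊥ : Ideal P.Acris) := by
  obtain ⟨y, hy⟩ := P.exists_γ_pow_eq hn a
  refine Ideal.isRadical_jacobson _ ⟨p, ?_⟩
  rw [← map_pow, hy, map_mul, map_natCast]
  exact Ideal.mul_mem_right _ _ P.p_mem_jacobson_acris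

/-- The element `σ ξ / p` of the divided power envelope. -/
lemma exists_frobenius_xi_eq : ∃ u : P.PDEnvelope,
    algebraMap _ _ (WittVector.frobenius P.ξ) = p * u ∧ IsUnit (P.ofEnv u) := by
  obtain ⟨w, hw, e⟩ := P.exists_xi_eq
  -- From ξ = T + pw one gets σ(ξ) = Tᵖ + pσ(w), and Tᵖ = p·(p − 1)!·γₚ(T). The quotient by p is a
  -- unit in A_cris since σ(w) is one and γₚ(T) lies in the radical.
  refine ⟨algebraMap _ _ (WittVector.frobenius w) + ((p - 1).factorial : P.PDEnvelope) * P.γ p P.TJ,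
    ?_, ?_⟩
  · have h1 := P.factorial_mul_γ p P.TJ
    rw [← Nat.mul_factorial_pred (Fact.out : p.Prime).ne_zero, Nat.cast_mul, mul_assoc] at h1
    have h2 : WittVector.frobenius P.T = P.T ^ p := by
      rcases WittVector.subsingleton_or_charP p S with h | h
      · have := WittVector.subsingleton_of (p := p) (S := S)
        exact Subsingleton.elim _ _
      · rw [T, WittVector.frobenius_eq_map_frobenius, WittVector.map_teichmuller, frobenius_def,
          map_pow]
    rw [mul_add, h1, e, map_add, map_mul, map_natCast, h2, map_add, map_mul, map_natCast, map_pow]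
    exact add_comm _ _
  · rw [map_add, map_mul]
    obtain ⟨v, hv⟩ := (hw.map (WittVector.frobenius)).map (algebraMap (WittVector p S) P.Acris)
    have h3 : P.ofEnv ((p - 1).factorial : P.PDEnvelope) * P.ofEnv (P.γ p P.TJ) ∈
        Ideal.jacobson (⊥ : Ideal P.Acris) :=
      Ideal.mul_mem_left _ _ (P.ofEnv_γ_mem_jacobson (Fact.out : p.Prime).ne_zero _)
    have h4 := Ideal.mem_jacobson_bot.1 h3 ↑v⁻¹
    rw [ofEnv_algebraMap, ← hv]
    have h5 := v.isUnit.mul h4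
    rwa [mul_add, mul_one, mul_comm (_ * _) (↑v⁻¹ : P.Acris), v.mul_inv_cancel_left, add_comm] at h5

/-- After multiplication by n! both sides are σ(ξ)ⁿ = pⁿuⁿ, and the envelope is torsion free. -/
lemma envFrob_γ_xi {u : P.PDEnvelope} (hu : algebraMap _ _ (WittVector.frobenius P.ξ) = p * u)
    (n : ℕ) : P.envFrob (P.γ n P.ξJ) =
      algebraMap _ _ (WittVector.ofPadicInt p S (PadicInt.dpowP p n)) * u ^ n := by
  refine P.natCast_mul_cancel n.factorial_ne_zero ?_
  rw [envFrob_γ, factorial_mul_γ]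
  change algebraMap _ _ (WittVector.frobenius P.ξ) ^ n = _
  have h := congrArg (fun x => algebraMap (WittVector p S) P.PDEnvelope (WittVector.ofPadicInt p S x))
    (PadicInt.factorial_mul_dpowP p n)
  simp only [map_mul, map_natCast, map_pow] at h
  rw [hu, ← mul_assoc, h, mul_pow]

lemma p_dvd_envFrob_γ_xi {n : ℕ} (hn : n ≠ 0) : (p : P.PDEnvelope) ∣ P.envFrob (P.γ n P.ξJ) := by
  obtain ⟨u, hu, -⟩ := P.exists_frobenius_xi_eq
  rw [P.envFrob_γ_xi hu]
  refine Dvd.dvd.mul_right ?_ _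
  obtain ⟨c, hc⟩ := PadicInt.p_dvd_dpowP p hn
  exact ⟨_, by rw [hc, map_mul, map_mul, map_natCast, map_natCast]⟩

lemma p_sq_dvd_envFrob_γ_xi (hp : 3 ≤ p) {n : ℕ} (hn : 2 ≤ n) :
    (p : P.PDEnvelope) ^ 2 ∣ P.envFrob (P.γ n P.ξJ) := by
  obtain ⟨u, hu, -⟩ := P.exists_frobenius_xi_eq
  rw [P.envFrob_γ_xi hu]
  refine Dvd.dvd.mul_right ?_ _
  obtain ⟨c, hc⟩ := PadicInt.p_sq_dvd_dpowP hp hn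
  exact ⟨_, by rw [hc, map_mul, map_mul, map_pow, map_pow, map_natCast, map_natCast]⟩

lemma envToR_γ_xi {n : ℕ} (hn : n ≠ 0) : P.envToR (P.γ n P.ξJ) = 0 := by
  rw [P.envToR_γ n P.ξJ 0 (by rw [mul_zero]; exact P.π_xi), zero_pow hn, mul_zero]

lemma J_le_sup_xi : P.J ≤ Ideal.span {(p : WittVector p S)} ⊔ Ideal.span {(P.ξJ : WittVector p S)} :=
  P.J_eq.le

/-- The decomposition A' = A + N before completion: among the generators, γ₀(ξ) and γ₁(ξ) come from
W(S), and the γₙ(ξ) with n ≥ 2 satisfy both conditions with a = 0. -/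
lemma exists_envToR_sub_eq_zero (hp : 3 ≤ p) (d : P.PDEnvelope) : ∃ a : WittVector p S,
    P.envToR (d - algebraMap _ _ a) = 0 ∧
      (p : P.PDEnvelope) ^ 2 ∣ P.envFrob (d - algebraMap _ _ a) := by
  induction P.mem_span_γ P.J_le_sup_xi d using Submodule.span_induction with
  | zero => exact ⟨0, by simp, by simp⟩
  | add x y _ _ hx hy =>
    obtain ⟨a, h1, h2⟩ := hx
    obtain ⟨b, h3, h4⟩ := hy
    refine ⟨a + b, ?_, ?_⟩
    · rw [map_add, add_sub_add_comm, map_add, h1, h3, add_zero]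
    · rw [map_add, add_sub_add_comm, map_add]; exact dvd_add h2 h4
  | smul r x _ hx =>
    obtain ⟨a, h1, h2⟩ := hx
    have e : r • x - algebraMap _ _ (r * a) = algebraMap _ _ r * (x - algebraMap _ _ a) := by
      rw [Algebra.smul_def, map_mul, mul_sub]
    refine ⟨r * a, ?_, ?_⟩
    · rw [e, map_mul, h1, mul_zero]
    · rw [e, map_mul]; exact h2.mul_left _
  | mem x hx =>
    obtain ⟨n, rfl⟩ := hx
    match n with
    | 0 => exact ⟨1, by simp [γ_zero], by simp [γ_zero]⟩
    | 1 =>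
      have e : P.γ 1 P.ξJ - algebraMap _ _ P.ξ = 0 := by rw [γ_one]; exact sub_self _
      exact ⟨P.ξ, by rw [e, map_zero], by rw [e, map_zero]; exact dvd_zero _⟩
    | n + 2 =>
      refine ⟨0, ?_, ?_⟩
      · rw [map_zero, sub_zero, P.envToR_γ_xi (by omega)]
      · rw [map_zero, sub_zero]; exact P.p_sq_dvd_envFrob_γ_xi hp (by omega)

/-- The elements of the kernel of `A_cris → R` whose Frobenius image is divisible by `p ^ 2`. -/
noncomputable def contractingIdeal : Ideal P.Acris :=
  RingHom.ker P.acrisToR ⊓ (Ideal.span {(p : P.Acris) ^ 2}).comap P.acrisFrob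

lemma mem_contractingIdeal {x : P.Acris} :
    x ∈ P.contractingIdeal ↔ P.acrisToR x = 0 ∧ (p : P.Acris) ^ 2 ∣ P.acrisFrob x := by
  rw [contractingIdeal, Ideal.mem_inf, RingHom.mem_ker, Ideal.mem_comap, Ideal.mem_span_singleton]

/-- Approximate x modulo p² by the envelope. The remainder p²y is corrected by p²b, where b ∈ W(S)
has the same image in R as y; its Frobenius is divisible by p² automatically. -/
lemma exists_sub_mem_contractingIdeal (hp : 3 ≤ p) (x : P.Acris) :
    ∃ a : WittVector p S, x - algebraMap _ _ a ∈ P.contractingIdeal := by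
  obtain ⟨d, y, rfl⟩ := P.exists_eq_ofEnv_add x 2
  obtain ⟨a, h1, z, h2⟩ := P.exists_envToR_sub_eq_zero hp d
  obtain ⟨b, hb⟩ := P.surjective (P.acrisToR y)
  have e : P.ofEnv d + p ^ 2 * y - algebraMap _ _ (a + p ^ 2 * b) =
      P.ofEnv (d - algebraMap _ _ a) + p ^ 2 * (y - algebraMap _ _ b) := by
    rw [map_add, map_mul, map_pow, map_natCast, map_sub, ofEnv_algebraMap]; ring
  refine ⟨a + p ^ 2 * b, P.mem_contractingIdeal.2 ⟨?_, ?_⟩⟩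
  · rw [e, map_add, acrisToR_ofEnv, h1, map_mul, map_sub, acrisToR_algebraMap, hb, sub_self,
      mul_zero, add_zero]
  · rw [e, map_add, map_mul, map_pow, map_natCast, acrisFrob_ofEnv, h2, map_mul, map_pow, map_natCast,
      ← mul_add]
    exact dvd_mul_right _ _

/-- Modulo the contracting ideal, x comes from Ker(W(S) → R) = (ξ), and p divides σ(ξ). -/
lemma p_dvd_acrisFrob (hp : 3 ≤ p) {x : P.Acris} (hx : P.acrisToR x = 0) :
    (p : P.Acris) ∣ P.acrisFrob x := by
  obtain ⟨a, ha⟩ := P.exists_sub_mem_contractingIdeal hp x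
  obtain ⟨h1, h2⟩ := P.mem_contractingIdeal.1 ha
  rw [map_sub, hx, zero_sub, neg_eq_zero, acrisToR_algebraMap, ← RingHom.mem_ker, P.ker_eq,
    Ideal.mem_span_singleton] at h1
  obtain ⟨b, rfl⟩ := h1
  obtain ⟨u, hu, -⟩ := P.exists_frobenius_xi_eq
  have h3 : (p : P.Acris) ∣ P.acrisFrob (algebraMap _ _ (P.ξ * b)) := by
    rw [acrisFrob_algebraMap, map_mul, map_mul, ← ofEnv_algebraMap, hu, map_mul, map_natCast, mul_assoc]
    exact dvd_mul_right _ _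
  have h4 := dvd_add ((dvd_pow_self _ two_ne_zero).trans h2) h3
  rwa [← map_add, sub_add_cancel] at h4

/-- The property passes to sums and W(S)-multiples, and for γₙ(ξ) with n > 0 both terms are
divisible by p. -/
lemma p_dvd_envFrob_sub_pow (d : P.PDEnvelope) : (p : P.PDEnvelope) ∣ P.envFrob d - d ^ p := by
  induction P.mem_span_γ P.J_le_sup_xi d using Submodule.span_induction with
  | zero => rw [map_zero, zero_pow (Fact.out : p.Prime).ne_zero, sub_zero]; exact dvd_zero _
  | add x y _ _ hx hy =>
    obtain ⟨r, hr⟩ := exists_add_pow_prime_eq (Fact.out : p.Prime) x y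
    obtain ⟨a, ha⟩ := hx
    obtain ⟨b, hb⟩ := hy
    exact ⟨a + b - x * y * r, by rw [map_add, hr]; linear_combination ha + hb⟩
  | smul r x _ hx =>
    obtain ⟨a, ha⟩ := hx
    obtain ⟨b, hb⟩ := Ideal.mem_span_singleton.1 (WittVector.frobenius_sub_pow_mem r)
    have hb' := congrArg (algebraMap (WittVector p S) P.PDEnvelope) hb
    rw [map_sub, map_pow, map_mul, map_natCast] at hb'
    refine ⟨algebraMap _ _ (WittVector.frobenius r) * a + algebraMap _ _ b * x ^ p, ?_⟩
    rw [Algebra.smul_def, map_mul, envFrob_algebraMap, mul_pow]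
    linear_combination algebraMap _ _ (WittVector.frobenius r) * ha + x ^ p * hb'
  | mem x hx =>
    obtain ⟨n, rfl⟩ := hx
    rcases eq_or_ne n 0 with rfl | hn
    · simp [γ_zero]
    · obtain ⟨y, hy⟩ := P.exists_γ_pow_eq hn P.ξJ
      exact dvd_sub (P.p_dvd_envFrob_γ_xi hn) (Dvd.intro _ hy.symm)

lemma acrisFrob_sub_pow_mem (x : P.Acris) :
    P.acrisFrob x - x ^ p ∈ Ideal.span {(p : P.Acris)} := by
  rw [Ideal.mem_span_singleton]
  obtain ⟨d, y, rfl⟩ := P.exists_eq_ofEnv_add x 1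
  obtain ⟨a, ha⟩ := P.p_dvd_envFrob_sub_pow d
  obtain ⟨r, hr⟩ := exists_add_pow_prime_eq (Fact.out : p.Prime) (P.ofEnv d) (p ^ 1 * y)
  have ha' := congrArg P.ofEnv ha
  rw [map_sub, map_pow, map_mul, map_natCast] at ha'
  have h2 : (p : P.Acris) ∣ ((p : P.Acris) ^ 1 * y) ^ p :=
    dvd_pow (by rw [pow_one]; exact dvd_mul_right _ _) (Fact.out : p.Prime).ne_zero
  obtain ⟨b, hb⟩ := h2
  rw [hr, map_add, map_mul, map_pow, map_natCast, acrisFrob_ofEnv, hb]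
  exact ⟨P.ofEnv a + P.acrisFrob y - b - P.ofEnv d * (p ^ 1 * y) * r, by linear_combination ha'⟩

/-- For x in the kernel, p divides σ(x), and σ(x) ≡ xᵖ modulo p; so xᵖ lies in the radical. -/
lemma ker_acrisToR_le_jacobson (hp : 3 ≤ p) :
    RingHom.ker P.acrisToR ≤ Ideal.jacobson (⊥ : Ideal P.Acris) := by
  intro x hx
  refine Ideal.isRadical_jacobson _ ⟨p, ?_⟩
  have h1 : Ideal.span {(p : P.Acris)} ≤ Ideal.jacobson (⊥ : Ideal P.Acris) :=
    (Ideal.span_singleton_le_iff_mem _).2 P.p_mem_jacobson_acris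
  have h2 := Ideal.sub_mem _ (Ideal.mem_span_singleton.2 (P.p_dvd_acrisFrob hp hx))
    (P.acrisFrob_sub_pow_mem x)
  rw [sub_sub_cancel] at h2
  exact h1 h2

end PerfectoidPresentation

/-- Closed submodules of a `p`-adically complete module are `p`-adically complete. -/
lemma PadicComplete.submodule {p : ℕ} {A V : Type*} [Ring A] [AddCommGroup V] [Module A V]
    {N : Submodule A V} (h : PadicComplete p V)
    (hN : ∀ (b : ℕ → N) (s : V),
      (∀ k, ∃ z, s = ∑ i ∈ Finset.range k, p ^ i • (b i : V) + p ^ k • z) → s ∈ N) :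
    PadicComplete p N := by
  constructor
  · intro x hx
    refine Subtype.ext (h.haus _ fun k => ?_)
    obtain ⟨y, hy⟩ := hx k
    exact ⟨y, congrArg Subtype.val hy⟩
  · intro a
    obtain ⟨s, hs⟩ := h.sum fun i => (a i : V)
    refine ⟨⟨s, hN a s hs⟩, fun k => ?_⟩
    -- The remainder provided by `hs` need not lie in N; the shifted series gives one that does.
    obtain ⟨t, ht⟩ := h.sum fun i => (a (k + i) : V)
    refine ⟨⟨t, hN _ t ht⟩, Subtype.ext ?_⟩
    have e : ((∑ i ∈ Finset.range k, p ^ i • a i + p ^ k • ⟨t, hN _ t ht⟩ : N) : V) =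
        ∑ i ∈ Finset.range k, p ^ i • (a i : V) + p ^ k • t := by simp
    rw [e, ← sub_eq_zero]
    refine h.haus _ fun n => ?_
    obtain ⟨z, hz⟩ := hs (k + n)
    obtain ⟨w, hw⟩ := ht n
    refine ⟨p ^ k • (z - w), ?_⟩
    have e2 : ∑ i ∈ Finset.range n, p ^ (k + i) • (a (k + i) : V) =
        p ^ k • ∑ i ∈ Finset.range n, p ^ i • (a (k + i) : V) := by
      rw [Finset.smul_sum]
      exact Finset.sum_congr rfl fun i _ => by rw [pow_add, mul_smul]
    change s - _ = _
    rw [hz, hw, Finset.sum_range_add, e2, pow_add, mul_smul, smul_add, smul_comm (p ^ n) (p ^ k),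
      smul_sub, smul_sub]
    abel

/-! ### The frame of A_cris and the equivalence -/

namespace PerfectoidPresentation

variable {p : ℕ} [Fact p.Prime] {S : Type u} {R : Type v} [CommRing S] [Algebra (ZMod p) S]
  [PerfectRing S p] [CommRing R] (P : PerfectoidPresentation p S R)

lemma acris_mul_cancel {x y : P.Acris} (h : (p : P.Acris) * x = p * y) : x = y := by
  rw [← sub_eq_zero] at h ⊢
  exact P.acris_torsionFree _ (by rw [mul_sub, h])

/-- The Frobenius-linear map `p⁻¹ σ` on the kernel of `A_cris → R`. -/
noncomputable def acrisσ₁ (hp : 3 ≤ p) : RingHom.ker P.acrisToR →ₛₗ[P.acrisFrob] P.Acris where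
  toFun x := (P.p_dvd_acrisFrob hp x.2).choose
  map_add' x y := P.acris_mul_cancel (by
    rw [mul_add, ← (P.p_dvd_acrisFrob hp x.2).choose_spec, ← (P.p_dvd_acrisFrob hp y.2).choose_spec,
      ← (P.p_dvd_acrisFrob hp (x + y).2).choose_spec, ← map_add]; rfl)
  map_smul' a x := P.acris_mul_cancel (by
    rw [smul_eq_mul, mul_left_comm, ← (P.p_dvd_acrisFrob hp x.2).choose_spec,
      ← (P.p_dvd_acrisFrob hp (a • x).2).choose_spec, ← map_mul]; rfl)

lemma p_mul_acrisσ₁ (hp : 3 ≤ p) (x : RingHom.ker P.acrisToR) :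
    (p : P.Acris) * P.acrisσ₁ hp x = P.acrisFrob x :=
  (P.p_dvd_acrisFrob hp x.2).choose_spec.symm

lemma algebraMap_mem_ker_iff (a : WittVector p S) :
    algebraMap _ P.Acris a ∈ RingHom.ker P.acrisToR ↔ a ∈ RingHom.ker P.π := by
  rw [RingHom.mem_ker, RingHom.mem_ker, acrisToR_algebraMap]

/-- The unit is σ(ξ)/p: dividing σ(ξb) by p gives (σ(ξ)/p)·σ(b). -/
lemma exists_acrisσ₁_eq (hp : 3 ≤ p) : ∃ u : P.Acrisˣ, ∀ a : RingHom.ker P.π,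
    P.acrisσ₁ hp ⟨algebraMap _ _ (a : WittVector p S), (P.algebraMap_mem_ker_iff _).2 a.2⟩ =
      u * algebraMap _ _ (P.ainfσ₁ a) := by
  obtain ⟨u, hu, u', hu'⟩ := P.exists_frobenius_xi_eq
  refine ⟨u', fun a => P.acris_mul_cancel ?_⟩
  have e : P.ainfσ₁ a = WittVector.frobenius (P.divXi a) := rfl
  rw [p_mul_acrisσ₁, hu', e]
  change P.acrisFrob (algebraMap _ _ (a : WittVector p S)) = _
  conv_lhs => rw [← P.mul_divXi a]
  rw [acrisFrob_algebraMap, map_mul, map_mul, ← P.ofEnv_algebraMap (WittVector.frobenius P.ξ), hu, map_mul,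
    map_natCast, mul_assoc]

lemma xi_mem_ker : P.ξ ∈ RingHom.ker P.π := P.π_xi

lemma ainfσ₁_xi : P.ainfσ₁ ⟨P.ξ, P.xi_mem_ker⟩ = 1 := by
  have h : P.divXi ⟨P.ξ, P.xi_mem_ker⟩ = 1 := P.divXi_eq _ 1 (mul_one _).symm
  change WittVector.frobenius _ = 1
  rw [h, map_one]

/-- The frame `(A_cris, ker (A_cris → R), R, σ, p⁻¹ σ)`. -/
noncomputable def acrisFrame (hp : 3 ≤ p) : WindowFrame p P.Acris (RingHom.ker P.acrisToR) where
  σ := P.acrisFrob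
  σ₁ := P.acrisσ₁ hp
  le_rad := P.ker_acrisToR_le_jacobson hp
  p_mem_rad := P.p_mem_jacobson_acris
  frobenius_lift := P.acrisFrob_sub_pow_mem
  span_range := by
    obtain ⟨u, hu⟩ := P.exists_acrisσ₁_eq hp
    have h := hu ⟨P.ξ, P.xi_mem_ker⟩
    rw [ainfσ₁_xi, map_one, mul_one] at h
    exact Ideal.eq_top_of_isUnit_mem _ (Ideal.subset_span ⟨_, h⟩) u.isUnit

/-- The frame homomorphism from `A_inf` to `A_cris`. -/
noncomputable def frameHom (hp : 3 ≤ p) : WindowFrame.Hom P.ainfFrame (P.acrisFrame hp) where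
  u := (P.exists_acrisσ₁_eq hp).choose
  map_mem a ha := (P.algebraMap_mem_ker_iff a).2 ha
  comm_σ := P.acrisFrob_algebraMap
  comm_σ₁ := (P.exists_acrisσ₁_eq hp).choose_spec

/-- The ideal is p-adically closed: R is p-adically separated, and the divisibility of σ(x) by p²
depends only on x modulo p². -/
lemma padicComplete_contractingIdeal : PadicComplete p P.contractingIdeal := by
  refine P.padicComplete_acris.submodule fun b s h => ?_
  have hb : ∀ k, ∑ i ∈ Finset.range k, p ^ i • (b i : P.Acris) ∈ P.contractingIdeal := fun k =>
    Ideal.sum_mem _ fun i _ => nsmul_mem (b i).2 _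
  refine P.mem_contractingIdeal.2 ⟨?_, ?_⟩
  · have := P.isAdicComplete
    refine (PadicComplete.of_isAdicComplete (p := p) (A := R)).haus _ fun k => ?_
    obtain ⟨z, rfl⟩ := h k
    exact ⟨P.acrisToR z, by
      rw [map_add, (P.mem_contractingIdeal.1 (hb k)).1, zero_add, map_nsmul]⟩
  · obtain ⟨z, rfl⟩ := h 2
    rw [map_add, map_nsmul, nsmul_eq_mul, Nat.cast_pow]
    exact dvd_add (P.mem_contractingIdeal.1 (hb 2)).2 (dvd_mul_right _ _)

lemma isDescent_frameHom (hp : 3 ≤ p) :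
    (P.frameHom hp).IsDescent P.contractingIdeal ⟨P.ξ, P.xi_mem_ker⟩ where
  le := inf_le_left
  exists_sub_mem := P.exists_sub_mem_contractingIdeal hp
  σ₁_mem x hx := by
    obtain ⟨y, hy⟩ := (P.mem_contractingIdeal.1 hx).2
    refine ⟨y, P.acris_mul_cancel ?_⟩
    have h := P.p_mul_acrisσ₁ hp ⟨x, (P.mem_contractingIdeal.1 hx).1⟩
    rw [← mul_assoc, ← pow_two, ← hy]
    exact h
  torsionFree := P.acris_torsionFree
  closed := P.exists_algebraMap_eq_of_forall
  injective := P.algebraMap_acris_injective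
  comap a ha := (P.algebraMap_mem_ker_iff a).1 ha
  bijective := WittVector.frobenius_bijective_of_perfect
  σ₁_gen := P.ainfσ₁_xi
  complete := by
    rw [P.ker_eq, sup_comm, ← J_eq]; exact P.isAdicComplete_J
  padic :=
    haveI := WittVector.isAdicComplete_p (p := p) (S := S)
    PadicComplete.of_isAdicComplete
  padic' := P.padicComplete_acris
  padic_ideal := P.padicComplete_contractingIdeal

end PerfectoidPresentation

theorem mainTheorem11 (p : ℕ) [Fact p.Prime] (hp : 3 ≤ p)
    {S : Type u} {R : Type v} [CommRing S] [Algebra (ZMod p) S] [PerfectRing S p] [CommRing R]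
    (P : PerfectoidPresentation p S R) :
    (∀ x : P.Acris, (p : P.Acris) * x = 0 → x = 0) ∧
    ∃ acrisFrame : WindowFrame p P.Acris (RingHom.ker P.acrisToR),
      acrisFrame.σ = P.acrisFrob ∧
      (∀ x : RingHom.ker P.acrisToR, (p : P.Acris) * acrisFrame.σ₁ x = acrisFrame.σ x) ∧
      ∃ lam : WindowFrame.Hom P.ainfFrame acrisFrame,
        lam.baseChange.IsEquivalence :=
  ⟨P.acris_torsionFree, P.acrisFrame hp, rfl, P.p_mul_acrisσ₁ hp, P.frameHom hp,
    (P.isDescent_frameHom hp).isEquivalence⟩
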